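/- **Conventions.** A *symmetric triple* $(\mathfrak g,\sigma,B)$ consists of a finite-dimensional real Lie algebra $\mathfrak g$, an involutive automorphism $\sigma$ of $\mathfrak g$ whose eigenspaces $\mathfrak h=\mathrm{Eig}(\sigma,1)$ and $\mathfrak m=\mathrm{Eig}(\sigma,-1)$ satisfy $\mathfrak h=[\mathfrak m,\mathfrak m]$, and a non-degenerate symmetric bilinear form $B$ on $\mathfrak g$ that is invariant under $\sigma$ and under $\mathrm{ad}(\mathfrak g)$. An isomorphism of symmetric triples is a Lie algebra isomorphism that commutes with the involutions and is an isometry. The triple has signature $(p,q)$ if $B|_{\mathfrak m\times\mathfrak m}$ has $p$ negative and $q$ positive directions. It is indecomposable if $\mathfrak m$ has no non-zero proper subspace that is $\mathrm{ad}(\mathfrak h)$-invariant and on which $B$ is non-degenerate. Write $\mathfrak z$ for the centre of $\mathfrak g$; a triple of signature $(2,n-2)$ is said to have maximal centre if it is indecomposable and $\dim\mathfrak z=2$. For such a triple, an adapted decomposition is a decomposition $\mathfrak m=\mathfrak z\oplus W\oplus\mathfrak z^*$ with $\mathfrak z\oplus W=[\mathfrak h,\mathfrak m]$, with $\mathfrak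 z$ and $\mathfrak z^*$ totally isotropic, and with $\mathfrak z\oplus\mathfrak z^*$ orthogonal to $W$. Let $W_{nil}$ be the common kernel in $W$ of the operators $\mathrm{pr}_W\circ\mathrm{ad}(a)\circ\mathrm{ad}(b)$, $a,b\in\mathfrak z^*$. Say that a triple is *of type (IIa)* for $n$ if it has signature $(2,n-2)$ and maximal centre and, for some adapted decomposition, $\dim W_{nil}=1$. **Normal form.** Let $n\ge5$, $r\in\{0,\dots,n-5\}$, and let $\lambda=(\lambda_1,\lambda_2)$ with $\lambda_1,\lambda_2\in\mathbb R^{n-5}$ and $(\lambda_1^\alpha,\lambda_2^\alpha)\neq(0,0)$ for all $\alpha$. Put $\varepsilon_\alpha=-1$ for $\alpha\le r$ and $\varepsilon_\alpha=1$ for $\alpha>r$. Then $\tau_n(r,\lambda,1)$ is the symmetric triple with $\mathfrak h$ spanned by the basis $y,W_1^*,\dots,W_{n-5}^*,w^*$ and $\mathfrak m$ by the basis $Z_1,Z_2,W_1,\dots,W_{n-5},w,Z_1^*,Z_2^*$, with $$[Z_1^*,Z_2^*]=y,\quad [Z_1^*,w]=w^*,\quad [Z_i^*,W_\alpha]=\lambda_i^\alpha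 W_\alpha^*,$$ $$[y,Z_1^*]=w,\quad [y,w]=-Z_1,\quad [w^*,Z_1^*]=Z_2,\quad [w^*,Z_2^*]=-Z_1,$$ $$[W_\alpha^*,Z_i^*]=\varepsilon_\alpha\lambda_i^\alpha W_\alpha,\quad [W_\alpha^*,W_\beta]=-\delta_{\alpha\beta}\,\varepsilon_\alpha(\lambda_1^\alpha Z_1+\lambda_2^\alpha Z_2),$$ all other brackets of basis vectors being zero up to skew-symmetry, and with $$B(y,w^*)=1,\quad B(W_\alpha^*,W_\alpha^*)=\varepsilon_\alpha,\quad B(Z_i,Z_i^*)=1,\quad B(W_\alpha,W_\alpha)=1,\quad B(w,w)=1,$$ all other products of basis vectors being zero up to symmetry. **Proposition.** (1) Let $n\ge5$. Every symmetric triple of type (IIa) for $n$ is isomorphic to some $\tau_n(r,\lambda,1)$. Conversely every $\tau_n(r,\lambda,1)$ is of type (IIa) for $n$, and its Lie algebra is solvable. (2) Let $n\ge6$. The group $\mathcal S_r\times\mathcal S_{n-r-5}\times\{\pm1\}^{n-5}$ acts on $\mathbb R^{n-5}$ by permutations of the coordinates that preserve $\{1,\dots,r\}$, combined with sign changes of coordinates;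 let $e_\alpha^\perp$ be the coordinate hyperplanes. The isomorphism classes of symmetric triples of type (IIa) for $n$ are in one-to-one correspondence with the disjoint union of the following two families: * classes $(r,k,[l])$ with $r\in\{0,\dots,n-5\}$, $k\in\{1,2\}$ and $l\in S^{n-6}\subset\mathbb R^{n-5}$, $l\notin\bigcup_\alpha e_\alpha^\perp$, where $[l]$ is the class of $l$ modulo $\mathcal S_r\times\mathcal S_{n-r-5}\times\{\pm1\}^{n-5}$; this class corresponds to the isomorphism class of $\tau_n(r,\lambda,1)$ with $\lambda_i=\delta_{ik}\,l$; * classes $(r,\delta,[l_1,l_2])$ with $r\in\{0,\dots,n-5\}$, $\delta>0$ and $(l_1,l_2)$ an orthonormal pair in $\mathbb R^{n-5}$ with $\mathrm{span}\{l_1,l_2\}\not\subset\bigcup_\alpha e_\alpha^\perp$, where $[l_1,l_2]$ is the class of $(l_1,l_2)$ modulo $(l_1,l_2)\sim(-l_1,l_2)$ (so that $l_1$ represents a point of $\mathbb RP^{n-6}$ and $l_2$ is a unit vector orthogonal to it) and modulo the simultaneous action of $\mathcal S_r\times\mathcal S_{n-r-5}\times\{\pm1\}^{n-5}$ on $l_1$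 and $l_2$; this class corresponds to the isomorphism class of $\tau_n(r,\lambda,1)$ with $(\lambda_1,\lambda_2)=(\delta l_1,\delta l_2)$. The isomorphism class of $\tau_n(r,\lambda,1)$ belongs to the first family if and only if the $2\times(n-5)$ matrix $(\lambda_i^\alpha)$ has rank $1$, and to the second if and only if it has rank $2$. -/

import Mathlib

universe u v

/-- A symmetric triple `(𝔤, σ, B)`: a finite dimensional real Lie algebra `𝔤`, an involutive
automorphism `σ` whose eigenspaces `𝔥 = Eig(σ, 1)` and `𝔪 = Eig(σ, -1)` satisfy `𝔥 = [𝔪, 𝔪]`,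
and a non-degenerate symmetric bilinear form `B` invariant under `σ` and under `ad 𝔤`. -/
structure SymmetricTriple where
  /-- the Lie algebra -/
  g : Type u
  [lieRing : LieRing g]
  [lieAlgebra : LieAlgebra ℝ g]
  [finite : Module.Finite ℝ g]
  /-- the involution -/
  σ : g ≃ₗ⁅ℝ⁆ g
  σ_invol : ∀ x : g, σ (σ x) = x
  span_bracket : Module.End.eigenspace (σ : g →ₗ[ℝ] g) 1 =
    Submodule.span ℝ {z | ∃ x ∈ Module.End.eigenspace (σ : g →ₗ[ℝ] g) (-1),
      ∃ y ∈ Module.End.eigenspace (σ : g →ₗ[ℝ] g) (-1), ⁅(x : g), (y : g)⁆ = z}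
  /-- the scalar product -/
  B : LinearMap.BilinForm ℝ g
  B_symm : ∀ x y : g, B x y = B y x
  B_nondeg : ∀ x : g, (∀ y : g, B x y = 0) → x = 0
  B_sigma : ∀ x y : g, B (σ x) (σ y) = B x y
  B_ad : ∀ x y z : g, B ⁅x, y⁆ z = - B y ⁅x, z⁆

attribute [instance] SymmetricTriple.lieRing SymmetricTriple.lieAlgebra SymmetricTriple.finite

namespace SymmetricTriple

/-- `𝔥`, the `+1`-eigenspace of the involution. -/
def h (τ : SymmetricTriple) : Submodule ℝ τ.g :=
  Module.End.eigenspace (τ.σ : τ.g →ₗ[ℝ] τ.g) 1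

/-- `𝔪`, the `-1`-eigenspace of the involution. -/
def m (τ : SymmetricTriple) : Submodule ℝ τ.g :=
  Module.End.eigenspace (τ.σ : τ.g →ₗ[ℝ] τ.g) (-1)

/-- `[𝔥, 𝔪]`, the span of all brackets. -/
def hm (τ : SymmetricTriple) : Submodule ℝ τ.g :=
  Submodule.span ℝ {z | ∃ x ∈ τ.h, ∃ y ∈ τ.m, ⁅x, y⁆ = z}

/-- `𝔷`, the centre of `𝔤`. -/
def z (τ : SymmetricTriple) : Submodule ℝ τ.g :=
  (LieAlgebra.center ℝ τ.g).toSubmodule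

/-- The triple has signature `(p, q)`: the restriction of `B` to `𝔪` has `p` negative and
`q` positive directions. -/
def HasSignature (τ : SymmetricTriple) (p q : ℕ) : Prop :=
  sigNeg (τ.B.restrict τ.m).toQuadraticMap = p ∧
  sigPos (τ.B.restrict τ.m).toQuadraticMap = q

/-- `𝔪` has no proper non-zero subspace that is non-singular and `ad 𝔥`-invariant. -/
def Indecomposable (τ : SymmetricTriple) : Prop :=
  ∀ V : Submodule ℝ τ.g, V ≤ τ.m →
    (∀ x ∈ τ.h, ∀ v ∈ V, ⁅x, v⁆ ∈ V) →
    (∀ v ∈ V, (∀ w ∈ V, τ.B v w = 0) → v = 0) →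
    V = ⊥ ∨ V = τ.m

/-- An adapted decomposition `𝔪 = 𝔷 ⊕ W ⊕ 𝔷*`: here `𝔷 ⊕ W = [𝔥, 𝔪]`, the subspaces `𝔷` and `𝔷*`
are totally isotropic, and `𝔷 ⊕ 𝔷*` is orthogonal to `W`. -/
structure IsAdaptedDecomposition (τ : SymmetricTriple) (W Zd : Submodule ℝ τ.g) : Prop where
  disjoint_z_W : Disjoint τ.z W
  z_sup_W : τ.z ⊔ W = τ.hm
  disjoint_Zd : Disjoint (τ.z ⊔ W) Zd
  sup_Zd : τ.z ⊔ W ⊔ Zd = τ.m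
  z_isotropic : ∀ x ∈ τ.z, ∀ y ∈ τ.z, τ.B x y = 0
  Zd_isotropic : ∀ x ∈ Zd, ∀ y ∈ Zd, τ.B x y = 0
  orthogonal : ∀ x ∈ τ.z ⊔ Zd, ∀ w ∈ W, τ.B x w = 0

/-- `W_nil`, the common kernel in `W` of the operators `pr_W ∘ ad a ∘ ad b` for `a, b ∈ 𝔷*`;
`pr_W` is the projection of `𝔪 = 𝔷 ⊕ W ⊕ 𝔷*` onto `W`, whose kernel is `𝔷 ⊕ 𝔷*`. -/
def Wnil (τ : SymmetricTriple) (W Zd : Submodule ℝ τ.g) : Submodule ℝ τ.g where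
  carrier := {w | w ∈ W ∧ ∀ a ∈ Zd, ∀ b ∈ Zd, ⁅a, ⁅b, w⁆⁆ ∈ τ.z ⊔ Zd}
  zero_mem' := ⟨W.zero_mem, fun a _ b _ => by simp⟩
  add_mem' := fun hx hy => ⟨W.add_mem hx.1 hy.1, fun a ha b hb => by
    rw [lie_add, lie_add]
    exact Submodule.add_mem _ (hx.2 a ha b hb) (hy.2 a ha b hb)⟩
  smul_mem' := fun c x hx => ⟨W.smul_mem c hx.1, fun a ha b hb => by
    rw [lie_smul, lie_smul]
    exact Submodule.smul_mem _ c (hx.2 a ha b hb)⟩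

/-- The class under consideration: indecomposable triples of signature `(2, n - 2)` with maximal
(that is, two-dimensional) centre and `dim W_nil = 1`. -/
structure IsTypeIIa (τ : SymmetricTriple) (n : ℕ) : Prop where
  signature : τ.HasSignature 2 (n - 2)
  indecomposable : τ.Indecomposable
  finrank_center : Module.finrank ℝ τ.z = 2
  finrank_Wnil : ∃ W Zd : Submodule ℝ τ.g,
    τ.IsAdaptedDecomposition W Zd ∧ Module.finrank ℝ (τ.Wnil W Zd) = 1

/-- Isomorphism of symmetric triples: a Lie algebra isomorphism that commutes with the involutions
and is an isometry. -/
def Isomorphic (τ₁ : SymmetricTriple.{u}) (τ₂ : SymmetricTriple.{v}) : Prop :=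
  ∃ Φ : τ₁.g ≃ₗ⁅ℝ⁆ τ₂.g,
    (∀ x, Φ (τ₁.σ x) = τ₂.σ (Φ x)) ∧ ∀ x y, τ₂.B (Φ x) (Φ y) = τ₁.B x y

theorem Isomorphic.refl (τ : SymmetricTriple) : τ.Isomorphic τ :=
  ⟨LieEquiv.refl, fun _ => rfl, fun _ _ => rfl⟩

theorem Isomorphic.symm {τ₁ τ₂ : SymmetricTriple} (H : τ₁.Isomorphic τ₂) : τ₂.Isomorphic τ₁ := by
  obtain ⟨Φ, h1, h2⟩ := H
  refine ⟨Φ.symm, fun x => ?_, fun x y => ?_⟩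
  · have := congrArg Φ.symm (h1 (Φ.symm x))
    rw [LieEquiv.symm_apply_apply, LieEquiv.apply_symm_apply] at this
    exact this.symm
  · rw [← h2, LieEquiv.apply_symm_apply, LieEquiv.apply_symm_apply]

theorem Isomorphic.trans {τ₁ τ₂ τ₃ : SymmetricTriple} (H : τ₁.Isomorphic τ₂)
    (H' : τ₂.Isomorphic τ₃) : τ₁.Isomorphic τ₃ := by
  obtain ⟨Φ, h1, h2⟩ := H
  obtain ⟨Ψ, k1, k2⟩ := H'
  refine ⟨Φ.trans Ψ, fun x => ?_, fun x y => ?_⟩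
  · simp only [LieEquiv.trans_apply, h1, k1]
  · simp only [LieEquiv.trans_apply, h2, k2]

instance isoSetoid : Setoid SymmetricTriple.{0} where
  r := Isomorphic
  iseqv := ⟨Isomorphic.refl, Isomorphic.symm, Isomorphic.trans⟩

/-- Isomorphism classes of symmetric triples. -/
abbrev IsoClass : Type 1 := Quotient isoSetoid

end SymmetricTriple

/-- The vector space `𝔤 = 𝔥 ⊕ 𝔪` of the normal form `τ_n(r, λ, 1)` with `s = n - 5`: coordinates with
respect to the basis `y, W*_1, …, W*_s, w*` of `𝔥` and `Z_1, Z_2, W_1, …, W_s, w, Z*_1, Z*_2` of `𝔪`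
(a letter `d` stands for the star). The parameters `r` and `λ` enter the bracket only. -/
@[ext] structure TauSpace {s : ℕ} (r : ℕ) (lam : Fin 2 → Fin s → ℝ) where
  y : ℝ
  Wd : Fin s → ℝ
  wd : ℝ
  Z1 : ℝ
  Z2 : ℝ
  W : Fin s → ℝ
  w : ℝ
  Zd1 : ℝ
  Zd2 : ℝ

namespace TauSpace

section
variable {s : ℕ} {r : ℕ} {lam : Fin 2 → Fin s → ℝ}

/-- The coordinates as a tuple. -/
def equivProd : TauSpace r lam ≃
    (ℝ × (Fin s → ℝ) × ℝ) × ((ℝ × ℝ) × (Fin s → ℝ) × ℝ × (ℝ × ℝ)) where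
  toFun a := ((a.y, a.Wd, a.wd), ((a.Z1, a.Z2), a.W, a.w, (a.Zd1, a.Zd2)))
  invFun p := ⟨p.1.1, p.1.2.1, p.1.2.2, p.2.1.1, p.2.1.2, p.2.2.1, p.2.2.2.1,
    p.2.2.2.2.1, p.2.2.2.2.2⟩
  left_inv _ := rfl
  right_inv _ := rfl

instance : AddCommGroup (TauSpace r lam) := equivProd.addCommGroup

instance : Module ℝ (TauSpace r lam) := equivProd.module ℝ

/-- The coordinates as a linear equivalence. -/
def linEquivProd : TauSpace r lam ≃ₗ[ℝ]
    (ℝ × (Fin s → ℝ) × ℝ) × ((ℝ × ℝ) × (Fin s → ℝ) × ℝ × (ℝ × ℝ)) :=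
  { equivProd with
    map_add' := fun _ _ => rfl
    map_smul' := fun _ _ => rfl }

instance : Module.Finite ℝ (TauSpace r lam) := Module.Finite.equiv linEquivProd.symm

@[simp] theorem add_y (a b : TauSpace r lam) : (a + b).y = a.y + b.y := rfl
@[simp] theorem add_Wd (a b : TauSpace r lam) : (a + b).Wd = a.Wd + b.Wd := rfl
@[simp] theorem add_wd (a b : TauSpace r lam) : (a + b).wd = a.wd + b.wd := rfl
@[simp] theorem add_Z1 (a b : TauSpace r lam) : (a + b).Z1 = a.Z1 + b.Z1 := rfl
@[simp] theorem add_Z2 (a b : TauSpace r lam) : (a + b).Z2 = a.Z2 + b.Z2 := rfl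
@[simp] theorem add_W (a b : TauSpace r lam) : (a + b).W = a.W + b.W := rfl
@[simp] theorem add_w (a b : TauSpace r lam) : (a + b).w = a.w + b.w := rfl
@[simp] theorem add_Zd1 (a b : TauSpace r lam) : (a + b).Zd1 = a.Zd1 + b.Zd1 := rfl
@[simp] theorem add_Zd2 (a b : TauSpace r lam) : (a + b).Zd2 = a.Zd2 + b.Zd2 := rfl

@[simp] theorem smul_y (c : ℝ) (a : TauSpace r lam) : (c • a).y = c * a.y := rfl
@[simp] theorem smul_Wd (c : ℝ) (a : TauSpace r lam) : (c • a).Wd = c • a.Wd := rfl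
@[simp] theorem smul_wd (c : ℝ) (a : TauSpace r lam) : (c • a).wd = c * a.wd := rfl
@[simp] theorem smul_Z1 (c : ℝ) (a : TauSpace r lam) : (c • a).Z1 = c * a.Z1 := rfl
@[simp] theorem smul_Z2 (c : ℝ) (a : TauSpace r lam) : (c • a).Z2 = c * a.Z2 := rfl
@[simp] theorem smul_W (c : ℝ) (a : TauSpace r lam) : (c • a).W = c • a.W := rfl
@[simp] theorem smul_w (c : ℝ) (a : TauSpace r lam) : (c • a).w = c * a.w := rfl
@[simp] theorem smul_Zd1 (c : ℝ) (a : TauSpace r lam) : (c • a).Zd1 = c * a.Zd1 := rfl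
@[simp] theorem smul_Zd2 (c : ℝ) (a : TauSpace r lam) : (c • a).Zd2 = c * a.Zd2 := rfl

@[simp] theorem zero_y : (0 : TauSpace r lam).y = 0 := rfl
@[simp] theorem zero_Wd : (0 : TauSpace r lam).Wd = 0 := rfl
@[simp] theorem zero_wd : (0 : TauSpace r lam).wd = 0 := rfl
@[simp] theorem zero_Z1 : (0 : TauSpace r lam).Z1 = 0 := rfl
@[simp] theorem zero_Z2 : (0 : TauSpace r lam).Z2 = 0 := rfl
@[simp] theorem zero_W : (0 : TauSpace r lam).W = 0 := rfl
@[simp] theorem zero_w : (0 : TauSpace r lam).w = 0 := rfl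
@[simp] theorem zero_Zd1 : (0 : TauSpace r lam).Zd1 = 0 := rfl
@[simp] theorem zero_Zd2 : (0 : TauSpace r lam).Zd2 = 0 := rfl

@[simp] theorem neg_y (a : TauSpace r lam) : (-a).y = -a.y := rfl
@[simp] theorem neg_Wd (a : TauSpace r lam) : (-a).Wd = -a.Wd := rfl
@[simp] theorem neg_wd (a : TauSpace r lam) : (-a).wd = -a.wd := rfl
@[simp] theorem neg_Z1 (a : TauSpace r lam) : (-a).Z1 = -a.Z1 := rfl
@[simp] theorem neg_Z2 (a : TauSpace r lam) : (-a).Z2 = -a.Z2 := rfl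
@[simp] theorem neg_W (a : TauSpace r lam) : (-a).W = -a.W := rfl
@[simp] theorem neg_w (a : TauSpace r lam) : (-a).w = -a.w := rfl
@[simp] theorem neg_Zd1 (a : TauSpace r lam) : (-a).Zd1 = -a.Zd1 := rfl
@[simp] theorem neg_Zd2 (a : TauSpace r lam) : (-a).Zd2 = -a.Zd2 := rfl

/-- The signs: `ε_α = -1` for the first `r` indices and `ε_α = 1` for the others. -/
def eps {s : ℕ} (r : ℕ) (α : Fin s) : ℝ := if (α : ℕ) < r then -1 else 1

/-- For `a` with `𝔷*`-component `Σ t_i Z*_i`, the number `Σ t_i λ_i^α`. -/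
def pair (a : TauSpace r lam) (α : Fin s) : ℝ := a.Zd1 * lam 0 α + a.Zd2 * lam 1 α

/-- The bilinear extension of the bracket relations
`[Z*_1, Z*_2] = y`, `[Z*_1, w] = w*`, `[Z*_i, W_α] = λ_i^α W*_α`,
`[y, Z*_1] = w`, `[y, w] = -Z_1`, `[w*, Z*_1] = Z_2`, `[w*, Z*_2] = -Z_1`,
`[W*_α, Z*_i] = ε_α λ_i^α W_α`, `[W*_α, W_β] = -δ_αβ ε_α (λ_1^α Z_1 + λ_2^α Z_2)`,
all other brackets of basis vectors being zero up to skew symmetry. -/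
instance : Bracket (TauSpace r lam) (TauSpace r lam) where
  bracket a b :=
    { y := a.Zd1 * b.Zd2 - a.Zd2 * b.Zd1
      Wd := fun α => a.pair α * b.W α - a.W α * b.pair α
      wd := a.Zd1 * b.w - a.w * b.Zd1
      Z1 := -(a.y * b.w - a.w * b.y) - (a.wd * b.Zd2 - a.Zd2 * b.wd)
        - ∑ α, eps r α * lam 0 α * (a.Wd α * b.W α - a.W α * b.Wd α)
      Z2 := (a.wd * b.Zd1 - a.Zd1 * b.wd)
        - ∑ α, eps r α * lam 1 α * (a.Wd α * b.W α - a.W α * b.Wd α)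
      W := fun α => eps r α * (a.Wd α * b.pair α - a.pair α * b.Wd α)
      w := a.y * b.Zd1 - a.Zd1 * b.y
      Zd1 := 0
      Zd2 := 0 }

theorem lie_def (a b : TauSpace r lam) : ⁅a, b⁆ =
    { y := a.Zd1 * b.Zd2 - a.Zd2 * b.Zd1
      Wd := fun α => a.pair α * b.W α - a.W α * b.pair α
      wd := a.Zd1 * b.w - a.w * b.Zd1
      Z1 := -(a.y * b.w - a.w * b.y) - (a.wd * b.Zd2 - a.Zd2 * b.wd)
        - ∑ α, eps r α * lam 0 α * (a.Wd α * b.W α - a.W α * b.Wd α)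
      Z2 := (a.wd * b.Zd1 - a.Zd1 * b.wd)
        - ∑ α, eps r α * lam 1 α * (a.Wd α * b.W α - a.W α * b.Wd α)
      W := fun α => eps r α * (a.Wd α * b.pair α - a.pair α * b.Wd α)
      w := a.y * b.Zd1 - a.Zd1 * b.y
      Zd1 := 0
      Zd2 := 0 } := rfl

instance : LieRing (TauSpace r lam) where
  add_lie a b c := by
    ext
    · simp [lie_def]; ring
    · simp [lie_def, pair]; ring
    · simp [lie_def]; ring
    · simp only [lie_def, add_y, add_w, add_wd, add_Zd2, add_Wd, add_W, Pi.add_apply, add_Z1]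
      have : ∀ α : Fin s, eps r α * lam 0 α * ((a.Wd α + b.Wd α) * c.W α - (a.W α + b.W α) * c.Wd α)
        = eps r α * lam 0 α * (a.Wd α * c.W α - a.W α * c.Wd α)
          + eps r α * lam 0 α * (b.Wd α * c.W α - b.W α * c.Wd α) := fun α => by ring
      simp only [this, Finset.sum_add_distrib]
      ring
    · simp only [lie_def, add_wd, add_Zd1, add_Wd, add_W, Pi.add_apply, add_Z2]
      have : ∀ α : Fin s, eps r α * lam 1 α * ((a.Wd α + b.Wd α) * c.W α - (a.W α + b.W α) * c.Wd α)
        = eps r α * lam 1 α * (a.Wd α * c.W α - a.W α * c.Wd α)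
          + eps r α * lam 1 α * (b.Wd α * c.W α - b.W α * c.Wd α) := fun α => by ring
      simp only [this, Finset.sum_add_distrib]
      ring
    · simp [lie_def, pair]; ring
    · simp [lie_def]; ring
    · simp [lie_def]
    · simp [lie_def]
  lie_add a b c := by
    ext
    · simp [lie_def]; ring
    · simp [lie_def, pair]; ring
    · simp [lie_def]; ring
    · simp only [lie_def, add_y, add_w, add_wd, add_Zd2, add_Wd, add_W, Pi.add_apply, add_Z1]
      have : ∀ α : Fin s, eps r α * lam 0 α * (a.Wd α * (b.W α + c.W α) - a.W α * (b.Wd α + c.Wd α))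
        = eps r α * lam 0 α * (a.Wd α * b.W α - a.W α * b.Wd α)
          + eps r α * lam 0 α * (a.Wd α * c.W α - a.W α * c.Wd α) := fun α => by ring
      simp only [this, Finset.sum_add_distrib]
      ring
    · simp only [lie_def, add_wd, add_Zd1, add_Wd, add_W, Pi.add_apply, add_Z2]
      have : ∀ α : Fin s, eps r α * lam 1 α * (a.Wd α * (b.W α + c.W α) - a.W α * (b.Wd α + c.Wd α))
        = eps r α * lam 1 α * (a.Wd α * b.W α - a.W α * b.Wd α)
          + eps r α * lam 1 α * (a.Wd α * c.W α - a.W α * c.Wd α) := fun α => by ring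
      simp only [this, Finset.sum_add_distrib]
      ring
    · simp [lie_def, pair]; ring
    · simp [lie_def]; ring
    · simp [lie_def]
    · simp [lie_def]
  lie_self a := by
    ext <;> simp [lie_def, mul_comm]
  leibniz_lie a b c := by
    ext
    · simp [lie_def]
    · simp [lie_def, pair]; ring
    · simp [lie_def]; ring
    · simp only [lie_def, pair, add_Z1]
      have e : ∀ (A B C A' B' C' : ℝ) (f g h : Fin s → ℝ), A = B + C →
          (∀ α, f α = g α + h α) →
          A - ∑ α, f α = B - ∑ α, g α + (C - ∑ α, h α) := by
        intro A B C A' B' C' f g h h1 h2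
        simp only [h2, Finset.sum_add_distrib, h1]
        ring
      refine e _ _ _ 0 0 0 _ _ _ ?_ (fun α => ?_) <;> ring
    · simp only [lie_def, pair, add_Z2]
      have e : ∀ (A B C : ℝ) (f g h : Fin s → ℝ), A = B + C →
          (∀ α, f α = g α + h α) →
          A - ∑ α, f α = B - ∑ α, g α + (C - ∑ α, h α) := by
        intro A B C f g h h1 h2
        simp only [h2, Finset.sum_add_distrib, h1]
        ring
      refine e _ _ _ _ _ _ ?_ (fun α => ?_) <;> ring
    · simp [lie_def, pair]; ring
    · simp [lie_def]; ring
    · simp [lie_def]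
    · simp [lie_def]

instance : LieAlgebra ℝ (TauSpace r lam) where
  lie_smul t a b := by
    ext
    · simp [lie_def]; ring
    · simp [lie_def, pair]; ring
    · simp [lie_def]; ring
    · simp only [lie_def, smul_y, smul_w, smul_wd, smul_Zd2, smul_Wd, smul_W, Pi.smul_apply,
        smul_Z1, smul_eq_mul, mul_sub, Finset.mul_sum, Finset.sum_sub_distrib]
      have : ∀ x y : Fin s → ℝ, (∀ α, x α = y α) → ∑ α, x α = ∑ α, y α :=
        fun x y h => Finset.sum_congr rfl (fun α _ => h α)
      rw [this (fun α => eps r α * lam 0 α * (a.Wd α * (t * b.W α)))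
          (fun α => t * (eps r α * lam 0 α * (a.Wd α * b.W α))) (fun α => by ring),
        this (fun α => eps r α * lam 0 α * (a.W α * (t * b.Wd α)))
          (fun α => t * (eps r α * lam 0 α * (a.W α * b.Wd α))) (fun α => by ring)]
      ring
    · simp only [lie_def, smul_wd, smul_Zd1, smul_Wd, smul_W, Pi.smul_apply,
        smul_Z2, smul_eq_mul, mul_sub, Finset.mul_sum, Finset.sum_sub_distrib]
      have : ∀ x y : Fin s → ℝ, (∀ α, x α = y α) → ∑ α, x α = ∑ α, y α :=
        fun x y h => Finset.sum_congr rfl (fun α _ => h α)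
      rw [this (fun α => eps r α * lam 1 α * (a.Wd α * (t * b.W α)))
          (fun α => t * (eps r α * lam 1 α * (a.Wd α * b.W α))) (fun α => by ring),
        this (fun α => eps r α * lam 1 α * (a.W α * (t * b.Wd α)))
          (fun α => t * (eps r α * lam 1 α * (a.W α * b.Wd α))) (fun α => by ring)]
      ring
    · simp [lie_def, pair]; ring
    · simp [lie_def]; ring
    · simp [lie_def]
    · simp [lie_def]

/-- The involution: `+1` on `𝔥` and `-1` on `𝔪`. -/
def sigma : TauSpace r lam ≃ₗ⁅ℝ⁆ TauSpace r lam where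
  toFun a := ⟨a.y, a.Wd, a.wd, -a.Z1, -a.Z2, -a.W, -a.w, -a.Zd1, -a.Zd2⟩
  map_add' a b := by ext <;> simp <;> ring
  map_smul' c a := by ext <;> simp
  map_lie' := by
    intro a b
    ext
    · simp [lie_def]
    · simp [lie_def, pair]; ring
    · simp [lie_def]
    · have : ∀ α : Fin s, a.Wd α * -b.W α - -a.W α * b.Wd α
        = -(a.Wd α * b.W α - a.W α * b.Wd α) := fun α => by ring
      have hs : ∀ f : Fin s → ℝ, ∑ α, f α * -(a.Wd α * b.W α - a.W α * b.Wd α)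
          = -∑ α, f α * (a.Wd α * b.W α - a.W α * b.Wd α) := fun f => by
        rw [← Finset.sum_neg_distrib]
        exact Finset.sum_congr rfl fun α _ => by ring
      simp only [lie_def, Pi.neg_apply, this, hs]
      ring
    · have : ∀ α : Fin s, a.Wd α * -b.W α - -a.W α * b.Wd α
        = -(a.Wd α * b.W α - a.W α * b.Wd α) := fun α => by ring
      have hs : ∀ f : Fin s → ℝ, ∑ α, f α * -(a.Wd α * b.W α - a.W α * b.Wd α)
          = -∑ α, f α * (a.Wd α * b.W α - a.W α * b.Wd α) := fun f => by
        rw [← Finset.sum_neg_distrib]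
        exact Finset.sum_congr rfl fun α _ => by ring
      simp only [lie_def, Pi.neg_apply, this, hs]
      ring
    · simp [lie_def, pair]; ring
    · simp [lie_def]; ring
    · simp [lie_def]
    · simp [lie_def]
  invFun a := ⟨a.y, a.Wd, a.wd, -a.Z1, -a.Z2, -a.W, -a.w, -a.Zd1, -a.Zd2⟩
  left_inv a := by ext <;> simp
  right_inv a := by ext <;> simp

theorem sigma_apply (a : TauSpace r lam) :
    sigma a = ⟨a.y, a.Wd, a.wd, -a.Z1, -a.Z2, -a.W, -a.w, -a.Zd1, -a.Zd2⟩ := rfl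

/-- The scalar product: `B(y, w*) = 1`, `B(W*_α, W*_α) = ε_α`, `B(Z_i, Z*_i) = 1`,
`B(W_α, W_α) = 1`, `B(w, w) = 1`, all other products of basis vectors being zero
up to symmetry. -/
def form : LinearMap.BilinForm ℝ (TauSpace r lam) :=
  LinearMap.mk₂ ℝ (fun a b =>
      (a.y * b.wd + a.wd * b.y + ∑ α, eps r α * (a.Wd α * b.Wd α))
      + (a.Z1 * b.Zd1 + a.Z2 * b.Zd2 + a.Zd1 * b.Z1 + a.Zd2 * b.Z2
        + ∑ α, a.W α * b.W α + a.w * b.w))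
    (fun a b c => by
      simp only [add_y, add_Wd, add_wd, add_Z1, add_Z2, add_W, add_w, add_Zd1, add_Zd2,
        Pi.add_apply, add_mul, mul_add, Finset.sum_add_distrib]
      ring)
    (fun t a b => by
      simp only [smul_y, smul_Wd, smul_wd, smul_Z1, smul_Z2, smul_W, smul_w, smul_Zd1, smul_Zd2,
        Pi.smul_apply, smul_eq_mul, mul_add, Finset.mul_sum]
      simp only [mul_assoc, mul_left_comm t])
    (fun a b c => by
      simp only [add_y, add_Wd, add_wd, add_Z1, add_Z2, add_W, add_w, add_Zd1, add_Zd2,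
        Pi.add_apply, mul_add, Finset.sum_add_distrib]
      ring)
    (fun t a b => by
      simp only [smul_y, smul_Wd, smul_wd, smul_Z1, smul_Z2, smul_W, smul_w, smul_Zd1, smul_Zd2,
        Pi.smul_apply, smul_eq_mul, mul_add, Finset.mul_sum]
      simp only [mul_left_comm _ t])

theorem form_apply (a b : TauSpace r lam) : form a b =
    (a.y * b.wd + a.wd * b.y + ∑ α, eps r α * (a.Wd α * b.Wd α))
      + (a.Z1 * b.Zd1 + a.Z2 * b.Zd2 + a.Zd1 * b.Z1 + a.Zd2 * b.Z2
        + ∑ α, a.W α * b.W α + a.w * b.w) := rfl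

theorem eps_mul_self (α : Fin s) : eps r α * eps r α = 1 := by
  unfold eps; split_ifs <;> norm_num

theorem mem_h_iff (a : TauSpace r lam) :
    a ∈ Module.End.eigenspace ((sigma : TauSpace r lam ≃ₗ⁅ℝ⁆ TauSpace r lam) :
      TauSpace r lam →ₗ[ℝ] TauSpace r lam) 1 ↔
      a.Z1 = 0 ∧ a.Z2 = 0 ∧ a.W = 0 ∧ a.w = 0 ∧ a.Zd1 = 0 ∧ a.Zd2 = 0 := by
  rw [Module.End.mem_eigenspace_iff, one_smul]
  change sigma a = a ↔ _
  rw [sigma_apply, TauSpace.ext_iff]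
  simp only [true_and, neg_eq_self]

theorem mem_m_iff (a : TauSpace r lam) :
    a ∈ Module.End.eigenspace ((sigma : TauSpace r lam ≃ₗ⁅ℝ⁆ TauSpace r lam) :
      TauSpace r lam →ₗ[ℝ] TauSpace r lam) (-1) ↔
      a.y = 0 ∧ a.Wd = 0 ∧ a.wd = 0 := by
  rw [Module.End.mem_eigenspace_iff]
  change sigma a = _ ↔ _
  have hf : a.Wd = -a.Wd ↔ a.Wd = 0 := self_eq_neg
  rw [sigma_apply, TauSpace.ext_iff]
  simp [hf, self_eq_neg]

theorem form_symm (a b : TauSpace r lam) : form a b = form b a := by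
  simp only [form_apply]
  simp only [mul_comm (a.Wd _), mul_comm (a.W _)]
  ring

theorem form_nondeg (a : TauSpace r lam) (ha : ∀ b, form a b = 0) : a = 0 := by
  have key : ∀ α : Fin s, eps r α * (eps r α * a.Wd α) = a.Wd α := fun α => by
    rw [← mul_assoc, eps_mul_self, one_mul]
  have h1 := ha ⟨a.wd, fun α => eps r α * a.Wd α, a.y, a.Zd1, a.Zd2, a.W, a.w, a.Z1, a.Z2⟩
  simp only [form_apply] at h1
  have h2 : ∀ α : Fin s, eps r α * (a.Wd α * (eps r α * a.Wd α)) = a.Wd α * a.Wd α :=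
    fun α => by rw [mul_left_comm, key]
  simp only [h2] at h1
  have p1 : 0 ≤ ∑ α, a.Wd α * a.Wd α := Finset.sum_nonneg fun α _ => mul_self_nonneg _
  have p2 : 0 ≤ ∑ α, a.W α * a.W α := Finset.sum_nonneg fun α _ => mul_self_nonneg _
  have q1 : ∑ α, a.Wd α * a.Wd α = 0 := by
    nlinarith [mul_self_nonneg a.y, mul_self_nonneg a.wd, mul_self_nonneg a.Z1,
      mul_self_nonneg a.Z2, mul_self_nonneg a.Zd1, mul_self_nonneg a.Zd2, mul_self_nonneg a.w]
  have q2 : ∑ α, a.W α * a.W α = 0 := by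
    nlinarith [mul_self_nonneg a.y, mul_self_nonneg a.wd, mul_self_nonneg a.Z1,
      mul_self_nonneg a.Z2, mul_self_nonneg a.Zd1, mul_self_nonneg a.Zd2, mul_self_nonneg a.w]
  rw [q1, q2] at h1
  rw [Finset.sum_eq_zero_iff_of_nonneg (fun α _ => mul_self_nonneg _)] at q1 q2
  have z : ∀ t : ℝ, t * t ≤ 0 → t = 0 := fun t ht =>
    mul_self_eq_zero.mp (le_antisymm ht (mul_self_nonneg t))
  ext
  · exact z _ (by nlinarith [mul_self_nonneg a.y, mul_self_nonneg a.wd, mul_self_nonneg a.Z1,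
      mul_self_nonneg a.Z2, mul_self_nonneg a.Zd1, mul_self_nonneg a.Zd2, mul_self_nonneg a.w])
  · exact mul_self_eq_zero.mp (q1 _ (Finset.mem_univ _))
  · exact z _ (by nlinarith [mul_self_nonneg a.y, mul_self_nonneg a.wd, mul_self_nonneg a.Z1,
      mul_self_nonneg a.Z2, mul_self_nonneg a.Zd1, mul_self_nonneg a.Zd2, mul_self_nonneg a.w])
  · exact z _ (by nlinarith [mul_self_nonneg a.y, mul_self_nonneg a.wd, mul_self_nonneg a.Z1,
      mul_self_nonneg a.Z2, mul_self_nonneg a.Zd1, mul_self_nonneg a.Zd2, mul_self_nonneg a.w])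
  · exact z _ (by nlinarith [mul_self_nonneg a.y, mul_self_nonneg a.wd, mul_self_nonneg a.Z1,
      mul_self_nonneg a.Z2, mul_self_nonneg a.Zd1, mul_self_nonneg a.Zd2, mul_self_nonneg a.w])
  · exact mul_self_eq_zero.mp (q2 _ (Finset.mem_univ _))
  · exact z _ (by nlinarith [mul_self_nonneg a.y, mul_self_nonneg a.wd, mul_self_nonneg a.Z1,
      mul_self_nonneg a.Z2, mul_self_nonneg a.Zd1, mul_self_nonneg a.Zd2, mul_self_nonneg a.w])
  · exact z _ (by nlinarith [mul_self_nonneg a.y, mul_self_nonneg a.wd, mul_self_nonneg a.Z1,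
      mul_self_nonneg a.Z2, mul_self_nonneg a.Zd1, mul_self_nonneg a.Zd2, mul_self_nonneg a.w])
  · exact z _ (by nlinarith [mul_self_nonneg a.y, mul_self_nonneg a.wd, mul_self_nonneg a.Z1,
      mul_self_nonneg a.Z2, mul_self_nonneg a.Zd1, mul_self_nonneg a.Zd2, mul_self_nonneg a.w])

theorem form_sigma (a b : TauSpace r lam) : form (sigma a) (sigma b) = form a b := by
  simp [form_apply, sigma_apply]

theorem form_ad (a b c : TauSpace r lam) : form ⁅a, b⁆ c = - form b ⁅a, c⁆ := by
  rw [eq_neg_iff_add_eq_zero]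
  simp only [form_apply, lie_def, pair, sub_mul, mul_sub, Finset.sum_mul, Finset.mul_sum]
  have comb : ∀ (A : ℝ) (f1 f2 f3 f4 f5 f6 f7 f8 : Fin s → ℝ), A = 0 →
      (∀ α, f1 α + f2 α + f3 α + f4 α + f5 α + f6 α + f7 α + f8 α = 0) →
      A + (∑ α, f1 α + ∑ α, f2 α + ∑ α, f3 α + ∑ α, f4 α + ∑ α, f5 α + ∑ α, f6 α
        + ∑ α, f7 α + ∑ α, f8 α) = 0 := by
    intro A f1 f2 f3 f4 f5 f6 f7 f8 hA hf
    simp only [← Finset.sum_add_distrib, hf, hA, Finset.sum_const_zero, add_zero]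
  refine Eq.trans ?_ (comb
    ((a.Zd1 * b.Zd2 - a.Zd2 * b.Zd1) * c.wd + (a.Zd1 * b.w - a.w * b.Zd1) * c.y
      + (-(a.y * b.w - a.w * b.y) - (a.wd * b.Zd2 - a.Zd2 * b.wd)) * c.Zd1
      + (a.wd * b.Zd1 - a.Zd1 * b.wd) * c.Zd2
      + (a.y * b.Zd1 - a.Zd1 * b.y) * c.w
      + ((a.Zd1 * c.Zd2 - a.Zd2 * c.Zd1) * b.wd + (a.Zd1 * c.w - a.w * c.Zd1) * b.y
      + (-(a.y * c.w - a.w * c.y) - (a.wd * c.Zd2 - a.Zd2 * c.wd)) * b.Zd1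
      + (a.wd * c.Zd1 - a.Zd1 * c.wd) * b.Zd2
      + (a.y * c.Zd1 - a.Zd1 * c.y) * b.w))
    (fun α => eps r α * ((a.Zd1 * lam 0 α + a.Zd2 * lam 1 α) * b.W α
      - a.W α * (b.Zd1 * lam 0 α + b.Zd2 * lam 1 α)) * c.Wd α)
    (fun α => - (eps r α * lam 0 α * (a.Wd α * b.W α - a.W α * b.Wd α)) * c.Zd1)
    (fun α => - (eps r α * lam 1 α * (a.Wd α * b.W α - a.W α * b.Wd α)) * c.Zd2)
    (fun α => eps r α * (a.Wd α * (b.Zd1 * lam 0 α + b.Zd2 * lam 1 α)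
      - (a.Zd1 * lam 0 α + a.Zd2 * lam 1 α) * b.Wd α) * c.W α)
    (fun α => eps r α * ((a.Zd1 * lam 0 α + a.Zd2 * lam 1 α) * c.W α
      - a.W α * (c.Zd1 * lam 0 α + c.Zd2 * lam 1 α)) * b.Wd α)
    (fun α => - (eps r α * lam 0 α * (a.Wd α * c.W α - a.W α * c.Wd α)) * b.Zd1)
    (fun α => - (eps r α * lam 1 α * (a.Wd α * c.W α - a.W α * c.Wd α)) * b.Zd2)
    (fun α => eps r α * (a.Wd α * (c.Zd1 * lam 0 α + c.Zd2 * lam 1 α)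
      - (a.Zd1 * lam 0 α + a.Zd2 * lam 1 α) * c.Wd α) * b.W α)
    (by ring) (fun α => by ring))
  simp only [mul_add, add_mul, sub_mul, mul_sub, neg_sub, Finset.sum_add_distrib,
    Finset.sum_sub_distrib, mul_assoc,
    mul_left_comm, mul_comm]
  ring

/-- The condition `(λ_1^α, λ_2^α) ≠ 0` for all `α`. -/
def Admissible {s : ℕ} (lam : Fin 2 → Fin s → ℝ) : Prop :=
  ∀ α, lam 0 α ≠ 0 ∨ lam 1 α ≠ 0

theorem span_bracket (hl : Admissible lam) :
    Module.End.eigenspace ((sigma : TauSpace r lam ≃ₗ⁅ℝ⁆ TauSpace r lam) :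
      TauSpace r lam →ₗ[ℝ] TauSpace r lam) 1 =
    Submodule.span ℝ {z | ∃ x ∈ Module.End.eigenspace
        ((sigma : TauSpace r lam ≃ₗ⁅ℝ⁆ TauSpace r lam) : TauSpace r lam →ₗ[ℝ] TauSpace r lam) (-1),
      ∃ y ∈ Module.End.eigenspace
        ((sigma : TauSpace r lam ≃ₗ⁅ℝ⁆ TauSpace r lam) : TauSpace r lam →ₗ[ℝ] TauSpace r lam) (-1),
      ⁅x, y⁆ = z} := by
  apply le_antisymm
  · intro a ha
    rw [mem_h_iff] at ha
    obtain ⟨h1, h2, h3, h4, h5, h6⟩ := ha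
    set N : Fin s → ℝ := fun α => lam 0 α ^ 2 + lam 1 α ^ 2 with hN
    have hN0 : ∀ α, N α ≠ 0 := fun α => by
      rcases hl α with h | h
      · have := pow_pos (abs_pos.mpr h) 2
        rw [sq_abs] at this
        simp only [hN]
        positivity
      · have := pow_pos (abs_pos.mpr h) 2
        rw [sq_abs] at this
        simp only [hN]
        positivity
    have key : a = ⁅(⟨0, 0, 0, 0, 0, 0, 0, 1, 0⟩ : TauSpace r lam),
          (⟨0, 0, 0, 0, 0, fun α => a.Wd α * lam 0 α / N α, a.wd, 0, a.y⟩ : TauSpace r lam)⁆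
        + ⁅(⟨0, 0, 0, 0, 0, 0, 0, 0, 1⟩ : TauSpace r lam),
          (⟨0, 0, 0, 0, 0, fun α => a.Wd α * lam 1 α / N α, 0, 0, 0⟩ : TauSpace r lam)⁆ := by
      ext α
      · simp [lie_def]
      · simp [lie_def, pair]
        have := hN0 α
        field_simp
        simp only [hN]
      all_goals simp [lie_def, h1, h2, h3, h4, h5, h6]
    rw [key]
    refine Submodule.add_mem _ (Submodule.subset_span ⟨_, ?_, _, ?_, rfl⟩)
      (Submodule.subset_span ⟨_, ?_, _, ?_, rfl⟩) <;> rw [mem_m_iff] <;> exact ⟨rfl, rfl, rfl⟩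
  · rw [Submodule.span_le]
    rintro _ ⟨x, hx, y, hy, rfl⟩
    rw [mem_m_iff] at hx hy
    obtain ⟨x1, x2, x3⟩ := hx
    obtain ⟨y1, y2, y3⟩ := hy
    rw [SetLike.mem_coe, mem_h_iff]
    refine ⟨?_, ?_, ?_, ?_, ?_, ?_⟩
    · simp [lie_def, x1, x2, x3, y1, y2, y3]
    · simp [lie_def, x2, x3, y2, y3]
    · ext α
      simp [lie_def, x2, y2]
    · simp [lie_def, x1, y1]
    · simp [lie_def]
    · simp [lie_def]

end

end TauSpace

/-- The normal form `τ_n(r, λ, 1)`. -/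
def tau (n : ℕ) (r : Fin (n - 5 + 1)) (lam : Fin 2 → Fin (n - 5) → ℝ)
    (hl : TauSpace.Admissible lam) : SymmetricTriple.{0} where
  g := TauSpace r lam
  σ := TauSpace.sigma
  σ_invol a := by simp [TauSpace.sigma_apply]
  span_bracket := TauSpace.span_bracket hl
  B := TauSpace.form
  B_symm := TauSpace.form_symm
  B_nondeg := TauSpace.form_nondeg
  B_sigma := TauSpace.form_sigma
  B_ad := TauSpace.form_ad

/-- The vectors `v` and `v'` of `ℝ^s` are related by the signed permutation that maps `e_α` to
`η_α e_{π(α)}`. -/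
def SignedPermRel {s : ℕ} (π : Equiv.Perm (Fin s)) (η : Fin s → ℤˣ)
    (v v' : EuclideanSpace ℝ (Fin s)) : Prop :=
  ∀ α, v' (π α) = ((η α : ℤ) : ℝ) * v α

/-- `π` belongs to `𝒮_r × 𝒮_{s-r}`: it preserves the set of the first `r` indices. -/
def PreservesPartition {s : ℕ} (r : ℕ) (π : Equiv.Perm (Fin s)) : Prop :=
  ∀ α, ((π α : Fin s) : ℕ) < r ↔ (α : ℕ) < r

/-- The triples `(r, k, l)` with `r ∈ {0, …, n - 5}`, `k ∈ {1, 2}` (here `0` and `1`) and `l` in the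
unit sphere of `ℝ^{n-5}`, outside of all coordinate hyperplanes `e_α^⊥`. -/
structure RankOneParam (n : ℕ) where
  r : Fin (n - 5 + 1)
  k : Fin 2
  l : EuclideanSpace ℝ (Fin (n - 5))
  norm_l : ‖l‖ = 1
  not_mem : l ∉ ⋃ α, {v : EuclideanSpace ℝ (Fin (n - 5)) | v α = 0}

/-- The equivalence relation given by the action of `𝒮_r × 𝒮_{n-r-5} × {±1}^{n-5}` on `l`. -/
def RankOneParam.Rel {n : ℕ} (p p' : RankOneParam n) : Prop :=
  p.r = p'.r ∧ p.k = p'.k ∧ ∃ (π : Equiv.Perm (Fin (n - 5))) (η : Fin (n - 5) → ℤˣ),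
    PreservesPartition p.r π ∧ SignedPermRel π η p.l p'.l

/-- The quadruples `(r, δ, l₁, l₂)` with `r ∈ {0, …, n - 5}`, `δ > 0` and `(l₁, l₂)` an orthonormal
pair in `ℝ^{n-5}` whose span is not contained in the union of the coordinate hyperplanes `e_α^⊥`. -/
structure RankTwoParam (n : ℕ) where
  r : Fin (n - 5 + 1)
  δ : ℝ
  l₁ : EuclideanSpace ℝ (Fin (n - 5))
  l₂ : EuclideanSpace ℝ (Fin (n - 5))
  δ_pos : 0 < δ
  norm_l₁ : ‖l₁‖ = 1
  norm_l₂ : ‖l₂‖ = 1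
  inner_eq : inner ℝ l₁ l₂ = 0
  not_subset : ¬ ((Submodule.span ℝ {l₁, l₂} : Set (EuclideanSpace ℝ (Fin (n - 5)))) ⊆
    ⋃ α, {v : EuclideanSpace ℝ (Fin (n - 5)) | v α = 0})

/-- The equivalence relation on the quadruples generated by the change of sign of `l₁` alone
(so that `l₁` stands for the point `[l₁]` of the projective space, with `l₂` a unit vector orthogonal
to it) and the simultaneous action of `𝒮_r × 𝒮_{n-r-5} × {±1}^{n-5}` on `l₁` and `l₂`. -/
def RankTwoParam.Rel {n : ℕ} (p p' : RankTwoParam n) : Prop :=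
  p.r = p'.r ∧ p.δ = p'.δ ∧ ∃ (κ : ℤˣ) (π : Equiv.Perm (Fin (n - 5))) (η : Fin (n - 5) → ℤˣ),
    PreservesPartition p.r π ∧ SignedPermRel π η (((κ : ℤ) : ℝ) • p.l₁) p'.l₁ ∧
    SignedPermRel π η p.l₂ p'.l₂

theorem PreservesPartition.symm {s r : ℕ} {π : Equiv.Perm (Fin s)} (H : PreservesPartition r π) :
    PreservesPartition r π.symm := fun α => by
  simpa using (H (π.symm α)).symm

theorem PreservesPartition.trans {s r : ℕ} {π π' : Equiv.Perm (Fin s)}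
    (H : PreservesPartition r π) (H' : PreservesPartition r π') :
    PreservesPartition r (π.trans π') := fun α => by
  simpa using (H' (π α)).trans (H α)

theorem units_cast_mul_self (κ : ℤˣ) : ((κ : ℤ) : ℝ) * ((κ : ℤ) : ℝ) = 1 := by
  rcases Int.units_eq_one_or κ with rfl | rfl <;> simp

theorem SignedPermRel.refl {s : ℕ} (v : EuclideanSpace ℝ (Fin s)) :
    SignedPermRel (Equiv.refl _) 1 v v := fun α => by simp

theorem SignedPermRel.symm {s : ℕ} {π : Equiv.Perm (Fin s)} {η : Fin s → ℤˣ}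
    {v v' : EuclideanSpace ℝ (Fin s)} (H : SignedPermRel π η v v') :
    SignedPermRel π.symm (fun α => η (π.symm α)) v' v := fun α => by
  have h1 := H (π.symm α)
  rw [Equiv.apply_symm_apply] at h1
  rw [h1, ← mul_assoc, units_cast_mul_self, one_mul]

theorem SignedPermRel.trans {s : ℕ} {π π' : Equiv.Perm (Fin s)} {η η' : Fin s → ℤˣ}
    {v v' v'' : EuclideanSpace ℝ (Fin s)} (H : SignedPermRel π η v v')
    (H' : SignedPermRel π' η' v' v'') :
    SignedPermRel (π.trans π') (fun α => η' (π α) * η α) v v'' := fun α => by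
  simp only [Equiv.trans_apply, H' (π α), H α, Units.val_mul, Int.cast_mul, mul_assoc]

theorem SignedPermRel.smul {s : ℕ} {π : Equiv.Perm (Fin s)} {η : Fin s → ℤˣ}
    {v v' : EuclideanSpace ℝ (Fin s)} (c : ℝ) (H : SignedPermRel π η v v') :
    SignedPermRel π η (c • v) (c • v') := fun α => by
  simp only [PiLp.smul_apply, smul_eq_mul, H α]
  ring

instance rankOneSetoid (n : ℕ) : Setoid (RankOneParam n) where
  r := RankOneParam.Rel
  iseqv := by
    refine ⟨fun p => ⟨rfl, rfl, Equiv.refl _, 1, fun _ => Iff.rfl, SignedPermRel.refl _⟩, ?_, ?_⟩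
    · rintro p p' ⟨h1, h2, π, η, h3, h4⟩
      exact ⟨h1.symm, h2.symm, π.symm, _, h1 ▸ h3.symm, h4.symm⟩
    · rintro p p' p'' ⟨h1, h2, π, η, h3, h4⟩ ⟨k1, k2, π', η', k3, k4⟩
      exact ⟨h1.trans k1, h2.trans k2, π.trans π', _, h3.trans (h1 ▸ k3), h4.trans k4⟩

instance rankTwoSetoid (n : ℕ) : Setoid (RankTwoParam n) where
  r := RankTwoParam.Rel
  iseqv := by
    refine ⟨fun p => ⟨rfl, rfl, 1, Equiv.refl _, 1, fun _ => Iff.rfl, ?_, SignedPermRel.refl _⟩,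
      ?_, ?_⟩
    · simpa using SignedPermRel.refl p.l₁
    · rintro p p' ⟨h1, h2, κ, π, η, h3, h4, h5⟩
      refine ⟨h1.symm, h2.symm, κ, π.symm, _, h1 ▸ h3.symm, ?_, h5.symm⟩
      have := h4.symm.smul ((κ : ℤ) : ℝ)
      rwa [smul_smul, units_cast_mul_self, one_smul] at this
    · rintro p p' p'' ⟨h1, h2, κ, π, η, h3, h4, h5⟩ ⟨k1, k2, κ', π', η', k3, k4, k5⟩
      refine ⟨h1.trans k1, h2.trans k2, κ' * κ, π.trans π', _, h3.trans (h1 ▸ k3), ?_,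
        h5.trans k5⟩
      have := (h4.smul ((κ' : ℤ) : ℝ)).trans k4
      rwa [smul_smul, ← Int.cast_mul, ← Units.val_mul] at this

/-- The classes `(r, k, [l])`. -/
abbrev RankOneModuli (n : ℕ) : Type := Quotient (rankOneSetoid n)

/-- The classes `(r, δ, [l₁, l₂])`. -/
abbrev RankTwoModuli (n : ℕ) : Type := Quotient (rankTwoSetoid n)

/-- `λ_i = δ_{ik} l`. -/
def RankOneParam.lam {n : ℕ} (p : RankOneParam n) : Fin 2 → Fin (n - 5) → ℝ :=
  fun i α => if i = p.k then p.l α else 0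

/-- `(λ_1, λ_2) = (δ l₁, δ l₂)`. -/
def RankTwoParam.lam {n : ℕ} (p : RankTwoParam n) : Fin 2 → Fin (n - 5) → ℝ :=
  ![fun α => p.δ * p.l₁ α, fun α => p.δ * p.l₂ α]

theorem RankOneParam.admissible {n : ℕ} (p : RankOneParam n) : TauSpace.Admissible p.lam := by
  intro α
  have h1 : p.l α ≠ 0 := fun h => p.not_mem (Set.mem_iUnion.mpr ⟨α, h⟩)
  have : p.k = 0 ∨ p.k = 1 := by omega
  rcases this with h | h
  · left; simp [RankOneParam.lam, h, h1]
  · right; simp [RankOneParam.lam, h, h1]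

theorem RankTwoParam.admissible {n : ℕ} (p : RankTwoParam n) : TauSpace.Admissible p.lam := by
  intro α
  by_contra! hα
  have h0 := p.δ_pos.ne'
  simp only [RankTwoParam.lam, Matrix.cons_val_zero, Matrix.cons_val_one, mul_eq_zero, h0,
    false_or] at hα
  refine p.not_subset fun v hv => Set.mem_iUnion.mpr ⟨α, ?_⟩
  obtain ⟨a, b, rfl⟩ := Submodule.mem_span_pair.mp hv
  simp [hα.1, hα.2]

/-! Since `B` is invariant and `𝔥 = [𝔪, 𝔪]`, the whole bracket is determined by `B` and the brackets
of pairs of elements of `𝔪`. A triple is therefore a normal form as soon as it contains a `Frame`: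
vectors with the prescribed products whose brackets inside `𝔪` are the prescribed ones.

Existence of the normal form. As `𝔷` is a null plane and `B` has only two negative directions on
`𝔪`, the space `W` is Euclidean. The crucial fact is `[W, W] = 0` (`lie_ι_ι`). It is equivalent to
`𝔥` acting trivially on `W` modulo `𝔷`, and this is shown for the three kinds of generators of `𝔥`
by three different arguments. For `[W, W]`, indecomposability shows that an `ad 𝔥`-invariant
symmetric form on `𝔪` that kills `𝔷` must vanish on `W`; the sum of the squares of the operators in
question is such a form. For `[W, Z*_c]`, the Jacobi identity produces a left Leibniz product on a
Euclidean space with skew left multiplications and vanishing cyclic sums, which is zero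
(`leibniz_product_eq_zero`). For `[Z*_0, Z*_1]`, the action is the skew part of the operators `S i j
= pr ∘ ad Z*_j ∘ ad Z*_i`, and trace identities exclude it (`skew_part_eq_zero`). Afterwards the `S
i j` are commuting symmetric operators with `S 0 1 = S 1 0` and `S 1 1 * S 0 0 = S 0 1 * S 0 1`, so
on a joint eigenbasis they have the form `-ε λ_i λ_j`. The vector `λ` vanishes exactly on the line
`W_nil`, spanned by `w`; the number of signs `ε = -1` is `r`. What remains are the `W`-components
`mu i` of `[[Z*_0, Z*_1], Z*_i]` and the number `B(y, y)`. The `w`-components of `mu` cannot both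
vanish, since otherwise `w` would be central, and a change of basis of `𝔷*` makes them `(1, 0)`.
Adding elements of `W` to `𝔷*` removes the other components, and adding a multiple of `w` removes
`B(y, y)`.

Classification. An isomorphism preserves `𝔷` and `𝔷^⊥`, matches the joint eigenvalues of `ad b ∘ ad
a` on `𝔪 ∩ 𝔷^⊥` modulo `𝔷`, and sends `w` to `±w` modulo `𝔷`. The relation `[[Z*_1, Z*_2], Z*_1] =
w` makes the induced map on `𝔷*` triangular with diagonal entries `A`, `D` such that `A²D = ±1`.
Hence (`tau_isomorphic_iff`) `λ` is unique up to signed permutations and `(λ_1, λ_2) ↦ (aλ_1 + bλ_2,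
a⁻²λ_2)`. In rank two, Gram-Schmidt fixes `b` and equality of norms fixes `|a|`; the sign of `a` is
the ambiguity of `l₁`. In rank one, `k` records whether `λ_2` vanishes, and `a` normalises the
length. -/

namespace SymmetricTriple

/-! ### Calculus in the graded Lie algebra `𝔤 = 𝔥 ⊕ 𝔪` -/

section
variable {τ : SymmetricTriple.{u}}

theorem mem_h {x : τ.g} : x ∈ τ.h ↔ τ.σ x = x := by
  rw [h, Module.End.mem_eigenspace_iff, one_smul]; rfl

theorem mem_m {x : τ.g} : x ∈ τ.m ↔ τ.σ x = -x := by
  rw [m, Module.End.mem_eigenspace_iff, neg_smul, one_smul]; rfl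

theorem lie_mem_h {x y : τ.g} (hx : x ∈ τ.m) (hy : y ∈ τ.m) : ⁅x, y⁆ ∈ τ.h := by
  rw [mem_m] at hx hy
  rw [mem_h, LieEquiv.map_lie, hx, hy, neg_lie, lie_neg, neg_neg]

theorem lie_mem_m {k x : τ.g} (hk : k ∈ τ.h) (hx : x ∈ τ.m) : ⁅k, x⁆ ∈ τ.m := by
  rw [mem_h] at hk
  rw [mem_m] at *
  rw [LieEquiv.map_lie, hk, hx, lie_neg]

theorem B_h_m {k x : τ.g} (hk : k ∈ τ.h) (hx : x ∈ τ.m) : τ.B k x = 0 := by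
  have := τ.B_sigma k x
  rw [mem_h.mp hk, mem_m.mp hx, map_neg] at this
  linarith

theorem B_m_h {k x : τ.g} (hx : x ∈ τ.m) (hk : k ∈ τ.h) : τ.B x k = 0 := by
  rw [τ.B_symm, B_h_m hk hx]

theorem B_lie (x y z : τ.g) : τ.B ⁅x, y⁆ z = τ.B x ⁅y, z⁆ := by
  rw [← lie_skew, map_neg, LinearMap.neg_apply, τ.B_ad, neg_neg]

theorem exists_h_add_m (x : τ.g) : ∃ k ∈ τ.h, ∃ u ∈ τ.m, x = k + u := by
  refine ⟨(2 : ℝ)⁻¹ • (x + τ.σ x), ?_, (2 : ℝ)⁻¹ • (x - τ.σ x), ?_, ?_⟩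
  · rw [mem_h, map_smul, map_add, τ.σ_invol, add_comm]
  · rw [mem_m, map_smul, map_sub, τ.σ_invol, ← smul_neg, neg_sub]
  · rw [← smul_add]
    have : x + τ.σ x + (x - τ.σ x) = (2 : ℝ) • x := by rw [two_smul]; abel
    rw [this, smul_smul]; norm_num

theorem h_eq_span : τ.h = Submodule.span ℝ {z | ∃ x ∈ τ.m, ∃ y ∈ τ.m, ⁅x, y⁆ = z} :=
  τ.span_bracket

theorem eq_zero_of_m {x : τ.g} (hx : x ∈ τ.m) (H : ∀ u ∈ τ.m, τ.B x u = 0) : x = 0 := by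
  refine τ.B_nondeg x fun y => ?_
  obtain ⟨k, hk, u, hu, rfl⟩ := exists_h_add_m y
  rw [map_add, H u hu, B_m_h hx hk, add_zero]

theorem eq_zero_of_h {k : τ.g} (hk : k ∈ τ.h)
    (H : ∀ u ∈ τ.m, ∀ v ∈ τ.m, τ.B k ⁅u, v⁆ = 0) : k = 0 := by
  refine τ.B_nondeg k fun y => ?_
  obtain ⟨l, hl, u, hu, rfl⟩ := exists_h_add_m y
  rw [map_add, B_h_m hk hu, add_zero]
  rw [h_eq_span] at hl
  induction hl using Submodule.span_induction with
  | mem x hx => obtain ⟨u, hu, v, hv, rfl⟩ := hx; exact H u hu v hv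
  | zero => simp
  | add x y _ _ hx hy => rw [map_add, hx, hy, add_zero]
  | smul c x _ hx => rw [map_smul, hx, smul_zero]

theorem mem_z {x : τ.g} : x ∈ τ.z ↔ ∀ y : τ.g, ⁅y, x⁆ = 0 := by
  rw [z, LieSubmodule.mem_toSubmodule]
  exact LieModule.mem_maxTrivSubmodule ..

/-- Commuting with `𝔪` is enough: for `k ∈ 𝔥` invariance gives `B([k, x], u) = B(k, [x, u]) = 0`,
and `B` is non-degenerate on `𝔪`. -/
theorem mem_z_of_m {x : τ.g} (hx : x ∈ τ.m) (H : ∀ u ∈ τ.m, ⁅x, u⁆ = 0) : x ∈ τ.z := by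
  have hk : ∀ k ∈ τ.h, ⁅k, x⁆ = 0 := fun k hk => by
    refine eq_zero_of_m (lie_mem_m hk hx) fun u hu => ?_
    rw [B_lie, H u hu, map_zero]
  rw [mem_z]
  intro y
  obtain ⟨k, hk', u, hu, rfl⟩ := exists_h_add_m y
  rw [add_lie, hk k hk', ← lie_skew, H u hu, neg_zero, add_zero]

end

/-! ### Recognising triples from brackets inside `𝔪`; frames -/

/-- A linear isometry that commutes with the involutions is an isomorphism of symmetric triples as
soon as it respects the brackets of elements of `𝔪`. -/
theorem isomorphic_of_linearEquiv {τ₁ : SymmetricTriple.{u}} {τ₂ : SymmetricTriple.{v}}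
    (Φ : τ₁.g ≃ₗ[ℝ] τ₂.g) (hσ : ∀ x, Φ (τ₁.σ x) = τ₂.σ (Φ x))
    (hB : ∀ x y, τ₂.B (Φ x) (Φ y) = τ₁.B x y)
    (hm : ∀ x ∈ τ₁.m, ∀ y ∈ τ₁.m, Φ ⁅x, y⁆ = ⁅Φ x, Φ y⁆) : τ₁.Isomorphic τ₂ := by
  have Φm : ∀ x ∈ τ₁.m, Φ x ∈ τ₂.m := fun x hx => by
    rw [mem_m] at *; rw [← hσ, hx, map_neg]
  have Φh : ∀ x ∈ τ₁.h, Φ x ∈ τ₂.h := fun x hx => by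
    rw [mem_h] at *; rw [← hσ, hx]
  have Φm' : ∀ y ∈ τ₂.m, ∃ x ∈ τ₁.m, Φ x = y := fun y hy => by
    refine ⟨Φ.symm y, ?_, by simp⟩
    rw [mem_m] at *
    apply Φ.injective
    rw [hσ, map_neg, LinearEquiv.apply_symm_apply, hy]
  -- The element `[k, x]` of `𝔪` is determined by `B([k, x], v) = B(k, [x, v])`, which involves only
  -- a bracket inside `𝔪`.
  have hkm : ∀ k ∈ τ₁.h, ∀ x ∈ τ₁.m, Φ ⁅k, x⁆ = ⁅Φ k, Φ x⁆ := fun k hk x hx => by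
    rw [← sub_eq_zero]
    refine eq_zero_of_m (sub_mem (Φm _ (lie_mem_m hk hx)) (lie_mem_m (Φh _ hk) (Φm _ hx))) ?_
    intro u hu
    obtain ⟨v, hv, rfl⟩ := Φm' u hu
    rw [map_sub, LinearMap.sub_apply, hB, B_lie, B_lie, ← hm x hx v hv, hB, sub_self]
  -- On generators `l = [u, v]` of `𝔥` the Jacobi identity reduces `[k, l]` to the two cases already
  -- known.
  have hkk : ∀ k ∈ τ₁.h, ∀ l ∈ τ₁.h, Φ ⁅k, l⁆ = ⁅Φ k, Φ l⁆ := fun k hk l hl => by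
    rw [h_eq_span] at hl
    induction hl using Submodule.span_induction with
    | mem x hx =>
      obtain ⟨u, hu, v, hv, rfl⟩ := hx
      rw [leibniz_lie, map_add, hm _ (lie_mem_m hk hu) v hv, hm u hu _ (lie_mem_m hk hv),
        hkm k hk u hu, hkm k hk v hv, hm u hu v hv, leibniz_lie (Φ k)]
    | zero => simp
    | add x y _ _ hx hy => rw [lie_add, map_add, hx, hy, map_add, lie_add]
    | smul c x _ hx => rw [lie_smul, map_smul, hx, map_smul, lie_smul]
  have hall : ∀ x y, Φ ⁅x, y⁆ = ⁅Φ x, Φ y⁆ := fun x y => by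
    obtain ⟨k, hk, u, hu, rfl⟩ := exists_h_add_m x
    obtain ⟨l, hl, v, hv, rfl⟩ := exists_h_add_m y
    have h1 : Φ ⁅u, l⁆ = ⁅Φ u, Φ l⁆ := by
      rw [← lie_skew, map_neg, hkm l hl u hu, lie_skew]
    simp only [add_lie, lie_add, map_add, hkk k hk l hl, hkm k hk v hv, hm u hu v hv, h1]
  exact ⟨{ Φ with map_lie' := fun {x y} => hall x y }, hσ, hB⟩

/-- Elements of a symmetric triple that satisfy the defining relations of a normal form. -/
structure Frame (τ : SymmetricTriple.{u}) {s : ℕ} (r : ℕ) (lam : Fin 2 → Fin s → ℝ) where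
  y : τ.g
  Wd : Fin s → τ.g
  wd : τ.g
  Z1 : τ.g
  Z2 : τ.g
  W : Fin s → τ.g
  w : τ.g
  Zd1 : τ.g
  Zd2 : τ.g
  Z1_mem : Z1 ∈ τ.m
  Z2_mem : Z2 ∈ τ.m
  W_mem : ∀ α, W α ∈ τ.m
  w_mem : w ∈ τ.m
  Zd1_mem : Zd1 ∈ τ.m
  Zd2_mem : Zd2 ∈ τ.m
  y_mem : y ∈ τ.h
  Wd_mem : ∀ α, Wd α ∈ τ.h
  wd_mem : wd ∈ τ.h
  lie_Z1 : ∀ x : τ.g, ⁅x, Z1⁆ = 0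
  lie_Z2 : ∀ x : τ.g, ⁅x, Z2⁆ = 0
  lie_Zd : ⁅Zd1, Zd2⁆ = y
  lie_Zd1_w : ⁅Zd1, w⁆ = wd
  lie_Zd2_w : ⁅Zd2, w⁆ = 0
  lie_Zd1_W : ∀ α, ⁅Zd1, W α⁆ = lam 0 α • Wd α
  lie_Zd2_W : ∀ α, ⁅Zd2, W α⁆ = lam 1 α • Wd α
  lie_W_W : ∀ α β, ⁅W α, W β⁆ = 0
  lie_w_W : ∀ α, ⁅w, W α⁆ = 0
  B_y_y : τ.B y y = 0
  B_y_wd : τ.B y wd = 1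
  B_wd_wd : τ.B wd wd = 0
  B_y_Wd : ∀ α, τ.B y (Wd α) = 0
  B_wd_Wd : ∀ α, τ.B wd (Wd α) = 0
  B_Wd_Wd : ∀ α β, τ.B (Wd α) (Wd β) = if α = β then TauSpace.eps r α else 0
  B_Z1_Z1 : τ.B Z1 Z1 = 0
  B_Z1_Z2 : τ.B Z1 Z2 = 0
  B_Z2_Z2 : τ.B Z2 Z2 = 0
  B_Zd1_Zd1 : τ.B Zd1 Zd1 = 0
  B_Zd1_Zd2 : τ.B Zd1 Zd2 = 0
  B_Zd2_Zd2 : τ.B Zd2 Zd2 = 0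
  B_Z1_Zd1 : τ.B Z1 Zd1 = 1
  B_Z1_Zd2 : τ.B Z1 Zd2 = 0
  B_Z2_Zd1 : τ.B Z2 Zd1 = 0
  B_Z2_Zd2 : τ.B Z2 Zd2 = 1
  B_Z1_W : ∀ α, τ.B Z1 (W α) = 0
  B_Z2_W : ∀ α, τ.B Z2 (W α) = 0
  B_Zd1_W : ∀ α, τ.B Zd1 (W α) = 0
  B_Zd2_W : ∀ α, τ.B Zd2 (W α) = 0
  B_Z1_w : τ.B Z1 w = 0
  B_Z2_w : τ.B Z2 w = 0
  B_Zd1_w : τ.B Zd1 w = 0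
  B_Zd2_w : τ.B Zd2 w = 0
  B_w_W : ∀ α, τ.B w (W α) = 0
  B_w_w : τ.B w w = 1
  B_W_W : ∀ α β, τ.B (W α) (W β) = if α = β then 1 else 0
  exists_coord : ∀ x ∈ τ.m, ∃ (a b c d e : ℝ) (f : Fin s → ℝ),
    x = a • Z1 + b • Z2 + ∑ α, f α • W α + c • w + d • Zd1 + e • Zd2

namespace Frame

variable {τ : SymmetricTriple.{u}} {s : ℕ} {r : ℕ} {lam : Fin 2 → Fin s → ℝ}

/-- The `𝔥`-part of the linear combination of the elements of a frame. -/
def toH (F : Frame τ r lam) : TauSpace r lam →ₗ[ℝ] τ.g where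
  toFun a := a.y • F.y + ∑ α, a.Wd α • F.Wd α + a.wd • F.wd
  map_add' a b := by
    simp only [TauSpace.add_y, TauSpace.add_Wd, TauSpace.add_wd, Pi.add_apply, add_smul,
      Finset.sum_add_distrib]
    abel
  map_smul' c a := by
    simp only [TauSpace.smul_y, TauSpace.smul_Wd, TauSpace.smul_wd, Pi.smul_apply, smul_eq_mul,
      mul_smul, smul_add, Finset.smul_sum, RingHom.id_apply]

/-- The `𝔪`-part of the linear combination of the elements of a frame. -/
def toM (F : Frame τ r lam) : TauSpace r lam →ₗ[ℝ] τ.g where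
  toFun a := a.Z1 • F.Z1 + a.Z2 • F.Z2 + ∑ α, a.W α • F.W α + a.w • F.w + a.Zd1 • F.Zd1
    + a.Zd2 • F.Zd2
  map_add' a b := by
    simp only [TauSpace.add_Z1, TauSpace.add_Z2, TauSpace.add_W, TauSpace.add_w, TauSpace.add_Zd1,
      TauSpace.add_Zd2, Pi.add_apply, add_smul, Finset.sum_add_distrib]
    abel
  map_smul' c a := by
    simp only [TauSpace.smul_Z1, TauSpace.smul_Z2, TauSpace.smul_W, TauSpace.smul_w,
      TauSpace.smul_Zd1, TauSpace.smul_Zd2, Pi.smul_apply, smul_eq_mul,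
      mul_smul, smul_add, Finset.smul_sum, RingHom.id_apply]

theorem toH_apply (F : Frame τ r lam) (a : TauSpace r lam) :
    F.toH a = a.y • F.y + ∑ α, a.Wd α • F.Wd α + a.wd • F.wd := rfl

theorem toM_apply (F : Frame τ r lam) (a : TauSpace r lam) :
    F.toM a = a.Z1 • F.Z1 + a.Z2 • F.Z2 + ∑ α, a.W α • F.W α + a.w • F.w + a.Zd1 • F.Zd1
      + a.Zd2 • F.Zd2 := rfl

theorem toH_mem (F : Frame τ r lam) (a : TauSpace r lam) : F.toH a ∈ τ.h := by
  rw [toH_apply]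
  exact add_mem (add_mem (Submodule.smul_mem _ _ F.y_mem)
    (Submodule.sum_mem _ fun α _ => Submodule.smul_mem _ _ (F.Wd_mem α)))
    (Submodule.smul_mem _ _ F.wd_mem)

theorem toM_mem (F : Frame τ r lam) (a : TauSpace r lam) : F.toM a ∈ τ.m := by
  rw [toM_apply]
  exact add_mem (add_mem (add_mem (add_mem (add_mem (Submodule.smul_mem _ _ F.Z1_mem)
    (Submodule.smul_mem _ _ F.Z2_mem))
    (Submodule.sum_mem _ fun α _ => Submodule.smul_mem _ _ (F.W_mem α)))
    (Submodule.smul_mem _ _ F.w_mem)) (Submodule.smul_mem _ _ F.Zd1_mem))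
    (Submodule.smul_mem _ _ F.Zd2_mem)

theorem B_toH (F : Frame τ r lam) (a b : TauSpace r lam) : τ.B (F.toH a) (F.toH b) =
    a.y * b.wd + a.wd * b.y + ∑ α, TauSpace.eps r α * (a.Wd α * b.Wd α) := by
  have h1 : τ.B F.wd F.y = 1 := by rw [τ.B_symm, F.B_y_wd]
  have h2 : ∀ α, τ.B (F.Wd α) F.y = 0 := fun α => by rw [τ.B_symm, F.B_y_Wd]
  have h3 : ∀ α, τ.B (F.Wd α) F.wd = 0 := fun α => by rw [τ.B_symm, F.B_wd_Wd]
  simp only [toH_apply, map_add, map_sum, map_smul, LinearMap.add_apply, LinearMap.sum_apply,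
    LinearMap.smul_apply, smul_eq_mul, h1, h2, h3, F.B_y_y, F.B_y_wd, F.B_wd_wd, F.B_y_Wd,
    F.B_wd_Wd, F.B_Wd_Wd, mul_zero, mul_one, Finset.sum_const_zero, mul_ite, Finset.sum_ite_eq',
    Finset.mem_univ, if_true, add_zero, zero_add]
  have e : ∀ α, TauSpace.eps r α * (a.Wd α * b.Wd α) = b.Wd α * (a.Wd α * TauSpace.eps r α) :=
    fun α => by ring
  simp only [e]
  ring

theorem B_toM (F : Frame τ r lam) (a b : TauSpace r lam) : τ.B (F.toM a) (F.toM b) =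
    a.Z1 * b.Zd1 + a.Z2 * b.Zd2 + a.Zd1 * b.Z1 + a.Zd2 * b.Z2
        + ∑ α, a.W α * b.W α + a.w * b.w := by
  have h1 : τ.B F.Zd1 F.Z1 = 1 := by rw [τ.B_symm, F.B_Z1_Zd1]
  have h2 : τ.B F.Zd1 F.Z2 = 0 := by rw [τ.B_symm, F.B_Z2_Zd1]
  have h3 : τ.B F.Zd2 F.Z1 = 0 := by rw [τ.B_symm, F.B_Z1_Zd2]
  have h4 : τ.B F.Zd2 F.Z2 = 1 := by rw [τ.B_symm, F.B_Z2_Zd2]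
  have h5 : τ.B F.Z2 F.Z1 = 0 := by rw [τ.B_symm, F.B_Z1_Z2]
  have h6 : τ.B F.Zd2 F.Zd1 = 0 := by rw [τ.B_symm, F.B_Zd1_Zd2]
  have k1 : ∀ α, τ.B (F.W α) F.Z1 = 0 := fun α => by rw [τ.B_symm, F.B_Z1_W]
  have k2 : ∀ α, τ.B (F.W α) F.Z2 = 0 := fun α => by rw [τ.B_symm, F.B_Z2_W]
  have k3 : ∀ α, τ.B (F.W α) F.Zd1 = 0 := fun α => by rw [τ.B_symm, F.B_Zd1_W]
  have k4 : ∀ α, τ.B (F.W α) F.Zd2 = 0 := fun α => by rw [τ.B_symm, F.B_Zd2_W]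
  have k5 : ∀ α, τ.B (F.W α) F.w = 0 := fun α => by rw [τ.B_symm, F.B_w_W]
  have l1 : τ.B F.w F.Z1 = 0 := by rw [τ.B_symm, F.B_Z1_w]
  have l2 : τ.B F.w F.Z2 = 0 := by rw [τ.B_symm, F.B_Z2_w]
  have l3 : τ.B F.w F.Zd1 = 0 := by rw [τ.B_symm, F.B_Zd1_w]
  have l4 : τ.B F.w F.Zd2 = 0 := by rw [τ.B_symm, F.B_Zd2_w]
  simp only [toM_apply, map_add, map_sum, map_smul, LinearMap.add_apply, LinearMap.sum_apply,
    LinearMap.smul_apply, smul_eq_mul, h1, h2, h3, h4, h5, h6, k1, k2, k3, k4, k5, l1, l2, l3, l4,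
    F.B_Z1_Z1, F.B_Z1_Z2, F.B_Z2_Z2, F.B_Zd1_Zd1, F.B_Zd1_Zd2, F.B_Zd2_Zd2, F.B_Z1_Zd1,
    F.B_Z1_Zd2, F.B_Z2_Zd1, F.B_Z2_Zd2, F.B_Z1_W, F.B_Z2_W, F.B_Zd1_W, F.B_Zd2_W, F.B_Z1_w,
    F.B_Z2_w, F.B_Zd1_w, F.B_Zd2_w, F.B_w_W, F.B_w_w, F.B_W_W,
    mul_zero, mul_one, Finset.sum_const_zero, mul_ite, Finset.sum_ite_eq',
    Finset.mem_univ, if_true, add_zero, zero_add]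
  simp only [mul_comm (b.W _)]
  ring

/-- No condition on `a`, `b` is needed, because the `𝔥`-coordinates of a bracket in `TauSpace`
depend only on the `𝔪`-coordinates of the two factors. -/
theorem lie_toM (F : Frame τ r lam) (a b : TauSpace r lam) :
    F.toH ⁅a, b⁆ = ⁅F.toM a, F.toM b⁆ := by
  have h1 : ∀ x : τ.g, ⁅F.Z1, x⁆ = 0 := fun x => by rw [← lie_skew, F.lie_Z1, neg_zero]
  have h2 : ∀ x : τ.g, ⁅F.Z2, x⁆ = 0 := fun x => by rw [← lie_skew, F.lie_Z2, neg_zero]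
  have h3 : ⁅F.Zd2, F.Zd1⁆ = -F.y := by rw [← lie_skew, F.lie_Zd]
  have h4 : ⁅F.w, F.Zd1⁆ = -F.wd := by rw [← lie_skew, F.lie_Zd1_w]
  have h5 : ⁅F.w, F.Zd2⁆ = 0 := by rw [← lie_skew, F.lie_Zd2_w, neg_zero]
  have h6 : ∀ α, ⁅F.W α, F.Zd1⁆ = -(lam 0 α • F.Wd α) := fun α => by
    rw [← lie_skew, F.lie_Zd1_W]
  have h7 : ∀ α, ⁅F.W α, F.Zd2⁆ = -(lam 1 α • F.Wd α) := fun α => by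
    rw [← lie_skew, F.lie_Zd2_W]
  have h8 : ∀ α, ⁅F.W α, F.w⁆ = 0 := fun α => by rw [← lie_skew, F.lie_w_W, neg_zero]
  simp only [toM_apply, add_lie, lie_add, sum_lie, lie_sum, smul_lie, lie_smul, h1,
    h2, h3, h4, h5, h6, h7, h8, F.lie_Z1, F.lie_Z2, F.lie_Zd, F.lie_Zd1_w, F.lie_Zd2_w, F.lie_Zd1_W,
    F.lie_Zd2_W, F.lie_W_W, F.lie_w_W, lie_self, smul_zero, Finset.sum_const_zero, add_zero,
    zero_add]
  rw [toH_apply, TauSpace.lie_def]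
  have e : ∀ α, (a.pair α * b.W α - a.W α * b.pair α) • F.Wd α =
      b.W α • a.Zd1 • lam 0 α • F.Wd α + b.W α • a.Zd2 • lam 1 α • F.Wd α
      + (b.Zd1 • a.W α • -(lam 0 α • F.Wd α) + b.Zd2 • a.W α • -(lam 1 α • F.Wd α)) :=
    fun α => by
      unfold TauSpace.pair
      module
  simp only [e, smul_add, Finset.sum_add_distrib, Finset.smul_sum]
  module

/-- The linear combination map of a frame is isometric, hence injective. It reaches `𝔪` by
`exists_coord` and therefore also `𝔥 = [𝔪, 𝔪]`, so a frame need not contain a spanning condition for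
`𝔥`. -/
theorem isomorphic {n : ℕ} {r : Fin (n - 5 + 1)} {lam : Fin 2 → Fin (n - 5) → ℝ}
    (hl : TauSpace.Admissible lam) (F : Frame τ (r : ℕ) lam) : τ.Isomorphic (tau n r lam hl) := by
  let φ : TauSpace (r : ℕ) lam →ₗ[ℝ] τ.g := F.toH + F.toM
  have hφ : ∀ a, φ a = F.toH a + F.toM a := fun a => rfl
  have hB : ∀ a b, τ.B (φ a) (φ b) = TauSpace.form a b := fun a b => by
    rw [hφ, hφ, map_add, map_add, LinearMap.add_apply, LinearMap.add_apply, F.B_toH, F.B_toM,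
      B_h_m (F.toH_mem a) (F.toM_mem b), B_m_h (F.toM_mem a) (F.toH_mem b), TauSpace.form_apply]
    ring
  have hinj : Function.Injective φ := by
    rw [injective_iff_map_eq_zero]
    intro a ha
    refine TauSpace.form_nondeg a fun b => ?_
    rw [← hB, ha, map_zero, LinearMap.zero_apply]
  have Hm : ∀ a : TauSpace (r : ℕ) lam, a.y = 0 ∧ a.Wd = 0 ∧ a.wd = 0 → φ a = F.toM a := by
    rintro a ⟨h1, h2, h3⟩
    rw [hφ, F.toH_apply, h1, h2, h3]
    simp
  have hlie : ∀ a b : TauSpace (r : ℕ) lam, a.y = 0 ∧ a.Wd = 0 ∧ a.wd = 0 →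
      b.y = 0 ∧ b.Wd = 0 ∧ b.wd = 0 → φ ⁅a, b⁆ = ⁅φ a, φ b⁆ := fun a b ha hb => by
    rw [Hm a ha, Hm b hb, ← F.lie_toM a b, hφ, add_eq_left, F.toM_apply]
    obtain ⟨a1, a2, a3⟩ := ha
    obtain ⟨b1, b2, b3⟩ := hb
    simp [TauSpace.lie_def, a1, a2, a3, b1, b2, b3]
  have hmr : ∀ x ∈ τ.m, ∃ a : TauSpace (r : ℕ) lam, (a.y = 0 ∧ a.Wd = 0 ∧ a.wd = 0) ∧ φ a = x := by
    intro x hx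
    obtain ⟨a, b, c, d, e, f, rfl⟩ := F.exists_coord x hx
    exact ⟨⟨0, 0, 0, a, b, f, c, d, e⟩, ⟨rfl, rfl, rfl⟩, by rw [Hm _ ⟨rfl, rfl, rfl⟩, F.toM_apply]⟩
  have hsurj : Function.Surjective φ := by
    rw [← LinearMap.range_eq_top, eq_top_iff]
    intro x _
    obtain ⟨k, hk, u, hu, rfl⟩ := exists_h_add_m x
    refine add_mem ?_ ?_
    · have : τ.h ≤ LinearMap.range φ := by
        rw [h_eq_span, Submodule.span_le]
        rintro _ ⟨u, hu, v, hv, rfl⟩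
        obtain ⟨a, ha, rfl⟩ := hmr u hu
        obtain ⟨b, hb, rfl⟩ := hmr v hv
        exact ⟨⁅a, b⁆, hlie a b ha hb⟩
      exact this hk
    · obtain ⟨a, -, rfl⟩ := hmr u hu
      exact ⟨a, rfl⟩
  refine Isomorphic.symm (isomorphic_of_linearEquiv (τ₁ := tau n r lam hl)
    (LinearEquiv.ofBijective φ ⟨hinj, hsurj⟩) ?_ hB ?_)
  · suffices H : ∀ a : TauSpace (r : ℕ) lam, φ (TauSpace.sigma a) = τ.σ (φ a) from H
    intro a
    rw [hφ a, map_add, mem_h.mp (F.toH_mem a), mem_m.mp (F.toM_mem a), hφ, TauSpace.sigma_apply,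
      F.toH_apply, F.toM_apply, F.toH_apply, F.toM_apply]
    simp only [neg_smul, Pi.neg_apply, Finset.sum_neg_distrib]
    abel
  · intro a ha b hb
    exact hlie a b ((TauSpace.mem_m_iff a).mp ha) ((TauSpace.mem_m_iff b).mp hb)

end Frame

end SymmetricTriple

/-! ### The normal form in coordinates: centre, solvability, invariant subspaces -/

namespace TauSpace

section
variable {s : ℕ} {r : ℕ} {lam : Fin 2 → Fin s → ℝ}

theorem normSq_ne_zero (hl : Admissible lam) (α : Fin s) : lam 0 α ^ 2 + lam 1 α ^ 2 ≠ 0 := by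
  rcases hl α with h | h
  · have := sq_pos_of_ne_zero h
    positivity
  · have := sq_pos_of_ne_zero h
    positivity

/-- Commuting with `Z*_1` and `Z*_2` already forces all these coordinates to vanish; admissibility
supplies, for each `α`, one of the two by which to divide. -/
theorem mem_center_iff (hl : Admissible lam) (a : TauSpace r lam) :
    (∀ b : TauSpace r lam, ⁅b, a⁆ = 0) ↔
    a.y = 0 ∧ a.Wd = 0 ∧ a.wd = 0 ∧ a.W = 0 ∧ a.w = 0 ∧ a.Zd1 = 0 ∧ a.Zd2 = 0 := by
  constructor
  · intro H
    have h1 := H ⟨0, 0, 0, 0, 0, 0, 0, 1, 0⟩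
    have h2 := H ⟨0, 0, 0, 0, 0, 0, 0, 0, 1⟩
    rw [TauSpace.ext_iff] at h1 h2
    simp only [lie_def, pair] at h1 h2
    obtain ⟨a1, a2, a3, a4, a5, a6, a7, -, -⟩ := h1
    obtain ⟨b1, b2, b3, b4, b5, b6, b7, -, -⟩ := h2
    simp at a1 a2 a3 a4 a5 a6 a7 b1 b2 b3 b4 b5 b6 b7
    refine ⟨a7, ?_, a5, ?_, a3, b1, a1⟩
    · ext α
      have c1 := congrFun a6 α
      have c2 := congrFun b6 α
      have he : eps r α ≠ 0 := fun h => by simpa [h] using eps_mul_self (r := r) α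
      simp [he] at c1 c2
      rcases hl α with h | h
      · exact c1.resolve_left h
      · exact c2.resolve_left h
    · ext α
      have c1 := congrFun a2 α
      have c2 := congrFun b2 α
      simp at c1 c2
      rcases hl α with h | h
      · exact c1.resolve_left h
      · exact c2.resolve_left h
  · rintro ⟨h1, h2, h3, h4, h5, h6, h7⟩ b
    ext <;> simp [lie_def, pair, h1, h2, h3, h4, h5, h6, h7]

/-- The span of `W_1, …, W_s, w`. -/
def subW : Submodule ℝ (TauSpace r lam) where
  carrier := {a | a.y = 0 ∧ a.Wd = 0 ∧ a.wd = 0 ∧ a.Z1 = 0 ∧ a.Z2 = 0 ∧ a.Zd1 = 0 ∧ a.Zd2 = 0}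
  zero_mem' := by simp
  add_mem' := by
    rintro a b ⟨a1, a2, a3, a4, a5, a6, a7⟩ ⟨b1, b2, b3, b4, b5, b6, b7⟩
    simp [a1, a2, a3, a4, a5, a6, a7, b1, b2, b3, b4, b5, b6, b7]
  smul_mem' := by
    rintro c a ⟨a1, a2, a3, a4, a5, a6, a7⟩
    simp [a1, a2, a3, a4, a5, a6, a7]

/-- The span of `Z*_1, Z*_2`. -/
def subZd : Submodule ℝ (TauSpace r lam) where
  carrier := {a | a.y = 0 ∧ a.Wd = 0 ∧ a.wd = 0 ∧ a.Z1 = 0 ∧ a.Z2 = 0 ∧ a.W = 0 ∧ a.w = 0}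
  zero_mem' := by simp
  add_mem' := by
    rintro a b ⟨a1, a2, a3, a4, a5, a6, a7⟩ ⟨b1, b2, b3, b4, b5, b6, b7⟩
    simp [a1, a2, a3, a4, a5, a6, a7, b1, b2, b3, b4, b5, b6, b7]
  smul_mem' := by
    rintro c a ⟨a1, a2, a3, a4, a5, a6, a7⟩
    simp [a1, a2, a3, a4, a5, a6, a7]

theorem mem_subW (a : TauSpace r lam) : a ∈ subW (r := r) (lam := lam) ↔
    a.y = 0 ∧ a.Wd = 0 ∧ a.wd = 0 ∧ a.Z1 = 0 ∧ a.Z2 = 0 ∧ a.Zd1 = 0 ∧ a.Zd2 = 0 := Iff.rfl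

theorem mem_subZd (a : TauSpace r lam) : a ∈ subZd (r := r) (lam := lam) ↔
    a.y = 0 ∧ a.Wd = 0 ∧ a.wd = 0 ∧ a.Z1 = 0 ∧ a.Z2 = 0 ∧ a.W = 0 ∧ a.w = 0 := Iff.rfl

/-- The first derived ideal has no `𝔷*`-component, the second lies in the span of `Z_1, Z_2`, and
the third is zero. -/
theorem isSolvable : LieAlgebra.IsSolvable (TauSpace r lam) := by
  rw [LieAlgebra.isSolvable_iff ℝ]
  have h1 : ∀ a ∈ LieAlgebra.derivedSeries ℝ (TauSpace r lam) 1, a.Zd1 = 0 ∧ a.Zd2 = 0 := by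
    intro a ha
    rw [LieAlgebra.derivedSeries_def, LieAlgebra.derivedSeriesOfIdeal_succ,
      ← LieSubmodule.mem_toSubmodule, LieSubmodule.lieIdeal_oper_eq_linear_span'] at ha
    induction ha using Submodule.span_induction with
    | mem x hx => obtain ⟨u, _, v, _, rfl⟩ := hx; exact ⟨rfl, rfl⟩
    | zero => exact ⟨rfl, rfl⟩
    | add x y _ _ hx hy => simp [hx, hy]
    | smul c x _ hx => simp [hx]
  have h2 : ∀ a ∈ LieAlgebra.derivedSeries ℝ (TauSpace r lam) 2,
      a.y = 0 ∧ a.Wd = 0 ∧ a.wd = 0 ∧ a.W = 0 ∧ a.w = 0 ∧ a.Zd1 = 0 ∧ a.Zd2 = 0 := by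
    intro a ha
    rw [LieAlgebra.derivedSeries_def, LieAlgebra.derivedSeriesOfIdeal_succ,
      ← LieSubmodule.mem_toSubmodule, LieSubmodule.lieIdeal_oper_eq_linear_span'] at ha
    induction ha using Submodule.span_induction with
    | mem x hx =>
      obtain ⟨u, hu, v, hv, rfl⟩ := hx
      obtain ⟨u1, u2⟩ := h1 u hu
      obtain ⟨v1, v2⟩ := h1 v hv
      refine ⟨?_, ?_, ?_, ?_, ?_, rfl, rfl⟩ <;> (try ext) <;> simp [lie_def, pair, u1, u2, v1, v2]
    | zero => simp
    | add x y _ _ hx hy =>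
      obtain ⟨a1, a2, a3, a4, a5, a6, a7⟩ := hx
      obtain ⟨b1, b2, b3, b4, b5, b6, b7⟩ := hy
      simp [a1, a2, a3, a4, a5, a6, a7, b1, b2, b3, b4, b5, b6, b7]
    | smul c x _ hx =>
      obtain ⟨a1, a2, a3, a4, a5, a6, a7⟩ := hx
      simp [a1, a2, a3, a4, a5, a6, a7]
  refine ⟨3, (LieSubmodule.eq_bot_iff _).mpr ?_⟩
  intro a ha
  rw [LieAlgebra.derivedSeries_def, LieAlgebra.derivedSeriesOfIdeal_succ,
    ← LieSubmodule.mem_toSubmodule, LieSubmodule.lieIdeal_oper_eq_linear_span'] at ha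
  induction ha using Submodule.span_induction with
  | mem x hx =>
    obtain ⟨u, hu, v, hv, rfl⟩ := hx
    obtain ⟨u1, u2, u3, u4, u5, u6, u7⟩ := h2 u hu
    obtain ⟨v1, v2, v3, v4, v5, v6, v7⟩ := h2 v hv
    ext <;> simp [lie_def, pair, u1, u2, u3, u4, u5, u6, u7, v1, v2, v3, v4, v5, v6, v7]
  | zero => rfl
  | add x y _ _ hx hy => rw [hx, hy, add_zero]
  | smul c x _ hx => rw [hx, smul_zero]

/-- The inclusion of `𝔪` in coordinates. -/
def inclM : ((ℝ × ℝ) × (Fin s → ℝ) × ℝ × (ℝ × ℝ)) →ₗ[ℝ] TauSpace r lam where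
  toFun p := ⟨0, 0, 0, p.1.1, p.1.2, p.2.1, p.2.2.1, p.2.2.2.1, p.2.2.2.2⟩
  map_add' p q := by ext <;> simp
  map_smul' c p := by ext <;> simp

/-- A maximal positive definite subspace of `𝔪` in coordinates. -/
def inclPos : ((ℝ × ℝ) × (Fin s → ℝ) × ℝ) →ₗ[ℝ] TauSpace r lam where
  toFun p := ⟨0, 0, 0, p.1.1, p.1.2, p.2.1, p.2.2, p.1.1, p.1.2⟩
  map_add' p q := by ext <;> simp
  map_smul' c p := by ext <;> simp

/-- A maximal negative definite subspace of `𝔪` in coordinates. -/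
def inclNeg : (ℝ × ℝ) →ₗ[ℝ] TauSpace r lam where
  toFun p := ⟨0, 0, 0, p.1, p.2, 0, 0, -p.1, -p.2⟩
  map_add' p q := by ext <;> simp <;> ring
  map_smul' c p := by ext <;> simp

/-- An `ad 𝔥`-invariant subspace that projects onto `𝔷*` contains `𝔪`. -/
theorem mem_of_det_ne_zero (hl : Admissible lam) (V : Submodule ℝ (TauSpace r lam))
    (hVm : ∀ v ∈ V, v.y = 0 ∧ v.Wd = 0 ∧ v.wd = 0)
    (hV : ∀ k : TauSpace r lam, k.Z1 = 0 ∧ k.Z2 = 0 ∧ k.W = 0 ∧ k.w = 0 ∧ k.Zd1 = 0 ∧ k.Zd2 = 0 →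
      ∀ v ∈ V, ⁅k, v⁆ ∈ V)
    {v₁ v₂ : TauSpace r lam} (h₁ : v₁ ∈ V) (h₂ : v₂ ∈ V)
    (hd : v₁.Zd1 * v₂.Zd2 - v₁.Zd2 * v₂.Zd1 ≠ 0) (x : TauSpace r lam)
    (hx : x.y = 0 ∧ x.Wd = 0 ∧ x.wd = 0) : x ∈ V := by
  set d := v₁.Zd1 * v₂.Zd2 - v₁.Zd2 * v₂.Zd1 with hdd
  -- Cramer's rule produces elements of `V` over `Z*_1` and `Z*_2`.
  obtain ⟨e₁, he₁, p1, p2⟩ : ∃ e ∈ V, e.Zd1 = 1 ∧ e.Zd2 = 0 := by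
    refine ⟨d⁻¹ • (v₂.Zd2 • v₁ - v₁.Zd2 • v₂), V.smul_mem _
      (V.sub_mem (V.smul_mem _ h₁) (V.smul_mem _ h₂)), ?_, ?_⟩
    · simp only [sub_eq_add_neg, smul_Zd1, add_Zd1, neg_Zd1]
      field_simp
      rw [hdd]; ring
    · simp only [sub_eq_add_neg, smul_Zd2, add_Zd2, neg_Zd2]
      ring
  obtain ⟨e₂, he₂, q1, q2⟩ : ∃ e ∈ V, e.Zd1 = 0 ∧ e.Zd2 = 1 := by
    refine ⟨d⁻¹ • (v₁.Zd1 • v₂ - v₂.Zd1 • v₁), V.smul_mem _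
      (V.sub_mem (V.smul_mem _ h₂) (V.smul_mem _ h₁)), ?_, ?_⟩
    · simp only [sub_eq_add_neg, smul_Zd1, add_Zd1, neg_Zd1]
      ring
    · simp only [sub_eq_add_neg, smul_Zd2, add_Zd2, neg_Zd2]
      field_simp
      rw [hdd]; ring
  -- The vector `w*` maps `e₁` to `Z_2` and `e₂` to `-Z_1`, whatever their components in `𝔷 ⊕ W`
  -- are; so `V` contains the centre.
  have hZ2 : (⟨0, 0, 0, 0, 1, 0, 0, 0, 0⟩ : TauSpace r lam) ∈ V := by
    have := hV ⟨0, 0, 1, 0, 0, 0, 0, 0, 0⟩ ⟨rfl, rfl, rfl, rfl, rfl, rfl⟩ e₁ he₁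
    convert this using 1
    ext <;> simp [lie_def, pair, p1, p2]
  have hZ1 : (⟨0, 0, 0, 1, 0, 0, 0, 0, 0⟩ : TauSpace r lam) ∈ V := by
    have := V.neg_mem (hV ⟨0, 0, 1, 0, 0, 0, 0, 0, 0⟩ ⟨rfl, rfl, rfl, rfl, rfl, rfl⟩ e₂ he₂)
    convert this using 1
    ext <;> simp [lie_def, pair, q1, q2]
  have hZ : ∀ v : TauSpace r lam, v.y = 0 ∧ v.Wd = 0 ∧ v.wd = 0 → v.W = 0 → v.w = 0 → v.Zd1 = 0 →
      v.Zd2 = 0 → v ∈ V := by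
    rintro v ⟨h1, h2, h3⟩ h4 h5 h6 h7
    have : v = v.Z1 • (⟨0, 0, 0, 1, 0, 0, 0, 0, 0⟩ : TauSpace r lam)
        + v.Z2 • (⟨0, 0, 0, 0, 1, 0, 0, 0, 0⟩ : TauSpace r lam) := by
      ext <;> simp [h1, h2, h3, h4, h5, h6, h7]
    rw [this]
    exact V.add_mem (V.smul_mem _ hZ1) (V.smul_mem _ hZ2)
  set u := x - x.Zd1 • e₁ - x.Zd2 • e₂ with hu
  have hu1 : u.Zd1 = 0 := by simp [hu, sub_eq_add_neg, p1, q1]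
  have hu2 : u.Zd2 = 0 := by simp [hu, sub_eq_add_neg, p2, q2]
  have hum : u.y = 0 ∧ u.Wd = 0 ∧ u.wd = 0 := by
    obtain ⟨a1, a2, a3⟩ := hx
    obtain ⟨b1, b2, b3⟩ := hVm e₁ he₁
    obtain ⟨c1, c2, c3⟩ := hVm e₂ he₂
    simp [hu, sub_eq_add_neg, a1, a2, a3, b1, b2, b3, c1, c2, c3]
  set N : Fin s → ℝ := fun α => lam 0 α ^ 2 + lam 1 α ^ 2 with hN
  -- With these choices `[k₁, e₁] + [k₂, e₂]` has the same `W_α`- and `w`-coordinates as `u`,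
  -- because `λ_1² + λ_2² = N`; the difference lies in the centre.
  set k₁ : TauSpace r lam := ⟨u.w, fun α => eps r α * u.W α * lam 0 α / N α, 0, 0, 0, 0, 0, 0, 0⟩
    with hk₁
  set k₂ : TauSpace r lam := ⟨0, fun α => eps r α * u.W α * lam 1 α / N α, 0, 0, 0, 0, 0, 0, 0⟩
    with hk₂
  have hW : u - ⁅k₁, e₁⁆ - ⁅k₂, e₂⁆ ∈ V := by
    obtain ⟨a1, a2, a3⟩ := hum
    refine hZ _ ?_ ?_ ?_ ?_ ?_
    · refine ⟨?_, ?_, ?_⟩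
      · simp [sub_eq_add_neg, lie_def, a1, hk₁, hk₂]
      · ext α; simp [sub_eq_add_neg, lie_def, pair, a2, hk₁, hk₂]
      · simp [sub_eq_add_neg, lie_def, a3, hk₁, hk₂]
    · ext α
      simp only [sub_eq_add_neg, lie_def, pair, hk₁, hk₂, p1, p2, q1, q2, add_W, neg_W,
        Pi.add_apply, Pi.neg_apply, Pi.zero_apply]
      have hN0 := normSq_ne_zero hl α
      have he := eps_mul_self (r := r) α
      have : u.W α = eps r α * eps r α * u.W α * ((lam 0 α ^ 2 + lam 1 α ^ 2) / N α) := by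
        rw [he, hN, div_self hN0]; ring
      nth_rewrite 1 [this]
      ring
    · simp [sub_eq_add_neg, lie_def, hk₁, hk₂, p1, p2, q1, q2]
    · simp [sub_eq_add_neg, lie_def, hu1]
    · simp [sub_eq_add_neg, lie_def, hu2]
  have : x = (u - ⁅k₁, e₁⁆ - ⁅k₂, e₂⁆) + ⁅k₁, e₁⁆ + ⁅k₂, e₂⁆ + x.Zd1 • e₁ + x.Zd2 • e₂ := by
    rw [hu]; abel
  rw [this]
  exact V.add_mem (V.add_mem (V.add_mem (V.add_mem hW
    (hV _ ⟨rfl, rfl, rfl, rfl, rfl, rfl⟩ _ he₁)) (hV _ ⟨rfl, rfl, rfl, rfl, rfl, rfl⟩ _ he₂))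
    (V.smul_mem _ he₁)) (V.smul_mem _ he₂)

end

end TauSpace

/-! ### The normal forms are of type (IIa) -/

section
variable {n : ℕ} {r : Fin (n - 5 + 1)} {lam : Fin 2 → Fin (n - 5) → ℝ}
  (hl : TauSpace.Admissible lam)

/-- An element of the Lie algebra of the normal form, given by its coordinates. -/
def toTau (a : TauSpace (r : ℕ) lam) : (tau n r lam hl).g := a

/-- The span of `W_1, …, W_s, w`, as a subspace of the normal form. -/
def tauW : Submodule ℝ (tau n r lam hl).g := TauSpace.subW (r := (r : ℕ)) (lam := lam)

/-- The span of `Z*_1, Z*_2`, as a subspace of the normal form. -/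
def tauZd : Submodule ℝ (tau n r lam hl).g := TauSpace.subZd (r := (r : ℕ)) (lam := lam)

theorem tau_mem_h (a : (tau n r lam hl).g) : a ∈ (tau n r lam hl).h ↔
    TauSpace.Z1 a = 0 ∧ TauSpace.Z2 a = 0 ∧ TauSpace.W a = 0 ∧ TauSpace.w a = 0 ∧ TauSpace.Zd1 a = 0 ∧ TauSpace.Zd2 a = 0 := TauSpace.mem_h_iff a

theorem tau_mem_m (a : (tau n r lam hl).g) : a ∈ (tau n r lam hl).m ↔
    TauSpace.y a = 0 ∧ TauSpace.Wd a = 0 ∧ TauSpace.wd a = 0 := TauSpace.mem_m_iff a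

theorem tau_mem_z (a : (tau n r lam hl).g) : a ∈ (tau n r lam hl).z ↔
    TauSpace.y a = 0 ∧ TauSpace.Wd a = 0 ∧ TauSpace.wd a = 0 ∧ TauSpace.W a = 0 ∧ TauSpace.w a = 0 ∧ TauSpace.Zd1 a = 0 ∧ TauSpace.Zd2 a = 0 :=
  SymmetricTriple.mem_z.trans (TauSpace.mem_center_iff hl a)

theorem tau_mem_hm (a : (tau n r lam hl).g) : a ∈ (tau n r lam hl).hm ↔
    TauSpace.y a = 0 ∧ TauSpace.Wd a = 0 ∧ TauSpace.wd a = 0 ∧ TauSpace.Zd1 a = 0 ∧ TauSpace.Zd2 a = 0 := by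
  constructor
  · intro ha
    induction ha using Submodule.span_induction with
    | mem x hx =>
      obtain ⟨k, hk, v, hv, rfl⟩ := hx
      have := (tau_mem_m hl _).mp (SymmetricTriple.lie_mem_m hk hv)
      exact ⟨this.1, this.2.1, this.2.2, rfl, rfl⟩
    | zero => exact ⟨rfl, rfl, rfl, rfl, rfl⟩
    | add x y _ _ hx hy =>
      obtain ⟨a1, a2, a3, a4, a5⟩ := hx
      obtain ⟨b1, b2, b3, b4, b5⟩ := hy
      refine ⟨(congrArg₂ (· + ·) a1 b1).trans (add_zero _),
        (congrArg₂ (· + ·) a2 b2).trans (add_zero _), (congrArg₂ (· + ·) a3 b3).trans (add_zero _),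
        (congrArg₂ (· + ·) a4 b4).trans (add_zero _), (congrArg₂ (· + ·) a5 b5).trans (add_zero _)⟩
    | smul c x _ hx =>
      obtain ⟨a1, a2, a3, a4, a5⟩ := hx
      exact ⟨(congrArg (c * ·) a1).trans (mul_zero _), (congrArg (c • ·) a2).trans (smul_zero _),
        (congrArg (c * ·) a3).trans (mul_zero _), (congrArg (c * ·) a4).trans (mul_zero _),
        (congrArg (c * ·) a5).trans (mul_zero _)⟩
  · rintro ⟨h1, h2, h3, h4, h5⟩
    have key : (a : TauSpace (r : ℕ) lam) = ⁅(⟨TauSpace.w a, fun α => TauSpace.eps r α * TauSpace.W a α * lam 0 α / (lam 0 α ^ 2 + lam 1 α ^ 2),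
          TauSpace.Z2 a, 0, 0, 0, 0, 0, 0⟩ : TauSpace (r : ℕ) lam),
          (⟨0, 0, 0, 0, 0, 0, 0, 1, 0⟩ : TauSpace (r : ℕ) lam)⁆
        + ⁅(⟨0, fun α => TauSpace.eps r α * TauSpace.W a α * lam 1 α / (lam 0 α ^ 2 + lam 1 α ^ 2),
          0, 0, 0, 0, 0, 0, 0⟩ : TauSpace (r : ℕ) lam),
          (⟨0, 0, 0, 0, 0, 0, 0, 0, 1⟩ : TauSpace (r : ℕ) lam)⁆
        + ⁅(⟨1, 0, 0, 0, 0, 0, 0, 0, 0⟩ : TauSpace (r : ℕ) lam),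
          (⟨0, 0, 0, 0, 0, 0, -TauSpace.Z1 a, 0, 0⟩ : TauSpace (r : ℕ) lam)⁆ := by
      refine TauSpace.ext ?_ (funext fun α => ?_) ?_ ?_ ?_ (funext fun α => ?_) ?_ ?_ ?_
      · simp [TauSpace.lie_def, h1]
      · simp [TauSpace.lie_def, TauSpace.pair, h2]
      · simp [TauSpace.lie_def, h3]
      · simp [TauSpace.lie_def]
      · simp [TauSpace.lie_def]
      · simp only [TauSpace.lie_def, TauSpace.pair, TauSpace.add_W, Pi.add_apply]
        have hN0 := TauSpace.normSq_ne_zero hl α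
        have he := TauSpace.eps_mul_self (r := (r : ℕ)) α
        have : TauSpace.W a α = TauSpace.eps r α * TauSpace.eps r α * TauSpace.W a α *
            ((lam 0 α ^ 2 + lam 1 α ^ 2) / (lam 0 α ^ 2 + lam 1 α ^ 2)) := by
          rw [he, div_self hN0]; ring
        nth_rewrite 1 [this]
        simp only [Pi.zero_apply]
        ring
      · simp [TauSpace.lie_def]
      · simp [TauSpace.lie_def, h4]
      · simp [TauSpace.lie_def, h5]
    have mk : ∀ k x : TauSpace (r : ℕ) lam,
        (k.Z1 = 0 ∧ k.Z2 = 0 ∧ k.W = 0 ∧ k.w = 0 ∧ k.Zd1 = 0 ∧ k.Zd2 = 0) →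
        (x.y = 0 ∧ x.Wd = 0 ∧ x.wd = 0) → toTau hl ⁅k, x⁆ ∈ (tau n r lam hl).hm :=
      fun k x hk hx => Submodule.subset_span ⟨toTau hl k, (tau_mem_h hl k).mpr hk, toTau hl x,
        (tau_mem_m hl x).mpr hx, rfl⟩
    rw [key]
    exact Submodule.add_mem _ (Submodule.add_mem _
      (mk _ _ ⟨rfl, rfl, rfl, rfl, rfl, rfl⟩ ⟨rfl, rfl, rfl⟩)
      (mk _ _ ⟨rfl, rfl, rfl, rfl, rfl, rfl⟩ ⟨rfl, rfl, rfl⟩))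
      (mk _ _ ⟨rfl, rfl, rfl, rfl, rfl, rfl⟩ ⟨rfl, rfl, rfl⟩)

theorem tau_finrank_m (hn : 5 ≤ n) : Module.finrank ℝ (tau n r lam hl).m = n := by
  have hr : (tau n r lam hl).m = LinearMap.range (TauSpace.inclM (r := (r : ℕ)) (lam := lam)) := by
    ext a
    refine (tau_mem_m hl a).trans ⟨?_, ?_⟩
    · rintro ⟨h1, h2, h3⟩
      refine ⟨((a.Z1, a.Z2), a.W, a.w, (a.Zd1, a.Zd2)), ?_⟩
      exact TauSpace.ext h1.symm h2.symm h3.symm rfl rfl rfl rfl rfl rfl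
    · rintro ⟨p, rfl⟩
      exact ⟨rfl, rfl, rfl⟩
  have hi : Function.Injective (TauSpace.inclM (r := (r : ℕ)) (lam := lam)) := by
    rintro ⟨⟨p1, p2⟩, p3, p4, p5, p6⟩ ⟨⟨q1, q2⟩, q3, q4, q5, q6⟩ h
    have := TauSpace.ext_iff.mp h
    simp only [TauSpace.inclM, LinearMap.coe_mk, AddHom.coe_mk] at this
    simp [this]
  rw [hr]
  refine (LinearMap.finrank_range_of_inj hi).trans ?_
  simp
  omega

/-- Explicit definite subspaces of dimensions `n - 2` and `2` bound both indices from below, and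
these bounds already add up to `dim 𝔪 = n`. -/
theorem tau_hasSignature (hn : 5 ≤ n) : (tau n r lam hl).HasSignature 2 (n - 2) := by
  set τ := tau n r lam hl with hτ
  set Q := (τ.B.restrict τ.m).toQuadraticMap with hQ
  have hQa : ∀ x : τ.m, Q x = τ.B x x := fun x => rfl
  have hsum := QuadraticForm.sigPos_add_sigNeg_add_radical (Q := Q)
  rw [tau_finrank_m hl hn] at hsum
  have hp : n - 2 ≤ sigPos Q := by
    let f : ((ℝ × ℝ) × (Fin (n - 5) → ℝ) × ℝ) →ₗ[ℝ] τ.m :=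
      LinearMap.codRestrict τ.m (TauSpace.inclPos (r := (r : ℕ)) (lam := lam))
        (fun p => (tau_mem_m hl _).mpr ⟨rfl, rfl, rfl⟩)
    have hf : ∀ p, Q (f p) = 2 * p.1.1 ^ 2 + 2 * p.1.2 ^ 2 + ∑ α, p.2.1 α * p.2.1 α + p.2.2 ^ 2 := by
      intro p
      refine (TauSpace.form_apply (TauSpace.inclPos (r := (r : ℕ)) (lam := lam) p)
        (TauSpace.inclPos p)).trans ?_
      simp [TauSpace.inclPos]
      ring
    have hpos : ∀ p, p ≠ 0 → 0 < Q (f p) := by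
      rintro ⟨⟨p1, p2⟩, p3, p4⟩ hp
      rw [hf]
      have hs : 0 ≤ ∑ α, p3 α * p3 α := Finset.sum_nonneg fun α _ => mul_self_nonneg _
      by_contra! hle
      apply hp
      simp only at hle
      have z1 : p1 ^ 2 ≤ 0 := by nlinarith [sq_nonneg p1, sq_nonneg p2, sq_nonneg p4]
      have z2 : p2 ^ 2 ≤ 0 := by nlinarith [sq_nonneg p1, sq_nonneg p2, sq_nonneg p4]
      have z4 : p4 ^ 2 ≤ 0 := by nlinarith [sq_nonneg p1, sq_nonneg p2, sq_nonneg p4]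
      have z3 : ∑ α, p3 α * p3 α = 0 := by
        nlinarith [sq_nonneg p1, sq_nonneg p2, sq_nonneg p4]
      rw [Finset.sum_eq_zero_iff_of_nonneg fun α _ => mul_self_nonneg _] at z3
      have w3 : p3 = 0 := funext fun α => mul_self_eq_zero.mp (z3 α (Finset.mem_univ _))
      have w1 : p1 = 0 := pow_eq_zero_iff two_ne_zero |>.mp (le_antisymm z1 (sq_nonneg _))
      have w2 : p2 = 0 := pow_eq_zero_iff two_ne_zero |>.mp (le_antisymm z2 (sq_nonneg _))
      have w4 : p4 = 0 := pow_eq_zero_iff two_ne_zero |>.mp (le_antisymm z4 (sq_nonneg _))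
      simp [w1, w2, w3, w4]
    have hinj : Function.Injective f := by
      rw [injective_iff_map_eq_zero]
      intro p hp
      by_contra h
      have := hpos p h
      rw [hp, map_zero] at this
      exact lt_irrefl _ this
    have h1 : Module.finrank ℝ (LinearMap.range f) = n - 2 := by
      rw [LinearMap.finrank_range_of_inj hinj]
      simp
      omega
    rw [← h1]
    refine le_sigPos_of_posDef Q ?_
    rintro ⟨_, p, rfl⟩ hx
    refine hpos p fun h => hx (Subtype.ext ?_)
    change f p = 0
    rw [h, map_zero]
  have hm : 2 ≤ sigNeg Q := by
    let f : (ℝ × ℝ) →ₗ[ℝ] τ.m :=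
      LinearMap.codRestrict τ.m (TauSpace.inclNeg (r := (r : ℕ)) (lam := lam))
        (fun p => (tau_mem_m hl _).mpr ⟨rfl, rfl, rfl⟩)
    have hf : ∀ p, Q (f p) = - (2 * p.1 ^ 2 + 2 * p.2 ^ 2) := by
      intro p
      refine (TauSpace.form_apply (TauSpace.inclNeg (r := (r : ℕ)) (lam := lam) p)
        (TauSpace.inclNeg p)).trans ?_
      simp [TauSpace.inclNeg]
      ring
    have hpos : ∀ p, p ≠ 0 → 0 < - Q (f p) := by
      rintro ⟨p1, p2⟩ hp
      rw [hf, neg_neg]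
      by_contra! hle
      apply hp
      simp only at hle
      have z1 : p1 ^ 2 ≤ 0 := by nlinarith [sq_nonneg p1, sq_nonneg p2]
      have z2 : p2 ^ 2 ≤ 0 := by nlinarith [sq_nonneg p1, sq_nonneg p2]
      have w1 : p1 = 0 := pow_eq_zero_iff two_ne_zero |>.mp (le_antisymm z1 (sq_nonneg _))
      have w2 : p2 = 0 := pow_eq_zero_iff two_ne_zero |>.mp (le_antisymm z2 (sq_nonneg _))
      simp [w1, w2]
    have hinj : Function.Injective f := by
      rw [injective_iff_map_eq_zero]
      intro p hp
      by_contra h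
      have := hpos p h
      rw [hp, map_zero, neg_zero] at this
      exact lt_irrefl _ this
    have h1 : Module.finrank ℝ (LinearMap.range f) = 2 := by
      rw [LinearMap.finrank_range_of_inj hinj]
      simp
    rw [← h1]
    refine le_sigNeg_of_negDef Q ?_
    rintro ⟨_, p, rfl⟩ hx
    refine hpos p fun h => hx (Subtype.ext ?_)
    change f p = 0
    rw [h, map_zero]
  exact ⟨show sigNeg Q = 2 by omega, show sigPos Q = n - 2 by omega⟩

/-- Let `Δ(v, x)` be the determinant of the `𝔷*`-components; it is the `y`-coordinate of `[v, x]`.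
If `V` is invariant and non-singular with orthogonal complement `V'` in `𝔪`, then `[V, V'] = 0`, so
`Δ` vanishes on `V × V'`. On `V × V` and `V' × V'` it vanishes because otherwise, by
`mem_of_det_ne_zero`, one summand would be all of `𝔪`. So `Δ = 0` on `𝔪 = V ⊕ V'`, against `Δ(Z*_1,
Z*_2) = 1`. -/
theorem tau_indecomposable : (tau n r lam hl).Indecomposable := by
  intro V hVm hVh hVB
  have hm : ∀ U : Submodule ℝ (tau n r lam hl).g, U ≤ (tau n r lam hl).m →
      (∀ x ∈ (tau n r lam hl).h, ∀ v ∈ U, ⁅x, v⁆ ∈ U) → ∀ v₁ ∈ U, ∀ v₂ ∈ U,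
      TauSpace.Zd1 v₁ * TauSpace.Zd2 v₂
      - TauSpace.Zd2 v₁ * TauSpace.Zd1 v₂ ≠ 0 → U = (tau n r lam hl).m := by
    intro U hUm hU v₁ h₁ v₂ h₂ hd
    refine le_antisymm hUm fun x hx => ?_
    exact TauSpace.mem_of_det_ne_zero hl U (fun v hv => (tau_mem_m hl v).mp (hUm hv))
      (fun k hk v hv => hU k ((tau_mem_h hl k).mpr hk) v hv) h₁ h₂ hd x ((tau_mem_m hl x).mp hx)
  by_contra hcon
  push Not at hcon
  obtain ⟨hV0, hV1⟩ := hcon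
  have hdV : ∀ v₁ ∈ V, ∀ v₂ ∈ V, TauSpace.Zd1 v₁ * TauSpace.Zd2 v₂
      - TauSpace.Zd2 v₁ * TauSpace.Zd1 v₂ = 0 := fun v₁ h₁ v₂ h₂ => by
    by_contra hd
    exact hV1 (hm V hVm hVh v₁ h₁ v₂ h₂ hd)
  set V' : Submodule ℝ (tau n r lam hl).g := (tau n r lam hl).m ⊓ (tau n r lam hl).B.orthogonal V with hV'
  have hV'mem : ∀ x ∈ V', x ∈ (tau n r lam hl).m ∧ ∀ v ∈ V, (tau n r lam hl).B v x = 0 := fun x hx =>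
    ⟨hx.1, fun v hv => LinearMap.BilinForm.mem_orthogonal_iff.mp hx.2 v hv⟩
  have hV'h : ∀ x ∈ (tau n r lam hl).h, ∀ v ∈ V', ⁅x, v⁆ ∈ V' := fun x hx v hv => by
    refine ⟨SymmetricTriple.lie_mem_m hx hv.1, LinearMap.BilinForm.mem_orthogonal_iff.mpr ?_⟩
    intro u hu
    have := (tau n r lam hl).B_ad x u v
    rw [(hV'mem v hv).2 _ (hVh x hx u hu)] at this
    exact neg_eq_zero.mp this.symm
  have hdV' : ∀ v₁ ∈ V', ∀ v₂ ∈ V', TauSpace.Zd1 v₁ * TauSpace.Zd2 v₂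
      - TauSpace.Zd2 v₁ * TauSpace.Zd1 v₂ = 0 := fun v₁ h₁ v₂ h₂ => by
    by_contra hd
    have h := hm V' inf_le_left hV'h v₁ h₁ v₂ h₂ hd
    apply hV0
    rw [Submodule.eq_bot_iff]
    intro v hv
    refine hVB v hv fun w hw => ?_
    exact (hV'mem w (h.symm ▸ hVm hw)).2 v hv
  have hVV' : ∀ v ∈ V, ∀ x ∈ V', TauSpace.Zd1 v * TauSpace.Zd2 x
      - TauSpace.Zd2 v * TauSpace.Zd1 x = 0 := fun v hv x hx => by
    -- For `k ∈ 𝔥` one has `B(k, [v, x]) = B([k, v], x) = 0`, as `V` is invariant.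
    have h0 : ⁅v, x⁆ = 0 := by
      refine (tau n r lam hl).B_nondeg _ fun y => ?_
      obtain ⟨k, hk, u, hu, rfl⟩ := SymmetricTriple.exists_h_add_m y
      rw [map_add, SymmetricTriple.B_h_m (SymmetricTriple.lie_mem_h (hVm hv) hx.1) hu, add_zero,
        (tau n r lam hl).B_symm, ← SymmetricTriple.B_lie]
      exact (hV'mem x hx).2 _ (hVh k hk v hv)
    exact congrArg TauSpace.y h0
  have hsplit : ∀ x ∈ (tau n r lam hl).m, ∃ v ∈ V, ∃ x' ∈ V', x = v + x' := by
    intro x hx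
    have href : (tau n r lam hl).B.IsRefl := fun a b hab => by rw [(tau n r lam hl).B_symm, hab]
    have hnd : ((tau n r lam hl).B.restrict V).Nondegenerate := by
      refine ⟨fun x hx => ?_, fun x hx => ?_⟩
      · exact Subtype.ext (hVB x x.2 fun w hw => hx ⟨w, hw⟩)
      · exact Subtype.ext (hVB x x.2 fun w hw => ((tau n r lam hl).B_symm _ _).trans (hx ⟨w, hw⟩))
    have hc := LinearMap.BilinForm.isCompl_orthogonal_of_restrict_nondegenerate href hnd
    have hxt : x ∈ V ⊔ (tau n r lam hl).B.orthogonal V := by rw [hc.sup_eq_top]; trivial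
    obtain ⟨v, hv, x', hx', rfl⟩ := Submodule.mem_sup.mp hxt
    refine ⟨v, hv, x', ⟨?_, hx'⟩, rfl⟩
    have := (tau n r lam hl).m.sub_mem hx (hVm hv)
    rwa [add_sub_cancel_left] at this
  obtain ⟨a, ha, a', ha', h1⟩ := hsplit (toTau hl ⟨0, 0, 0, 0, 0, 0, 0, 1, 0⟩)
    ((tau_mem_m hl _).mpr ⟨rfl, rfl, rfl⟩)
  obtain ⟨b, hb, b', hb', h2⟩ := hsplit (toTau hl ⟨0, 0, 0, 0, 0, 0, 0, 0, 1⟩)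
    ((tau_mem_m hl _).mpr ⟨rfl, rfl, rfl⟩)
  have e1 : (1 : ℝ) = TauSpace.Zd1 a + TauSpace.Zd1 a' := congrArg TauSpace.Zd1 h1
  have e2 : (0 : ℝ) = TauSpace.Zd2 a + TauSpace.Zd2 a' := congrArg TauSpace.Zd2 h1
  have e3 : (0 : ℝ) = TauSpace.Zd1 b + TauSpace.Zd1 b' := congrArg TauSpace.Zd1 h2
  have e4 : (1 : ℝ) = TauSpace.Zd2 b + TauSpace.Zd2 b' := congrArg TauSpace.Zd2 h2
  have d1 := hdV a ha b hb
  have d2 := hdV' a' ha' b' hb'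
  have d3 := hVV' a ha b' hb'
  have d4 := hVV' b hb a' ha'
  generalize TauSpace.Zd1 a = a1 at *
  generalize TauSpace.Zd1 a' = a1' at *
  generalize TauSpace.Zd2 a = a2 at *
  generalize TauSpace.Zd2 a' = a2' at *
  generalize TauSpace.Zd1 b = b1 at *
  generalize TauSpace.Zd1 b' = b1' at *
  generalize TauSpace.Zd2 b = b2 at *
  generalize TauSpace.Zd2 b' = b2' at *
  have : (a1 + a1') * (b2 + b2') - (a2 + a2') * (b1 + b1') = 0 := by linarith
  rw [← e1, ← e2, ← e3, ← e4] at this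
  norm_num at this

theorem tau_isAdaptedDecomposition :
    (tau n r lam hl).IsAdaptedDecomposition (tauW hl) (tauZd hl) := by
  have hzW : ∀ a : (tau n r lam hl).g, a ∈ (tau n r lam hl).z ⊔ tauW hl ↔
      a ∈ (tau n r lam hl).hm := by
    intro a
    rw [tau_mem_hm]
    constructor
    · intro ha
      obtain ⟨b, hb, c, hc, rfl⟩ := Submodule.mem_sup.mp ha
      obtain ⟨b1, b2, b3, b4, b5, b6, b7⟩ := (tau_mem_z hl b).mp hb
      obtain ⟨c1, c2, c3, c4, c5, c6, c7⟩ := (TauSpace.mem_subW c).mp hc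
      exact ⟨(congrArg₂ (· + ·) b1 c1).trans (add_zero _),
        (congrArg₂ (· + ·) b2 c2).trans (add_zero _), (congrArg₂ (· + ·) b3 c3).trans (add_zero _),
        (congrArg₂ (· + ·) b6 c6).trans (add_zero _), (congrArg₂ (· + ·) b7 c7).trans (add_zero _)⟩
    · rintro ⟨h1, h2, h3, h4, h5⟩
      refine Submodule.mem_sup.mpr ⟨toTau hl ⟨0, 0, 0, TauSpace.Z1 a, TauSpace.Z2 a, 0, 0, 0, 0⟩,
        (tau_mem_z hl _).mpr ⟨rfl, rfl, rfl, rfl, rfl, rfl, rfl⟩,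
        toTau hl ⟨0, 0, 0, 0, 0, TauSpace.W a, TauSpace.w a, 0, 0⟩,
        (TauSpace.mem_subW _).mpr ⟨rfl, rfl, rfl, rfl, rfl, rfl, rfl⟩, ?_⟩
      refine TauSpace.ext ?_ ?_ ?_ ?_ ?_ ?_ ?_ ?_ ?_
      · exact (add_zero _).trans h1.symm
      · exact (add_zero _).trans h2.symm
      · exact (add_zero _).trans h3.symm
      · exact (add_zero _)
      · exact (add_zero _)
      · exact (zero_add _)
      · exact (zero_add _)
      · exact (add_zero _).trans h4.symm
      · exact (add_zero _).trans h5.symm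
  refine ⟨?_, ?_, ?_, ?_, ?_, ?_, ?_⟩
  · rw [Submodule.disjoint_def]
    intro a ha hb
    obtain ⟨b1, b2, b3, b4, b5, b6, b7⟩ := (tau_mem_z hl a).mp ha
    obtain ⟨c1, c2, c3, c4, c5, c6, c7⟩ := (TauSpace.mem_subW a).mp hb
    exact TauSpace.ext b1 b2 b3 c4 c5 b4 b5 b6 b7
  · ext a; exact hzW a
  · rw [Submodule.disjoint_def]
    intro a ha hb
    obtain ⟨b1, b2, b3, b4, b5⟩ := (tau_mem_hm hl a).mp ((hzW a).mp ha)
    obtain ⟨c1, c2, c3, c4, c5, c6, c7⟩ := (TauSpace.mem_subZd a).mp hb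
    exact TauSpace.ext b1 b2 b3 c4 c5 c6 c7 b4 b5
  · ext a
    rw [tau_mem_m]
    constructor
    · intro ha
      obtain ⟨b, hb, c, hc, rfl⟩ := Submodule.mem_sup.mp ha
      obtain ⟨b1, b2, b3, b4, b5⟩ := (tau_mem_hm hl b).mp ((hzW b).mp hb)
      obtain ⟨c1, c2, c3, c4, c5, c6, c7⟩ := (TauSpace.mem_subZd c).mp hc
      exact ⟨(congrArg₂ (· + ·) b1 c1).trans (add_zero _),
        (congrArg₂ (· + ·) b2 c2).trans (add_zero _), (congrArg₂ (· + ·) b3 c3).trans (add_zero _)⟩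
    · rintro ⟨h1, h2, h3⟩
      refine Submodule.mem_sup.mpr
        ⟨toTau hl ⟨0, 0, 0, TauSpace.Z1 a, TauSpace.Z2 a, TauSpace.W a, TauSpace.w a, 0, 0⟩,
        (hzW _).mpr ((tau_mem_hm hl _).mpr ⟨rfl, rfl, rfl, rfl, rfl⟩),
        toTau hl ⟨0, 0, 0, 0, 0, 0, 0, TauSpace.Zd1 a, TauSpace.Zd2 a⟩,
        (TauSpace.mem_subZd _).mpr ⟨rfl, rfl, rfl, rfl, rfl, rfl, rfl⟩, ?_⟩
      refine TauSpace.ext ?_ ?_ ?_ ?_ ?_ ?_ ?_ ?_ ?_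
      · exact (add_zero _).trans h1.symm
      · exact (add_zero _).trans h2.symm
      · exact (add_zero _).trans h3.symm
      · exact (add_zero _)
      · exact (add_zero _)
      · exact (add_zero _)
      · exact (add_zero _)
      · exact (zero_add _)
      · exact (zero_add _)
  · intro a ha b hb
    obtain ⟨a1, a2, a3, a4, a5, a6, a7⟩ := (tau_mem_z hl a).mp ha
    obtain ⟨b1, b2, b3, b4, b5, b6, b7⟩ := (tau_mem_z hl b).mp hb
    refine (TauSpace.form_apply (r := (r : ℕ)) (lam := lam) a b).trans ?_
    simp [a1, a2, a3, a4, a5, a6, a7, b6, b7]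
  · intro a ha b hb
    obtain ⟨a1, a2, a3, a4, a5, a6, a7⟩ := (TauSpace.mem_subZd a).mp ha
    obtain ⟨b1, b2, b3, b4, b5, b6, b7⟩ := (TauSpace.mem_subZd b).mp hb
    refine (TauSpace.form_apply (r := (r : ℕ)) (lam := lam) a b).trans ?_
    simp [a1, a2, a3, a4, a5, a6, a7, b4, b5]
  · intro a ha b hb
    obtain ⟨c, hc, d, hd, rfl⟩ := Submodule.mem_sup.mp ha
    obtain ⟨a1, a2, a3, a4, a5, a6, a7⟩ := (tau_mem_z hl c).mp hc
    obtain ⟨d1, d2, d3, d4, d5, d6, d7⟩ := (TauSpace.mem_subZd d).mp hd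
    obtain ⟨b1, b2, b3, b4, b5, b6, b7⟩ := (TauSpace.mem_subW b).mp hb
    rw [map_add, LinearMap.add_apply]
    have e1 : (tau n r lam hl).B c b = 0 := by
      refine (TauSpace.form_apply (r := (r : ℕ)) (lam := lam) c b).trans ?_
      simp [a1, a2, a3, a4, a5, a6, a7, b6, b7]
    have e2 : (tau n r lam hl).B d b = 0 := by
      refine (TauSpace.form_apply (r := (r : ℕ)) (lam := lam) d b).trans ?_
      simp [d1, d2, d3, d4, d5, d6, d7, b4, b5]
    rw [e1, e2, add_zero]

theorem tau_mem_z_sup_subZd (a : (tau n r lam hl).g) :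
    a ∈ (tau n r lam hl).z ⊔ tauZd hl ↔
      TauSpace.y a = 0 ∧ TauSpace.Wd a = 0 ∧ TauSpace.wd a = 0 ∧ TauSpace.W a = 0 ∧ TauSpace.w a = 0 := by
  constructor
  · intro ha
    obtain ⟨b, hb, c, hc, rfl⟩ := Submodule.mem_sup.mp ha
    obtain ⟨b1, b2, b3, b4, b5, b6, b7⟩ := (tau_mem_z hl b).mp hb
    obtain ⟨c1, c2, c3, c4, c5, c6, c7⟩ := (TauSpace.mem_subZd c).mp hc
    exact ⟨(congrArg₂ (· + ·) b1 c1).trans (add_zero _),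
      (congrArg₂ (· + ·) b2 c2).trans (add_zero _), (congrArg₂ (· + ·) b3 c3).trans (add_zero _),
      (congrArg₂ (· + ·) b4 c6).trans (add_zero _), (congrArg₂ (· + ·) b5 c7).trans (add_zero _)⟩
  · rintro ⟨h1, h2, h3, h4, h5⟩
    refine Submodule.mem_sup.mpr
      ⟨toTau hl ⟨0, 0, 0, TauSpace.Z1 a, TauSpace.Z2 a, 0, 0, 0, 0⟩,
      (tau_mem_z hl _).mpr ⟨rfl, rfl, rfl, rfl, rfl, rfl, rfl⟩,
      toTau hl ⟨0, 0, 0, 0, 0, 0, 0, TauSpace.Zd1 a, TauSpace.Zd2 a⟩,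
      (TauSpace.mem_subZd _).mpr ⟨rfl, rfl, rfl, rfl, rfl, rfl, rfl⟩, ?_⟩
    refine TauSpace.ext ?_ ?_ ?_ ?_ ?_ ?_ ?_ ?_ ?_
    · exact (add_zero _).trans h1.symm
    · exact (add_zero _).trans h2.symm
    · exact (add_zero _).trans h3.symm
    · exact (add_zero _)
    · exact (add_zero _)
    · exact (add_zero _).trans h4.symm
    · exact (add_zero _).trans h5.symm
    · exact (zero_add _)
    · exact (zero_add _)

/-- Modulo `𝔷`, the square of `ad Z*_i` acts on `W_α` by `-ε_α (λ_i^α)²`, so admissibility excludes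
every `W_α`-component, while `w` is sent into `𝔷`. -/
theorem tau_Wnil : (tau n r lam hl).Wnil (tauW hl) (tauZd hl) =
    Submodule.span ℝ {toTau hl ⟨0, 0, 0, 0, 0, 0, 1, 0, 0⟩} := by
  ext a
  rw [Submodule.mem_span_singleton]
  constructor
  · rintro ⟨hW, H⟩
    obtain ⟨b1, b2, b3, b4, b5, b6, b7⟩ := (TauSpace.mem_subW a).mp hW
    refine ⟨TauSpace.w a, TauSpace.ext ?_ ?_ ?_ ?_ ?_ ?_ ?_ ?_ ?_⟩
    · exact (mul_zero _).trans b1.symm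
    · exact (smul_zero _).trans b2.symm
    · exact (mul_zero _).trans b3.symm
    · exact (mul_zero _).trans b4.symm
    · exact (mul_zero _).trans b5.symm
    · refine (smul_zero _).trans (Eq.symm (funext fun α => ?_))
      have H1 := (tau_mem_z_sup_subZd hl _).mp (H
        (toTau hl ⟨0, 0, 0, 0, 0, 0, 0, 1, 0⟩) ⟨rfl, rfl, rfl, rfl, rfl, rfl, rfl⟩
        (toTau hl ⟨0, 0, 0, 0, 0, 0, 0, 1, 0⟩) ⟨rfl, rfl, rfl, rfl, rfl, rfl, rfl⟩)
      have H2 := (tau_mem_z_sup_subZd hl _).mp (H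
        (toTau hl ⟨0, 0, 0, 0, 0, 0, 0, 0, 1⟩) ⟨rfl, rfl, rfl, rfl, rfl, rfl, rfl⟩
        (toTau hl ⟨0, 0, 0, 0, 0, 0, 0, 0, 1⟩) ⟨rfl, rfl, rfl, rfl, rfl, rfl, rfl⟩)
      have c1 := congrFun H1.2.2.2.1 α
      have c2 := congrFun H2.2.2.2.1 α
      have he : TauSpace.eps r α ≠ 0 := fun h => by
        simpa [h] using TauSpace.eps_mul_self (r := (r : ℕ)) α
      change TauSpace.eps r α * (0 * _ - (1 * lam 0 α + 0 * lam 1 α) *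
        ((1 * lam 0 α + 0 * lam 1 α) * TauSpace.W a α - 0 * _)) = 0 at c1
      change TauSpace.eps r α * (0 * _ - (0 * lam 0 α + 1 * lam 1 α) *
        ((0 * lam 0 α + 1 * lam 1 α) * TauSpace.W a α - 0 * _)) = 0 at c2
      simp [he] at c1 c2
      rcases hl α with h | h
      · exact c1.resolve_left h
      · exact c2.resolve_left h
    · exact mul_one _
    · exact (mul_zero _).trans b6.symm
    · exact (mul_zero _).trans b7.symm
  · rintro ⟨c, rfl⟩
    refine Submodule.smul_mem _ c ⟨⟨rfl, rfl, rfl, rfl, rfl, rfl, rfl⟩, fun a ha b hb => ?_⟩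
    obtain ⟨a1, a2, a3, a4, a5, a6, a7⟩ := (TauSpace.mem_subZd a).mp ha
    obtain ⟨b1, b2, b3, b4, b5, b6, b7⟩ := (TauSpace.mem_subZd b).mp hb
    refine (tau_mem_z_sup_subZd hl _).mpr ?_
    have : ∀ a b : TauSpace (r : ℕ) lam, a ∈ TauSpace.subZd (r := (r : ℕ)) (lam := lam) →
        b ∈ TauSpace.subZd (r := (r : ℕ)) (lam := lam) →
        (⁅a, ⁅b, (⟨0, 0, 0, 0, 0, 0, 1, 0, 0⟩ : TauSpace (r : ℕ) lam)⁆⁆).y = 0 ∧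
        (⁅a, ⁅b, (⟨0, 0, 0, 0, 0, 0, 1, 0, 0⟩ : TauSpace (r : ℕ) lam)⁆⁆).Wd = 0 ∧
        (⁅a, ⁅b, (⟨0, 0, 0, 0, 0, 0, 1, 0, 0⟩ : TauSpace (r : ℕ) lam)⁆⁆).wd = 0 ∧
        (⁅a, ⁅b, (⟨0, 0, 0, 0, 0, 0, 1, 0, 0⟩ : TauSpace (r : ℕ) lam)⁆⁆).W = 0 ∧
        (⁅a, ⁅b, (⟨0, 0, 0, 0, 0, 0, 1, 0, 0⟩ : TauSpace (r : ℕ) lam)⁆⁆).w = 0 := by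
      intro a b ha hb
      obtain ⟨a1, a2, a3, a4, a5, a6, a7⟩ := (TauSpace.mem_subZd a).mp ha
      obtain ⟨b1, b2, b3, b4, b5, b6, b7⟩ := (TauSpace.mem_subZd b).mp hb
      refine ⟨?_, ?_, ?_, ?_, ?_⟩ <;> (try ext) <;>
        simp [TauSpace.lie_def, TauSpace.pair, a1, a2, a3, a6, a7, b1, b2, b3, b6,
          b7]
    exact this a b ha hb

theorem tau_isTypeIIa (hn : 5 ≤ n) : (tau n r lam hl).IsTypeIIa n where
  signature := tau_hasSignature hl hn
  indecomposable := tau_indecomposable hl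
  finrank_center := by
    let f : (ℝ × ℝ) →ₗ[ℝ] TauSpace (r : ℕ) lam :=
      { toFun := fun p => ⟨0, 0, 0, p.1, p.2, 0, 0, 0, 0⟩
        map_add' := fun p q => by ext <;> simp
        map_smul' := fun c p => by ext <;> simp }
    have hr : (tau n r lam hl).z = LinearMap.range f := by
      ext a
      refine (tau_mem_z hl a).trans ⟨?_, ?_⟩
      · rintro ⟨h1, h2, h3, h4, h5, h6, h7⟩
        exact ⟨(TauSpace.Z1 a, TauSpace.Z2 a), TauSpace.ext h1.symm h2.symm h3.symm rfl rfl h4.symm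
          h5.symm h6.symm h7.symm⟩
      · rintro ⟨p, rfl⟩
        exact ⟨rfl, rfl, rfl, rfl, rfl, rfl, rfl⟩
    have hi : Function.Injective f := fun p q h =>
      Prod.ext (congrArg TauSpace.Z1 h) (congrArg TauSpace.Z2 h)
    rw [hr]
    refine (LinearMap.finrank_range_of_inj hi).trans ?_
    simp
  finrank_Wnil := by
    refine ⟨_, _, tau_isAdaptedDecomposition hl, ?_⟩
    rw [tau_Wnil]
    refine finrank_span_singleton fun h => ?_
    exact one_ne_zero (congrArg TauSpace.w h)

end

/-! ### Riesz vectors and invariance of traces on Euclidean space -/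

section
variable {N : ℕ}

/-- The vector that represents a linear form on a Euclidean space. -/
noncomputable def rieszVec : (EuclideanSpace ℝ (Fin N) →ₗ[ℝ] ℝ) →ₗ[ℝ] EuclideanSpace ℝ (Fin N) where
  toFun f := WithLp.toLp 2 fun i => f (EuclideanSpace.single i 1)
  map_add' f g := by ext i; simp
  map_smul' c f := by ext i; simp

theorem inner_rieszVec (f : EuclideanSpace ℝ (Fin N) →ₗ[ℝ] ℝ) (x : EuclideanSpace ℝ (Fin N)) :
    inner ℝ (rieszVec f) x = f x := by
  have hx : x = ∑ i, x i • EuclideanSpace.single i (1 : ℝ) := by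
    ext j; simp [Finset.sum_apply, Pi.single_apply]
  conv_rhs => rw [hx, map_sum]
  simp [PiLp.inner_apply, rieszVec]

/-- The infinitesimal form of the invariance of the trace of a bilinear form under rotations: the
skew matrix of `T` is contracted with a symmetrised expression. -/
theorem sum_skew_eq_zero (f : EuclideanSpace ℝ (Fin N) →ₗ[ℝ] EuclideanSpace ℝ (Fin N) →ₗ[ℝ] ℝ)
    (T : EuclideanSpace ℝ (Fin N) →ₗ[ℝ] EuclideanSpace ℝ (Fin N))
    (hT : ∀ x y, inner ℝ (T x) y = - inner ℝ x (T y)) :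
    ∑ i, (f (T (EuclideanSpace.single i 1)) (EuclideanSpace.single i 1)
      + f (EuclideanSpace.single i 1) (T (EuclideanSpace.single i 1))) = 0 := by
  have hx : ∀ x : EuclideanSpace ℝ (Fin N), x = ∑ i, x i • EuclideanSpace.single i (1 : ℝ) := by
    intro x
    ext j; simp [Finset.sum_apply, Pi.single_apply]
  have hsk : ∀ i j, T (EuclideanSpace.single i 1) j = - T (EuclideanSpace.single j 1) i := by
    intro i j
    have := hT (EuclideanSpace.single i 1) (EuclideanSpace.single j 1)
    rw [EuclideanSpace.inner_single_right, EuclideanSpace.inner_single_left] at this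
    simpa using this
  rw [Finset.sum_add_distrib]
  have h1 : ∑ i, f (T (EuclideanSpace.single i 1)) (EuclideanSpace.single i 1) =
      ∑ i, ∑ j, T (EuclideanSpace.single i 1) j *
        f (EuclideanSpace.single j 1) (EuclideanSpace.single i 1) := by
    refine Finset.sum_congr rfl fun i _ => ?_
    conv_lhs => rw [hx (T (EuclideanSpace.single i 1))]
    simp
  have h2 : ∑ i, f (EuclideanSpace.single i 1) (T (EuclideanSpace.single i 1)) =
      ∑ i, ∑ j, T (EuclideanSpace.single i 1) j *
        f (EuclideanSpace.single i 1) (EuclideanSpace.single j 1) := by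
    refine Finset.sum_congr rfl fun i _ => ?_
    conv_lhs => rw [hx (T (EuclideanSpace.single i 1))]
    simp
  rw [h1, h2, Finset.sum_comm (γ := Fin N), ← Finset.sum_add_distrib]
  refine Finset.sum_eq_zero fun i _ => ?_
  rw [← Finset.sum_add_distrib]
  refine Finset.sum_eq_zero fun j _ => ?_
  rw [hsk i j]; ring

end

/-! ### Splittings, and invariant forms on an indecomposable triple -/

namespace SymmetricTriple

/-- A decomposition `𝔪 = 𝔷 ⊕ W ⊕ 𝔷*` with dual bases `Z`, `Zd` of the isotropic subspaces `𝔷`, `𝔷*` and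
an isometric identification `ι` of `W` with a Euclidean space. -/
structure Splitting (τ : SymmetricTriple.{u}) (N : ℕ) where
  ι : EuclideanSpace ℝ (Fin N) →ₗ[ℝ] τ.g
  Z : Fin 2 → τ.g
  Zd : Fin 2 → τ.g
  ι_mem : ∀ x, ι x ∈ τ.m
  Z_mem : ∀ i, Z i ∈ τ.m
  Zd_mem : ∀ i, Zd i ∈ τ.m
  lie_Z : ∀ i (x : τ.g), ⁅x, Z i⁆ = 0
  B_Z_Z : ∀ i j, τ.B (Z i) (Z j) = 0
  B_Zd_Zd : ∀ i j, τ.B (Zd i) (Zd j) = 0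
  B_Z_Zd : ∀ i j, τ.B (Z i) (Zd j) = if i = j then 1 else 0
  B_Z_ι : ∀ i x, τ.B (Z i) (ι x) = 0
  B_Zd_ι : ∀ i x, τ.B (Zd i) (ι x) = 0
  B_ι_ι : ∀ x y, τ.B (ι x) (ι y) = inner ℝ x y
  exists_coord : ∀ x ∈ τ.m, ∃ (p q : Fin 2 → ℝ) (e : EuclideanSpace ℝ (Fin N)),
    x = ∑ i, p i • Z i + ι e + ∑ i, q i • Zd i
  center_le : ∀ x ∈ τ.z, ∃ p : Fin 2 → ℝ, x = ∑ i, p i • Z i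

namespace Splitting

variable {τ : SymmetricTriple.{u}} {N : ℕ} (D : Splitting τ N)

/-- The orthogonal projection to `W`. -/
noncomputable def pr : τ.g →ₗ[ℝ] EuclideanSpace ℝ (Fin N) :=
  rieszVec ∘ₗ (τ.B.compl₂ D.ι)

theorem inner_pr (x : τ.g) (e : EuclideanSpace ℝ (Fin N)) :
    inner ℝ (D.pr x) e = τ.B x (D.ι e) := inner_rieszVec _ e

theorem pr_ι (e : EuclideanSpace ℝ (Fin N)) : D.pr (D.ι e) = e :=
  ext_inner_right ℝ fun x => by rw [D.inner_pr, D.B_ι_ι]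

theorem pr_Z (i : Fin 2) : D.pr (D.Z i) = 0 :=
  ext_inner_right ℝ fun x => by rw [D.inner_pr, D.B_Z_ι, inner_zero_left]

theorem pr_Zd (i : Fin 2) : D.pr (D.Zd i) = 0 :=
  ext_inner_right ℝ fun x => by rw [D.inner_pr, D.B_Zd_ι, inner_zero_left]

theorem Z_lie (i : Fin 2) (x : τ.g) : ⁅D.Z i, x⁆ = 0 := by
  rw [← lie_skew, D.lie_Z, neg_zero]

theorem B_Zd_Z (i j : Fin 2) : τ.B (D.Zd i) (D.Z j) = if i = j then 1 else 0 := by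
  rw [τ.B_symm, D.B_Z_Zd]; simp only [eq_comm]

theorem B_ι_Z (i : Fin 2) (x : EuclideanSpace ℝ (Fin N)) : τ.B (D.ι x) (D.Z i) = 0 := by
  rw [τ.B_symm, D.B_Z_ι]

theorem B_ι_Zd (i : Fin 2) (x : EuclideanSpace ℝ (Fin N)) : τ.B (D.ι x) (D.Zd i) = 0 := by
  rw [τ.B_symm, D.B_Zd_ι]

theorem B_lie_Z (i : Fin 2) (x y : τ.g) : τ.B ⁅x, y⁆ (D.Z i) = 0 := by
  rw [B_lie, D.lie_Z, map_zero]

/-- Orthogonality to `𝔷` removes the `𝔷*`-component. By invariance it holds for every element of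
`[𝔥, 𝔪]`, which is how the lemma is applied in `lie_eq`. -/
theorem eq_of_B_Z {x : τ.g} (hx : x ∈ τ.m) (h : ∀ i, τ.B x (D.Z i) = 0) :
    x = D.ι (D.pr x) + ∑ i, τ.B x (D.Zd i) • D.Z i := by
  obtain ⟨p, q, e, he⟩ := D.exists_coord x hx
  have hq : ∀ j, q j = 0 := fun j => by
    have := h j
    rw [he] at this
    fin_cases j <;> simpa [D.B_Z_Z, D.B_ι_Z, D.B_Zd_Z] using this
  have hp : ∀ j, τ.B x (D.Zd j) = p j := fun j => by
    rw [he]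
    fin_cases j <;> simp [D.B_Z_Zd, D.B_ι_Zd, D.B_Zd_Zd]
  have hpr : D.pr x = e := by
    rw [he]
    simp [D.pr_Z, D.pr_ι, D.pr_Zd]
  simp only [hp, hpr]
  conv_lhs => rw [he]
  simp [hq, add_comm]

theorem lie_eq {k x : τ.g} (hk : k ∈ τ.h) (hx : x ∈ τ.m) :
    ⁅k, x⁆ = D.ι (D.pr ⁅k, x⁆) + ∑ i, τ.B ⁅k, x⁆ (D.Zd i) • D.Z i :=
  D.eq_of_B_Z (lie_mem_m hk hx) fun i => D.B_lie_Z i k x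

/-- The part of `[k, x]` outside `W` is central, hence invisible to a further bracket. This is what
turns iterated brackets into compositions of operators on `W`. -/
theorem lie_lie_eq {k x : τ.g} (hk : k ∈ τ.h) (hx : x ∈ τ.m) (v : τ.g) :
    ⁅⁅k, x⁆, v⁆ = ⁅D.ι (D.pr ⁅k, x⁆), v⁆ := by
  conv_lhs => rw [D.lie_eq hk hx]
  simp [add_lie, D.Z_lie]

theorem lie_lie_eq' {k x : τ.g} (hk : k ∈ τ.h) (hx : x ∈ τ.m) (v : τ.g) :
    ⁅v, ⁅k, x⁆⁆ = ⁅v, D.ι (D.pr ⁅k, x⁆)⁆ := by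
  conv_lhs => rw [D.lie_eq hk hx]
  simp [lie_add, D.lie_Z]

/-- The action of an element of `𝔥` on `W`. -/
noncomputable def rho : τ.g →ₗ[ℝ] EuclideanSpace ℝ (Fin N) →ₗ[ℝ] EuclideanSpace ℝ (Fin N) :=
  LinearMap.mk₂ ℝ (fun k x => D.pr ⁅k, D.ι x⁆) (by simp [add_lie]) (by simp) (by simp) (by simp)

theorem rho_apply (k : τ.g) (x : EuclideanSpace ℝ (Fin N)) : D.rho k x = D.pr ⁅k, D.ι x⁆ := rfl

theorem inner_rho (k : τ.g) (x y : EuclideanSpace ℝ (Fin N)) :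
    inner ℝ (D.rho k x) y = τ.B ⁅k, D.ι x⁆ (D.ι y) := D.inner_pr _ _

theorem rho_skew (k : τ.g) (x y : EuclideanSpace ℝ (Fin N)) :
    inner ℝ (D.rho k x) y = - inner ℝ x (D.rho k y) := by
  rw [inner_rho, real_inner_comm, inner_rho, τ.B_ad, τ.B_symm]

theorem pr_lie_lie {k l x : τ.g} (hl : l ∈ τ.h) (hx : x ∈ τ.m) :
    D.pr ⁅k, ⁅l, x⁆⁆ = D.rho k (D.pr ⁅l, x⁆) := by
  rw [D.lie_lie_eq' hl hx, rho_apply]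

theorem pr_bracket_lie {k l x : τ.g} (hk : k ∈ τ.h) (hl : l ∈ τ.h) (hx : x ∈ τ.m) :
    D.pr ⁅⁅k, l⁆, x⁆ = D.rho k (D.pr ⁅l, x⁆) - D.rho l (D.pr ⁅k, x⁆) := by
  rw [lie_lie, map_sub, D.pr_lie_lie hl hx, D.pr_lie_lie hk hx]

/-- In an indecomposable triple, an `ad 𝔥`-invariant symmetric form on `𝔪` that vanishes on the centre
vanishes on `W`. -/
theorem invariant_form_eq_zero (hind : τ.Indecomposable) (Q : τ.g →ₗ[ℝ] τ.g →ₗ[ℝ] ℝ)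
    (hsymm : ∀ x y, Q x y = Q y x) (hZ : ∀ i y, Q (D.Z i) y = 0)
    (hinv : ∀ k ∈ τ.h, ∀ x ∈ τ.m, ∀ y ∈ τ.m, Q ⁅k, x⁆ y = - Q x ⁅k, y⁆)
    (x y : EuclideanSpace ℝ (Fin N)) : Q (D.ι x) (D.ι y) = 0 := by
  have hZ' : ∀ i y, Q y (D.Z i) = 0 := fun i y => by rw [hsymm, hZ]
  let T : EuclideanSpace ℝ (Fin N) →ₗ[ℝ] EuclideanSpace ℝ (Fin N) :=
    rieszVec ∘ₗ (Q.compl₁₂ D.ι D.ι)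
  have hTi : ∀ a b, inner ℝ (T a) b = Q (D.ι a) (D.ι b) := fun a b => inner_rieszVec _ _
  have hT : T.IsSymmetric := fun a b => by
    rw [hTi, real_inner_comm, hTi, hsymm]
  have hN : Module.finrank ℝ (EuclideanSpace ℝ (Fin N)) = N := by simp
  suffices hT0 : T = 0 by rw [← hTi, hT0]; simp
  refine (hT.eigenvectorBasis hN).toBasis.ext fun i => ?_
  have hmu := hT.apply_eigenvectorBasis hN i
  set b := hT.eigenvectorBasis hN i with hb
  set μ : ℝ := hT.eigenvalues hN i with hμ
  have hb1 : b ≠ 0 := (hT.eigenvectorBasis hN).orthonormal.ne_zero i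
  rw [OrthonormalBasis.coe_toBasis, ← hb, LinearMap.zero_apply, hmu]
  by_cases h0 : μ = 0
  · simp [h0]
  exfalso
  -- The `μ`-eigenspace of `Q` relative to `B` inside `𝔷^⊥`. It is `ad 𝔥`-invariant, since `Q` and
  -- `B` are, and contains a central correction of `ι b`.
  let V : Submodule ℝ τ.g :=
    { carrier := {v | v ∈ τ.m ∧ (∀ i, τ.B v (D.Z i) = 0) ∧ ∀ y ∈ τ.m, Q v y = μ * τ.B v y}
      zero_mem' := by simp
      add_mem' := by
        rintro u v ⟨u1, u2, u3⟩ ⟨v1, v2, v3⟩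
        refine ⟨add_mem u1 v1, fun i => by simp [u2, v2], fun y hy => ?_⟩
        rw [map_add, map_add, LinearMap.add_apply, LinearMap.add_apply, u3 y hy, v3 y hy, mul_add]
      smul_mem' := by
        rintro c u ⟨u1, u2, u3⟩
        refine ⟨Submodule.smul_mem _ _ u1, fun i => by simp [u2], fun y hy => ?_⟩
        rw [map_smul, map_smul, LinearMap.smul_apply, LinearMap.smul_apply, u3 y hy, smul_eq_mul,
          smul_eq_mul]
        ring }
  have hV : ∀ v, v ∈ V ↔ v ∈ τ.m ∧ (∀ i, τ.B v (D.Z i) = 0) ∧ ∀ y ∈ τ.m, Q v y = μ * τ.B v y :=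
    fun v => Iff.rfl
  -- On `V` one has `B(v, v) = ‖pr v‖²`. If `pr v = 0`, then `v` is a combination of the `Z i`, so
  -- `μ B(v, ·) = Q(v, ·) = 0` on `𝔪`, and `μ ≠ 0`.
  have hVB : ∀ v ∈ V, τ.B v v = 0 → v = 0 := by
    intro v hv h
    obtain ⟨v1, v2, v3⟩ := (hV v).mp hv
    have hve := D.eq_of_B_Z v1 v2
    have hpr : D.pr v = 0 := by
      have e : inner ℝ (D.pr v) (D.pr v) = τ.B v v := by
        have e1 : τ.B v (D.ι (D.pr v)) =
            τ.B v (D.ι (D.pr v) + ∑ i, τ.B v (D.Zd i) • D.Z i) := by simp [v2]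
        rw [inner_pr, e1, ← hve]
      rw [h] at e
      exact inner_self_eq_zero.mp e
    refine eq_zero_of_m v1 fun u hu => ?_
    have := v3 u hu
    rw [hve, hpr] at this
    simp only [map_zero, zero_add, map_sum, map_smul, LinearMap.sum_apply, LinearMap.smul_apply, hZ,
      smul_zero, Finset.sum_const_zero] at this
    rw [hve, hpr]
    simp only [map_zero, zero_add, map_sum, map_smul, LinearMap.sum_apply, LinearMap.smul_apply]
    exact (mul_eq_zero.mp this.symm).resolve_left h0
  have hVh : ∀ k ∈ τ.h, ∀ v ∈ V, ⁅k, v⁆ ∈ V := by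
    intro k hk v hv
    obtain ⟨v1, v2, v3⟩ := (hV v).mp hv
    refine (hV _).mpr ⟨lie_mem_m hk v1, fun i => D.B_lie_Z i k v, fun y hy => ?_⟩
    rw [hinv k hk v v1 y hy, v3 _ (lie_mem_m hk hy), τ.B_ad]
    ring
  rcases hind V (fun v hv => hv.1) hVh (fun v hv h => hVB v hv (h v hv)) with h | h
  · let v := D.ι b + ∑ i, (μ⁻¹ * Q (D.ι b) (D.Zd i)) • D.Z i
    have hvV : v ∈ V := by
      refine (hV v).mpr ⟨add_mem (D.ι_mem _) (Submodule.sum_mem _ fun i _ =>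
        Submodule.smul_mem _ _ (D.Z_mem i)), fun i => ?_, fun y hy => ?_⟩
      · simp [v, D.B_ι_Z, D.B_Z_Z]
      · obtain ⟨p, q, e, rfl⟩ := D.exists_coord y hy
        have e1 : Q (D.ι b) (D.ι e) = μ * inner ℝ b e := by
          rw [← hTi, hmu]
          exact real_inner_smul_left _ _ _
        simp only [v, map_add, map_sum, map_smul, LinearMap.add_apply, LinearMap.sum_apply,
          LinearMap.smul_apply, hZ, hZ', e1, D.B_ι_Z, D.B_ι_Zd, D.B_ι_ι, D.B_Z_Z, D.B_Z_ι, D.B_Z_Zd]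
        simp only [Finset.sum_const_zero, zero_add, add_zero, smul_eq_mul, mul_ite,
          mul_one, mul_zero, Finset.sum_ite_eq', Finset.mem_univ, if_true,
          mul_add, Finset.mul_sum]
        congr 1
        refine Finset.sum_congr rfl fun i _ => ?_
        field_simp
    have hv0 : v = 0 := by rw [h] at hvV; exact (Submodule.mem_bot ℝ).mp hvV
    apply hb1
    have := congrArg D.pr hv0
    simpa [v, D.pr_ι, D.pr_Z] using this
  -- The case `V = 𝔪` is impossible, because `Z 0` is a non-zero null vector.
  · have h1 := (hV _).mp (h.symm ▸ D.Z_mem 0 : D.Z 0 ∈ V)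
    have := hVB _ (h.symm ▸ D.Z_mem 0 : D.Z 0 ∈ V) (D.B_Z_Z 0 0)
    have h2 := D.B_Z_Zd 0 0
    rw [this] at h2
    simp at h2

/-- Summing the squares of the operators `u ↦ pr [[ι x, ι y], u]` over pairs of vectors of the
standard orthonormal basis gives a symmetric form that kills `𝔷`. It is `ad 𝔥`-invariant, as the
operators depend equivariantly on `x, y` and `𝔥` acts on `W` by skew maps. By
`invariant_form_eq_zero` it vanishes on `W`, and being a sum of squares it does so term by term. -/
theorem rho_lie_ι_ι (hind : τ.Indecomposable) (x y : EuclideanSpace ℝ (Fin N)) :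
    D.rho ⁅D.ι x, D.ι y⁆ = 0 := by
  let f : EuclideanSpace ℝ (Fin N) → EuclideanSpace ℝ (Fin N) → τ.g →ₗ[ℝ] EuclideanSpace ℝ (Fin N) :=
    fun x y => D.pr ∘ₗ (LieAlgebra.ad ℝ τ.g ⁅D.ι x, D.ι y⁆ : τ.g →ₗ[ℝ] τ.g)
  have hf : ∀ x y u, f x y u = D.pr ⁅⁅D.ι x, D.ι y⁆, u⁆ := fun x y u => rfl
  have hxy : ∀ x y, ⁅D.ι x, D.ι y⁆ ∈ τ.h := fun x y => lie_mem_h (D.ι_mem x) (D.ι_mem y)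
  -- Equivariance of `f` under `𝔥`, from the Jacobi identity; the central parts of `[k, ι x]` and
  -- `[k, ι y]` drop out.
  have hfk : ∀ k ∈ τ.h, ∀ u ∈ τ.m, ∀ x y, f x y ⁅k, u⁆ =
      D.rho k (f x y u) - f (D.rho k x) y u - f x (D.rho k y) u := by
    intro k hk u hu x y
    have e1 : ⁅⁅D.ι x, D.ι y⁆, ⁅k, u⁆⁆ = ⁅k, ⁅⁅D.ι x, D.ι y⁆, u⁆⁆
        - (⁅⁅⁅k, D.ι x⁆, D.ι y⁆, u⁆ + ⁅⁅D.ι x, ⁅k, D.ι y⁆⁆, u⁆) := by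
      rw [leibniz_lie k, ← add_lie, ← leibniz_lie k (D.ι x)]
      abel
    rw [hf, e1, map_sub, map_add, D.pr_lie_lie (hxy x y) hu, D.lie_lie_eq hk (D.ι_mem x),
      D.lie_lie_eq' hk (D.ι_mem y)]
    simp only [hf, rho_apply]
    abel
  let b : Fin N → EuclideanSpace ℝ (Fin N) := fun i => EuclideanSpace.single i 1
  let Q : τ.g →ₗ[ℝ] τ.g →ₗ[ℝ] ℝ :=
    ∑ i, ∑ j, (innerₗ (EuclideanSpace ℝ (Fin N))).compl₁₂ (f (b i) (b j)) (f (b i) (b j))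
  have hQ : ∀ u v, Q u v = ∑ i, ∑ j, inner ℝ (f (b i) (b j) u) (f (b i) (b j) v) := fun u v => by
    simp [Q, LinearMap.sum_apply]
  have h0 := D.invariant_form_eq_zero hind Q
    (fun u v => by rw [hQ, hQ]; simp only [real_inner_comm])
    (fun i v => by rw [hQ]; simp [hf, D.lie_Z]) ?_
  · have h1 : ∀ z i j, f (b i) (b j) (D.ι z) = 0 := by
      intro z i j
      have := h0 z z
      rw [hQ, Finset.sum_eq_zero_iff_of_nonneg fun i _ => Finset.sum_nonneg fun j _ =>
        real_inner_self_nonneg] at this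
      have := this i (Finset.mem_univ i)
      rw [Finset.sum_eq_zero_iff_of_nonneg fun j _ => real_inner_self_nonneg] at this
      exact inner_self_eq_zero.mp (this j (Finset.mem_univ j))
    have hx : ∀ x : EuclideanSpace ℝ (Fin N), x = ∑ i, x i • b i := by
      intro x
      ext j; simp [b, Finset.sum_apply, Pi.single_apply]
    ext1 z
    rw [rho_apply, hx x, hx y]
    simp only [map_sum, map_smul, sum_lie, lie_sum, smul_lie, lie_smul]
    refine Finset.sum_eq_zero fun i _ => ?_
    rw [Finset.smul_sum]
    refine Finset.sum_eq_zero fun j _ => ?_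
    rw [← hf, h1]
    simp
  · intro k hk u hu v hv
    rw [eq_neg_iff_add_eq_zero, hQ, hQ, ← Finset.sum_add_distrib]
    have hsk : ∀ x y, inner ℝ (D.rho k x) y = - inner ℝ x (D.rho k y) := D.rho_skew k
    -- The terms in which `rho k` hits the first basis index cancel by skewness; `e2` does the same
    -- for the second index.
    have e1 : ∀ j, ∑ i, (inner ℝ (f (D.rho k (b i)) (b j) u) (f (b i) (b j) v)
        + inner ℝ (f (b i) (b j) u) (f (D.rho k (b i)) (b j) v)) = 0 := fun j =>
      sum_skew_eq_zero (LinearMap.mk₂ ℝ (fun x x' => inner ℝ (f x (b j) u) (f x' (b j) v))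
        (by simp [hf, add_lie, inner_add_left]) (by simp [hf, real_inner_smul_left])
        (by simp [hf, add_lie, inner_add_right]) (by simp [hf, real_inner_smul_right])) _ hsk
    have e2 : ∀ i, ∑ j, (inner ℝ (f (b i) (D.rho k (b j)) u) (f (b i) (b j) v)
        + inner ℝ (f (b i) (b j) u) (f (b i) (D.rho k (b j)) v)) = 0 := fun i =>
      sum_skew_eq_zero (LinearMap.mk₂ ℝ (fun x x' => inner ℝ (f (b i) x u) (f (b i) x' v))
        (by simp [hf, add_lie, inner_add_left]) (by simp [hf, real_inner_smul_left])
        (by simp [hf, add_lie, inner_add_right]) (by simp [hf, real_inner_smul_right])) _ hsk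
    have e3 : ∀ i j, inner ℝ (f (b i) (b j) ⁅k, u⁆) (f (b i) (b j) v)
        + inner ℝ (f (b i) (b j) u) (f (b i) (b j) ⁅k, v⁆) =
        - (inner ℝ (f (D.rho k (b i)) (b j) u) (f (b i) (b j) v)
        + inner ℝ (f (b i) (b j) u) (f (D.rho k (b i)) (b j) v))
        - (inner ℝ (f (b i) (D.rho k (b j)) u) (f (b i) (b j) v)
        + inner ℝ (f (b i) (b j) u) (f (b i) (D.rho k (b j)) v)) := fun i j => by
      rw [hfk k hk u hu, hfk k hk v hv]
      simp only [inner_sub_left, inner_sub_right, hsk]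
      ring
    simp only [← Finset.sum_add_distrib, e3, Finset.sum_sub_distrib, Finset.sum_neg_distrib]
    simp only [e2, Finset.sum_const_zero, sub_zero]
    rw [Finset.sum_comm]
    simp only [e1, Finset.sum_const_zero, neg_zero]

end Splitting

end SymmetricTriple

/-! ### Euclidean linear algebra: Leibniz products and a trace argument -/

section

variable {E : Type*} [NormedAddCommGroup E] [InnerProductSpace ℝ E] [FiniteDimensional ℝ E]

/-- A left Leibniz product on a Euclidean space with skew left multiplications and vanishing cyclic
sums is zero. -/
theorem leibniz_product_eq_zero (A : E →ₗ[ℝ] E →ₗ[ℝ] E)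
    (hskew : ∀ x y z, inner ℝ (A x y) z = - inner ℝ y (A x z))
    (hcyc : ∀ x y z, inner ℝ (A x y) z + inner ℝ (A y z) x + inner ℝ (A z x) y = 0)
    (hleib : ∀ x y z, A (A x y) z = A x (A y z) - A y (A x z)) : A = 0 := by
  set K := LinearMap.ker A with hK
  have hAK : ∀ x, ∀ y ∈ K, A x y ∈ K := fun x y hy => by
    rw [hK, LinearMap.mem_ker] at *
    ext1 z
    rw [hleib, hy]; simp
  have hAK' : ∀ x, ∀ y ∈ Kᗮ, A x y ∈ Kᗮ := fun x y hy => by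
    rw [Submodule.mem_orthogonal'] at *
    intro z hz
    rw [hskew, hy _ (hAK x z hz), neg_zero]
  have hbot : ∀ x ∈ K, x ∈ Kᗮ → x = 0 := fun x h1 h2 =>
    inner_self_eq_zero.mp ((Submodule.mem_orthogonal _ _).mp h2 x h1)
  -- The Leibniz rule gives `A (A x x) = [A x, A x] = 0`, so `A x x` lies in `K`, and also in `Kᗮ`,
  -- which is stable under left multiplications.
  have hself : ∀ x ∈ Kᗮ, A x x = 0 := fun x hx => by
    refine hbot _ ?_ (hAK' x x hx)
    rw [hK, LinearMap.mem_ker]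
    ext1 z
    rw [hleib, sub_self]; rfl
  have hanti : ∀ x ∈ Kᗮ, ∀ y ∈ Kᗮ, A x y = - A y x := fun x hx y hy => by
    have := hself (x + y) (add_mem hx hy)
    simp only [map_add, LinearMap.add_apply, hself x hx, hself y hy, zero_add, add_zero] at this
    rw [add_comm] at this
    exact eq_neg_of_add_eq_zero_left this
  -- On `Kᗮ` the trilinear form `⟨A x y, z⟩` is totally antisymmetric, so that its cyclic sum is
  -- three times the form itself.
  have h1 : ∀ x ∈ Kᗮ, ∀ y ∈ Kᗮ, A x y = 0 := fun x hx y hy => by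
    have h3 : ∀ z ∈ Kᗮ, inner ℝ (A x y) z = 0 := fun z hz => by
      have c := hcyc x y z
      have e1 : inner ℝ (A y z) x = inner ℝ (A x y) z := by
        rw [hskew, hanti y hy x hx, inner_neg_right, neg_neg, real_inner_comm]
      have e2 : inner ℝ (A z x) y = inner ℝ (A x y) z := by
        rw [hanti z hz x hx, inner_neg_left, hskew, neg_neg, real_inner_comm]
      rw [e1, e2] at c
      linarith
    exact inner_self_eq_zero.mp (h3 _ (hAK' x y hy))
  -- For `y, z ∈ K` only the term `⟨A x y, z⟩` of the cyclic sum survives.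
  have h2 : ∀ x ∈ Kᗮ, ∀ y ∈ K, A x y = 0 := fun x hx y hy => by
    have h3 : ∀ z ∈ K, inner ℝ (A x y) z = 0 := fun z hz => by
      have c := hcyc x y z
      rw [LinearMap.mem_ker.mp hy, LinearMap.mem_ker.mp hz] at c
      simpa using c
    exact inner_self_eq_zero.mp (h3 _ (hAK x y hy))
  ext x y
  obtain ⟨x₁, hx₁, x₂, hx₂, rfl⟩ := K.exists_add_mem_mem_orthogonal x
  obtain ⟨y₁, hy₁, y₂, hy₂, rfl⟩ := K.exists_add_mem_mem_orthogonal y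
  simp only [map_add, LinearMap.add_apply, LinearMap.mem_ker.mp hx₁, LinearMap.zero_apply,
    h1 x₂ hx₂ y₂ hy₂, h2 x₂ hx₂ y₁ hy₁, add_zero]

/-- For skew `M`, the trace of `M²` is `-∑ ‖M e_i‖²`. -/
theorem eq_zero_of_skew_of_trace (M : Module.End ℝ E)
    (hM : ∀ x y, inner ℝ (M x) y = - inner ℝ x (M y))
    (ht : LinearMap.trace ℝ E (M * M) = 0) : M = 0 := by
  rw [LinearMap.trace_eq_sum_inner (M * M) (stdOrthonormalBasis ℝ E)] at ht
  have h1 : ∀ i, inner ℝ (stdOrthonormalBasis ℝ E i) ((M * M) (stdOrthonormalBasis ℝ E i)) =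
      - inner ℝ (M (stdOrthonormalBasis ℝ E i)) (M (stdOrthonormalBasis ℝ E i)) := fun i => by
    rw [hM, neg_neg]; rfl
  simp only [h1, Finset.sum_neg_distrib, neg_eq_zero] at ht
  rw [Finset.sum_eq_zero_iff_of_nonneg fun i _ => real_inner_self_nonneg] at ht
  refine (stdOrthonormalBasis ℝ E).toBasis.ext fun i => ?_
  simpa using inner_self_eq_zero.mp (ht i (Finset.mem_univ i))

/-- Used with `P, Q, T, R = S 0 0, S 0 1, S 1 0, S 1 1`. As `Y` commutes with the symmetric `P` and
`R`, the products `Y P` and `Y R` are skew. Relations `d00`, `d11` and cyclicity of the trace give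
`tr (Y P)² = -tr (Y P)²`, and likewise for `R`; so both products vanish. Then `d01`, `d10` yield `2
Y² Q = -Y³` and further `Y⁴ = 0`, and a nilpotent skew operator is zero. -/
theorem skew_part_eq_zero (P Q T R Y : Module.End ℝ E)
    (hP : ∀ x y, inner ℝ (P x) y = inner ℝ x (P y)) (hR : ∀ x y, inner ℝ (R x) y = inner ℝ x (R y))
    (hY : ∀ x y, inner ℝ (Y x) y = - inner ℝ x (Y y)) (hYdef : Y = T - Q)
    (cP : Y * P = P * Y) (cQ : Y * Q = Q * Y) (cT : Y * T = T * Y) (cR : Y * R = R * Y)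
    (d00 : T * P - P * Q = - (Y * P)) (d11 : R * T - Q * R = - (Y * R))
    (d01 : R * P - Q * Q = - (Y * Q)) (d10 : T * T - P * R = - (Y * T)) : Y = 0 := by
  have tc : ∀ a b : Module.End ℝ E, LinearMap.trace ℝ E (a * b) = LinearMap.trace ℝ E (b * a) :=
    LinearMap.trace_mul_comm ℝ
  have hYP : Y * P = 0 := by
    refine eq_zero_of_skew_of_trace _ (fun x y => ?_) ?_
    · rw [Module.End.mul_apply, hY, hP, cP]; rfl
    · have e1 : Y * P * (Y * P) = Y * P * P * Q - Y * P * T * P := by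
        linear_combination (norm := noncomm_ring) Y * P * d00
      have e2 : Y * Q * P * P - Y * T * P * P = - (Y * P * (Y * P)) := by
        have : Y * P * (Y * P) = Y * Y * P * P := by
          rw [← mul_assoc, mul_assoc Y P Y, ← cP, ← mul_assoc]
        rw [this]
        nth_rewrite 4 [hYdef]
        noncomm_ring
      have f1 : Q * (Y * P * P) = Y * Q * P * P := by simp only [← mul_assoc, ← cQ]
      have f2 : P * (Y * P * T) = Y * P * P * T := by simp only [← mul_assoc, ← cP]
      have f3 : T * (Y * P * P) = Y * T * P * P := by simp only [← mul_assoc, ← cT]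
      have e3 := congrArg (LinearMap.trace ℝ E) e1
      have e4 := congrArg (LinearMap.trace ℝ E) e2
      simp only [map_sub, map_neg] at e3 e4
      rw [tc _ Q, tc _ P, f1, f2, tc _ T, f3] at e3
      linarith
  have hYR : Y * R = 0 := by
    refine eq_zero_of_skew_of_trace _ (fun x y => ?_) ?_
    · rw [Module.End.mul_apply, hY, hR, cR]; rfl
    · have e1 : Y * R * (Y * R) = Y * R * Q * R - Y * R * R * T := by
        linear_combination (norm := noncomm_ring) Y * R * d11
      have e2 : Y * Q * R * R - Y * T * R * R = - (Y * R * (Y * R)) := by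
        have : Y * R * (Y * R) = Y * Y * R * R := by
          rw [← mul_assoc, mul_assoc Y R Y, ← cR, ← mul_assoc]
        rw [this]
        nth_rewrite 4 [hYdef]
        noncomm_ring
      have f1 : Q * (Y * R * R) = Y * Q * R * R := by simp only [← mul_assoc, ← cQ]
      have f2 : R * (Y * R * Q) = Y * R * R * Q := by simp only [← mul_assoc, ← cR]
      have f3 : T * (Y * R * R) = Y * T * R * R := by simp only [← mul_assoc, ← cT]
      have e3 := congrArg (LinearMap.trace ℝ E) e1
      have e4 := congrArg (LinearMap.trace ℝ E) e2
      simp only [map_sub, map_neg] at e3 e4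
      rw [tc _ R, f2, tc _ Q, f1, tc _ T, f3] at e3
      linarith
  have hT : T = Q + Y := by rw [hYdef]; abel
  have g1 : Y * Q * Q = Y * Y * Q := by
    linear_combination (norm := noncomm_ring) hYR * P - Y * d01
  have g2 : Y * T * T = - (Y * Y * T) := by
    linear_combination (norm := noncomm_ring) hYP * R + Y * d10
  have g3 : (2 : ℝ) • (Y * Y * Q) = - (Y * Y * Y) := by
    have : (2 : ℝ) • ((2 : ℝ) • (Y * Y * Q) + Y * Y * Y) = 0 := by
      have e : Y * Q * Y = Y * Y * Q := by rw [mul_assoc, ← cQ, mul_assoc]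
      rw [hT] at g2
      simp only [two_smul]
      linear_combination (norm := noncomm_ring) g2 - g1 - e
    exact eq_neg_of_add_eq_zero_left ((smul_eq_zero.mp this).resolve_left two_ne_zero)
  -- Two evaluations of `Y² Q²`: as `Y (Y Q²) = Y (Y² Q)` it is `-Y⁴/2`, and as `(Y² Q) Q` it is
  -- `Y⁴/4`.
  have g4 : Y * Y * Y * Y = 0 := by
    have e1 : (2 : ℝ) • (Y * Y * Q * Q) = - (Y * Y * Y * Y) := by
      have : Y * Y * Q * Q = Y * (Y * Y * Q) := by
        linear_combination (norm := noncomm_ring) Y * g1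
      rw [this, ← mul_smul_comm, g3]; noncomm_ring
    have e2 : (4 : ℝ) • (Y * Y * Q * Q) = Y * Y * Y * Y := by
      have h1 : (2 : ℝ) • (Y * Y * Q * Q) = - (Y * (Y * Y * Q)) := by
        rw [← smul_mul_assoc, g3]; noncomm_ring
      have h2 : (4 : ℝ) • (Y * Y * Q * Q) = - (Y * ((2 : ℝ) • (Y * Y * Q))) := by
        rw [mul_smul_comm, ← smul_neg, ← h1, smul_smul]; norm_num
      rw [h2, g3]; noncomm_ring
    have e3 : (3 : ℝ) • (Y * Y * Y * Y) = 0 := by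
      have : (4 : ℝ) • (Y * Y * Q * Q) = - ((2 : ℝ) • (Y * Y * Y * Y)) := by
        rw [← smul_neg, ← e1, smul_smul]; norm_num
      rw [e2] at this
      have h3 : (3 : ℝ) • (Y * Y * Y * Y) = Y * Y * Y * Y + (2 : ℝ) • (Y * Y * Y * Y) := by
        module
      rw [h3]
      exact add_eq_zero_iff_eq_neg.mpr this
    exact (smul_eq_zero.mp e3).resolve_left (by norm_num)
  have g5 : ∀ x, Y (Y x) = 0 := fun x => by
    have : inner ℝ (Y (Y x)) (Y (Y x)) = 0 := by
      rw [hY, hY, neg_neg]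
      have := congrArg (fun f : Module.End ℝ E => f x) g4
      change Y (Y (Y (Y x))) = 0 at this
      rw [this, inner_zero_right]
    exact inner_self_eq_zero.mp this
  ext1 x
  have : inner ℝ (Y x) (Y x) = 0 := by rw [hY, g5, inner_zero_right, neg_zero]
  exact inner_self_eq_zero.mp this

end

/-! ### `W` is abelian, and the operators `S i j` commute -/

namespace SymmetricTriple.Splitting

variable {τ : SymmetricTriple.{u}} {N : ℕ} (D : Splitting τ N)

/-- The product `A x y = rho [ι x, Z*_c] y` on `W` has skew left multiplications. The Jacobi
identity for three elements of `W` makes its cyclic sums vanish, and the Leibniz rule holds because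
`[W, W]` already acts trivially (`rho_lie_ι_ι`). -/
theorem rho_lie_ι_Zd (hind : τ.Indecomposable) (x : EuclideanSpace ℝ (Fin N)) (c : Fin 2) :
    D.rho ⁅D.ι x, D.Zd c⁆ = 0 := by
  let A : EuclideanSpace ℝ (Fin N) →ₗ[ℝ] EuclideanSpace ℝ (Fin N) →ₗ[ℝ] EuclideanSpace ℝ (Fin N) :=
    { toFun := fun x => D.rho ⁅D.ι x, D.Zd c⁆
      map_add' := fun x y => by rw [map_add, add_lie, map_add]
      map_smul' := fun t x => by rw [map_smul, smul_lie, map_smul]; rfl }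
  have hA : ∀ x, A x = D.rho ⁅D.ι x, D.Zd c⁆ := fun x => rfl
  have hh : ∀ x, ⁅D.ι x, D.Zd c⁆ ∈ τ.h := fun x => lie_mem_h (D.ι_mem x) (D.Zd_mem c)
  suffices A = 0 by rw [← hA, this]; rfl
  refine leibniz_product_eq_zero A (fun x y z => D.rho_skew _ y z) (fun x y z => ?_)
    (fun x y z => ?_)
  · have e : ∀ x y z, inner ℝ (A x y) z = - τ.B (D.Zd c) ⁅D.ι x, ⁅D.ι y, D.ι z⁆⁆ := fun x y z => by
      rw [hA, inner_rho, B_lie, τ.B_ad]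
    rw [e, e, e, ← neg_add, ← neg_add, ← map_add, ← map_add, lie_jacobi, map_zero, neg_zero]
  · have e1 : ⁅⁅⁅D.ι x, D.Zd c⁆, D.ι y⁆, D.Zd c⁆ =
        ⁅⁅D.ι x, D.Zd c⁆, ⁅D.ι y, D.Zd c⁆⁆ - ⁅D.ι y, ⁅⁅D.ι x, D.Zd c⁆, D.Zd c⁆⁆ := lie_lie _ _ _
    have e2 : D.rho ⁅D.ι y, ⁅⁅D.ι x, D.Zd c⁆, D.Zd c⁆⁆ = 0 := by
      rw [D.lie_lie_eq' (hh x) (D.Zd_mem c), D.rho_lie_ι_ι hind]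
    have e3 : A (A x y) = D.rho ⁅⁅⁅D.ι x, D.Zd c⁆, D.ι y⁆, D.Zd c⁆ := by
      rw [D.lie_lie_eq (hh x) (D.ι_mem y), hA, hA, rho_apply]
    rw [e3, e1, map_sub, e2, sub_zero, rho_apply, D.pr_bracket_lie (hh x) (hh y) (D.ι_mem z)]
    rfl

/-- The operator `pr ∘ ad Z*_j ∘ ad Z*_i` on `W`. -/
noncomputable def S (i j : Fin 2) : Module.End ℝ (EuclideanSpace ℝ (Fin N)) where
  toFun x := D.pr ⁅⁅D.ι x, D.Zd i⁆, D.Zd j⁆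
  map_add' x y := by simp [add_lie]
  map_smul' c x := by simp

theorem S_apply (i j : Fin 2) (x : EuclideanSpace ℝ (Fin N)) :
    D.S i j x = D.pr ⁅⁅D.ι x, D.Zd i⁆, D.Zd j⁆ := rfl

theorem inner_S (i j : Fin 2) (x y : EuclideanSpace ℝ (Fin N)) :
    inner ℝ (D.S i j x) y = - τ.B ⁅D.ι x, D.Zd i⁆ ⁅D.ι y, D.Zd j⁆ := by
  rw [S_apply, inner_pr, B_lie, ← lie_skew (D.Zd j), map_neg]

theorem inner_S_comm (i j : Fin 2) (x y : EuclideanSpace ℝ (Fin N)) :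
    inner ℝ (D.S i j x) y = inner ℝ x (D.S j i y) := by
  rw [inner_S, real_inner_comm, inner_S, τ.B_symm]

theorem ι_Zd_mem (x : EuclideanSpace ℝ (Fin N)) (i : Fin 2) : ⁅D.ι x, D.Zd i⁆ ∈ τ.h :=
  lie_mem_h (D.ι_mem x) (D.Zd_mem i)

theorem Zd_Zd_mem : ⁅D.Zd 0, D.Zd 1⁆ ∈ τ.h := lie_mem_h (D.Zd_mem 0) (D.Zd_mem 1)

/-- By invariance the component along `v` is `B([ι x, ι y], [Z*_j, ι v])`, which is a matrix entry
of `rho [Z*_j, ι v] = 0`. -/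
theorem pr_lie_ι_ι_Zd (hind : τ.Indecomposable) (x y : EuclideanSpace ℝ (Fin N)) (j : Fin 2) :
    D.pr ⁅⁅D.ι x, D.ι y⁆, D.Zd j⁆ = 0 := by
  refine ext_inner_right ℝ fun v => ?_
  rw [inner_pr, B_lie, τ.B_symm, ← B_lie, ← inner_rho, ← lie_skew, map_neg,
    D.rho_lie_ι_Zd hind]
  simp

theorem rho_Zd_Zd : D.rho ⁅D.Zd 0, D.Zd 1⁆ = D.S 1 0 - D.S 0 1 := by
  ext1 x
  have e : ∀ a b : τ.g, ⁅a, ⁅b, D.ι x⁆⁆ = ⁅⁅D.ι x, b⁆, a⁆ := fun a b => by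
    rw [← lie_skew, ← lie_skew b, neg_lie, neg_neg]
  rw [rho_apply, lie_lie, map_sub, e, e]
  rfl

/-- With `y = [Z*_0, Z*_1]`, the operator `rho y` is `S 1 0 - S 0 1`. Expanding the action of `[y,
[ι x, Z*_i]]` on `Z*_j` in two ways gives both that `rho y` commutes with all `S i j` and, splitting
`y` instead, the quadratic relations required by `skew_part_eq_zero`. -/
theorem rho_lie_Zd_Zd (hind : τ.Indecomposable) : D.rho ⁅D.Zd 0, D.Zd 1⁆ = 0 := by
  set y := ⁅D.Zd 0, D.Zd 1⁆ with hy
  have hyh : y ∈ τ.h := D.Zd_Zd_mem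
  have hcomm : ∀ i j, D.rho y * D.S i j = D.S i j * D.rho y := fun i j => by
    ext1 x
    have e1 := D.pr_bracket_lie hyh (D.ι_Zd_mem x i) (D.Zd_mem j)
    rw [D.rho_lie_ι_Zd hind, LinearMap.zero_apply, sub_zero] at e1
    have e2 : ⁅y, ⁅D.ι x, D.Zd i⁆⁆ = ⁅D.ι (D.rho y x), D.Zd i⁆ + ⁅D.ι x, D.ι (D.pr ⁅y, D.Zd i⁆)⁆ := by
      rw [leibniz_lie, D.lie_lie_eq hyh (D.ι_mem x), D.lie_lie_eq' hyh (D.Zd_mem i), rho_apply]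
    rw [e2, add_lie, map_add, D.pr_lie_ι_ι_Zd hind, add_zero] at e1
    exact e1.symm
  have hd : ∀ c d, D.S 1 c * D.S d 0 - D.S 0 c * D.S d 1 = - (D.rho y * D.S d c) := fun c d => by
    ext1 x
    have e1 := D.pr_bracket_lie (D.ι_Zd_mem x d) hyh (D.Zd_mem c)
    rw [D.rho_lie_ι_Zd hind, LinearMap.zero_apply, zero_sub] at e1
    have e2 : ⁅⁅D.ι x, D.Zd d⁆, y⁆ = ⁅D.ι (D.S d 0 x), D.Zd 1⁆ - ⁅D.ι (D.S d 1 x), D.Zd 0⁆ := by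
      rw [hy, leibniz_lie, D.lie_lie_eq (D.ι_Zd_mem x d) (D.Zd_mem 0),
        D.lie_lie_eq' (D.ι_Zd_mem x d) (D.Zd_mem 1), ← lie_skew (D.Zd 0), ← sub_eq_add_neg]
      rfl
    rw [e2, sub_lie, map_sub] at e1
    exact e1
  exact skew_part_eq_zero (D.S 0 0) (D.S 0 1) (D.S 1 0) (D.S 1 1) (D.rho y) (D.inner_S_comm 0 0)
    (D.inner_S_comm 1 1) (D.rho_skew y) D.rho_Zd_Zd (hcomm _ _) (hcomm _ _) (hcomm _ _) (hcomm _ _)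
    (hd 0 0) (hd 1 1) (hd 1 0) (hd 0 1)

theorem B_lie_eq_zero {k : τ.g} (h0 : τ.B k ⁅D.Zd 0, D.Zd 1⁆ = 0)
    (h1 : ∀ x i, τ.B k ⁅D.ι x, D.Zd i⁆ = 0) (h2 : ∀ x y, τ.B k ⁅D.ι x, D.ι y⁆ = 0) :
    ∀ u ∈ τ.m, ∀ v ∈ τ.m, τ.B k ⁅u, v⁆ = 0 := by
  intro u hu v hv
  obtain ⟨p, q, e, rfl⟩ := D.exists_coord u hu
  obtain ⟨p', q', e', rfl⟩ := D.exists_coord v hv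
  have h1' : ∀ x i, τ.B k ⁅D.Zd i, D.ι x⁆ = 0 := fun x i => by
    rw [← lie_skew, map_neg, h1, neg_zero]
  have h0' : τ.B k ⁅D.Zd 1, D.Zd 0⁆ = 0 := by rw [← lie_skew, map_neg, h0, neg_zero]
  simp [D.lie_Z, D.Z_lie, h0, h0', h1, h1', h2]

/-- `B([ι x, ι y], k) = ⟨rho k x, y⟩`, and `rho` vanishes on all three kinds of generators of `𝔥`.
-/
theorem lie_ι_ι (hind : τ.Indecomposable) (x y : EuclideanSpace ℝ (Fin N)) :
    ⁅D.ι x, D.ι y⁆ = 0 := by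
  have key : ∀ k, D.rho k = 0 → τ.B ⁅D.ι x, D.ι y⁆ k = 0 := fun k hk => by
    rw [τ.B_symm, ← B_lie, ← inner_rho, hk]; simp
  exact eq_zero_of_h (lie_mem_h (D.ι_mem x) (D.ι_mem y)) (D.B_lie_eq_zero
    (key _ (D.rho_lie_Zd_Zd hind)) (fun x i => key _ (D.rho_lie_ι_Zd hind x i))
    (fun x y => key _ (D.rho_lie_ι_ι hind x y)))

theorem eq_zero_of_B (hind : τ.Indecomposable) {k : τ.g} (hk : k ∈ τ.h)
    (h0 : τ.B k ⁅D.Zd 0, D.Zd 1⁆ = 0) (h1 : ∀ x i, τ.B k ⁅D.ι x, D.Zd i⁆ = 0) : k = 0 :=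
  eq_zero_of_h hk (D.B_lie_eq_zero h0 h1 fun x y => by rw [D.lie_ι_ι hind, map_zero])

theorem rho_eq_zero (hind : τ.Indecomposable) (k : τ.g) : D.rho k = 0 := by
  ext1 x
  refine ext_inner_right ℝ fun y => ?_
  rw [inner_rho, B_lie, D.lie_ι_ι hind]; simp

/-- The compatibility of the operators `S` with the bracket that comes from `[𝔥, 𝔥] = 0`. -/
theorem lie_ι_S (hind : τ.Indecomposable) (d : Fin 2) (x : EuclideanSpace ℝ (Fin N)) :
    ⁅D.ι (D.S d 0 x), D.Zd 1⁆ = ⁅D.ι (D.S d 1 x), D.Zd 0⁆ := by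
  have hyh := D.Zd_Zd_mem
  have e1 : ⁅⁅D.Zd 0, D.Zd 1⁆, ⁅D.ι x, D.Zd d⁆⁆ = 0 := by
    rw [leibniz_lie, D.lie_lie_eq hyh (D.ι_mem x), D.lie_lie_eq' hyh (D.Zd_mem d), ← rho_apply,
      D.rho_eq_zero hind, D.lie_ι_ι hind]
    simp
  have e2 : ⁅⁅D.ι x, D.Zd d⁆, ⁅D.Zd 0, D.Zd 1⁆⁆ = ⁅D.ι (D.S d 0 x), D.Zd 1⁆ - ⁅D.ι (D.S d 1 x), D.Zd 0⁆ := by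
    rw [leibniz_lie, D.lie_lie_eq (D.ι_Zd_mem x d) (D.Zd_mem 0),
      D.lie_lie_eq' (D.ι_Zd_mem x d) (D.Zd_mem 1), ← lie_skew (D.Zd 0), ← sub_eq_add_neg]
    rfl
  rw [← lie_skew, e1, neg_zero] at e2
  exact sub_eq_zero.mp e2.symm

theorem S_comm (hind : τ.Indecomposable) : D.S 1 0 = D.S 0 1 := by
  rw [← sub_eq_zero, ← D.rho_Zd_Zd, D.rho_lie_Zd_Zd hind]

/-- Together with `S_comm` this says that the `S i j` commute and that each joint eigenvalue matrix
is singular, that is, of rank at most one. -/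
theorem S_mul (hind : τ.Indecomposable) (c d : Fin 2) :
    D.S 1 c * D.S d 0 = D.S 0 c * D.S d 1 := by
  ext1 x
  exact congrArg (fun k => D.pr ⁅k, D.Zd c⁆) (D.lie_ι_S hind d x)

end SymmetricTriple.Splitting

/-! ### From an adapted decomposition to a splitting -/

theorem exists_isometry {V : Type u} [AddCommGroup V] [Module ℝ V] [Module.Finite ℝ V]
    (B : LinearMap.BilinForm ℝ V) (hs : ∀ x y, B x y = B y x) (hp : ∀ x, x ≠ 0 → 0 < B x x)
    {N : ℕ} (hN : Module.finrank ℝ V = N) :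
    ∃ φ : EuclideanSpace ℝ (Fin N) ≃ₗ[ℝ] V, ∀ x y, B (φ x) (φ y) = inner ℝ x y := by
  let c : InnerProductSpace.Core ℝ V :=
    { inner := fun x y => B x y
      conj_inner_symm := fun x y => by simpa using hs y x
      re_inner_nonneg := fun x => by
        rcases eq_or_ne x 0 with rfl | h
        · simp
        · simpa using (hp x h).le
      add_left := fun x y z => by simp
      smul_left := fun x y r => by simp
      definite := fun x hx => by
        by_contra h
        exact (hp x h).ne' hx }
  let _ : NormedAddCommGroup V := c.toNormedAddCommGroup
  let _ : InnerProductSpace ℝ V := InnerProductSpace.ofCore c.toCore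
  let e := (stdOrthonormalBasis ℝ V).reindex (finCongr hN)
  refine ⟨e.repr.symm.toLinearEquiv, fun x y => ?_⟩
  have := e.repr.symm.inner_map_map x y
  exact this

namespace SymmetricTriple

theorem finrank_m_of_signature {τ : SymmetricTriple.{u}} {p q : ℕ} (H : τ.HasSignature p q) :
    Module.finrank ℝ τ.m = q + p := by
  have hsum := QuadraticForm.sigPos_add_sigNeg_add_radical (Q := (τ.B.restrict τ.m).toQuadraticMap)
  rw [H.1, H.2] at hsum
  have hrad : (τ.B.restrict τ.m).toQuadraticMap.radical = ⊥ := by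
    rw [eq_bot_iff]
    rintro ⟨x, hx⟩ ⟨-, h⟩
    rw [Submodule.mem_bot, ← Subtype.coe_inj]
    refine eq_zero_of_m hx fun u hu => ?_
    have h1 := LinearMap.congr_fun h ⟨u, hu⟩
    have h2 : τ.B x u + τ.B u x = 0 := by
      have : τ.B (x + u) (x + u) - τ.B x x - τ.B u u = 0 := h1
      simp only [map_add, LinearMap.add_apply] at this
      linarith
    rw [τ.B_symm u x] at h2
    linarith
  rw [hrad, finrank_bot, add_zero] at hsum
  exact hsum.symm

namespace IsAdaptedDecomposition

variable {τ : SymmetricTriple.{u}} {W Zd : Submodule ℝ τ.g} (H : τ.IsAdaptedDecomposition W Zd)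
include H

theorem z_le : τ.z ≤ τ.m := H.sup_Zd ▸ le_sup_left.trans le_sup_left

theorem W_le : W ≤ τ.m := H.sup_Zd ▸ le_sup_right.trans le_sup_left

theorem Zd_le : Zd ≤ τ.m := H.sup_Zd ▸ le_sup_right

theorem exists_add {x : τ.g} (hx : x ∈ τ.m) : ∃ a ∈ τ.z, ∃ b ∈ W, ∃ c ∈ Zd, x = a + b + c := by
  rw [← H.sup_Zd] at hx
  obtain ⟨y, hy, c, hc, rfl⟩ := Submodule.mem_sup.mp hx
  obtain ⟨a, ha, b, hb, rfl⟩ := Submodule.mem_sup.mp hy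
  exact ⟨a, ha, b, hb, c, hc, rfl⟩

theorem eq_zero_of_Zd {a : τ.g} (ha : a ∈ Zd) (h : ∀ x ∈ τ.z, τ.B x a = 0) : a = 0 := by
  refine eq_zero_of_m (H.Zd_le ha) fun u hu => ?_
  obtain ⟨x, hx, b, hb, c, hc, rfl⟩ := H.exists_add hu
  rw [map_add, map_add, τ.B_symm, h x hx, H.orthogonal a (Submodule.mem_sup_right ha) b hb,
    H.Zd_isotropic a ha c hc]
  simp

theorem eq_zero_of_z {a : τ.g} (ha : a ∈ τ.z) (h : ∀ x ∈ Zd, τ.B a x = 0) : a = 0 := by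
  refine eq_zero_of_m (H.z_le ha) fun u hu => ?_
  obtain ⟨x, hx, b, hb, c, hc, rfl⟩ := H.exists_add hu
  rw [map_add, map_add, h c hc, H.orthogonal a (Submodule.mem_sup_left ha) b hb,
    H.z_isotropic a ha x hx]
  simp

theorem finrank_Zd : Module.finrank ℝ Zd = Module.finrank ℝ τ.z := by
  have key : ∀ V V' : Submodule ℝ τ.g, (∀ a ∈ V, (∀ x ∈ V', τ.B a x = 0) → a = 0) →
      Module.finrank ℝ V ≤ Module.finrank ℝ V' := by
    intro V V' h
    rw [← Subspace.dual_finrank_eq (V := V')]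
    let f : V →ₗ[ℝ] Module.Dual ℝ V' := (τ.B.domRestrict₁₂ V V')
    refine LinearMap.finrank_le_finrank_of_injective (f := f) ?_
    rw [injective_iff_map_eq_zero]
    rintro ⟨a, ha⟩ h0
    exact Subtype.ext (h a ha fun x hx => LinearMap.congr_fun h0 ⟨x, hx⟩)
  refine le_antisymm (key _ _ fun a ha h => H.eq_zero_of_Zd ha fun x hx => ?_)
    (key _ _ fun a ha h => H.eq_zero_of_z ha h)
  rw [τ.B_symm, h x hx]

theorem finrank_W : Module.finrank ℝ W + 2 * Module.finrank ℝ τ.z = Module.finrank ℝ τ.m := by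
  have h1 := Submodule.finrank_sup_add_finrank_inf_eq (τ.z ⊔ W) Zd
  have h2 := Submodule.finrank_sup_add_finrank_inf_eq τ.z W
  rw [disjoint_iff.mp H.disjoint_Zd, finrank_bot, H.sup_Zd, H.finrank_Zd] at h1
  rw [disjoint_iff.mp H.disjoint_z_W, finrank_bot] at h2
  omega

/-- If `B(w, w) ≤ 0`, then `𝔷 ⊕ ℝw` is a three-dimensional subspace on which `B ≤ 0`, which leaves
at most `dim 𝔪 - 3` positive directions. -/
theorem posDef (hsig : τ.HasSignature 2 (Module.finrank ℝ τ.m - 2))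
    (hm : 2 ≤ Module.finrank ℝ τ.m)
    (hz : Module.finrank ℝ τ.z = 2) {w : τ.g} (hw : w ∈ W) (hw0 : w ≠ 0) : 0 < τ.B w w := by
  by_contra! hneg
  have hV : τ.z ⊔ Submodule.span ℝ {w} ≤ τ.m :=
    sup_le H.z_le ((Submodule.span_singleton_le_iff_mem _ _).mpr (H.W_le hw))
  have hfin : Module.finrank ℝ ↥(τ.z ⊔ Submodule.span ℝ {w}) = 3 := by
    have h2 := Submodule.finrank_sup_add_finrank_inf_eq τ.z (Submodule.span ℝ {w})
    have hd : Disjoint τ.z (Submodule.span ℝ {w}) :=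
      H.disjoint_z_W.mono_right ((Submodule.span_singleton_le_iff_mem _ _).mpr hw)
    rw [disjoint_iff.mp hd, finrank_bot, hz, finrank_span_singleton hw0] at h2
    omega
  have h3 := QuadraticForm.sigPos_add_finrank_le_of_nonpos
    (Q := (τ.B.restrict τ.m).toQuadraticMap)
    (V := (τ.z ⊔ Submodule.span ℝ {w}).comap τ.m.subtype) (by
      rintro ⟨x, hx⟩ hxV
      obtain ⟨a, ha, b, hb, rfl⟩ := Submodule.mem_sup.mp (show x ∈ τ.z ⊔ Submodule.span ℝ {w} from hxV)
      obtain ⟨c, rfl⟩ := Submodule.mem_span_singleton.mp hb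
      have e : τ.B (a + c • w) (a + c • w) = c * c * τ.B w w := by
        have h4 := H.orthogonal a (Submodule.mem_sup_left ha) w hw
        simp only [map_add, LinearMap.add_apply, map_smul, LinearMap.smul_apply, smul_eq_mul,
          H.z_isotropic a ha a ha, h4, τ.B_symm w a]
        ring
      show τ.B (a + c • w) (a + c • w) ≤ 0
      rw [e]
      exact mul_nonpos_of_nonneg_of_nonpos (mul_self_nonneg c) hneg)
  rw [(Submodule.comapSubtypeEquivOfLe hV).finrank_eq, hfin, hsig.2] at h3
  omega

theorem exists_splitting {n : ℕ} (hn : 4 ≤ n) (hsig : τ.HasSignature 2 (n - 2))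
    (hz : Module.finrank ℝ τ.z = 2) :
    ∃ D : Splitting τ (n - 4), (∀ i, D.Zd i ∈ Zd) ∧ (∀ x, D.ι x ∈ W) ∧
      (∀ a ∈ Zd, ∃ p : Fin 2 → ℝ, a = ∑ i, p i • D.Zd i) ∧ (∀ w ∈ W, ∃ x, w = D.ι x) := by
  have hm : Module.finrank ℝ τ.m = n := by
    rw [finrank_m_of_signature hsig]; omega
  have hW : Module.finrank ℝ W = n - 4 := by
    have := H.finrank_W
    omega
  obtain ⟨φ, hφ⟩ := exists_isometry (τ.B.restrict W) (fun x y => τ.B_symm x y)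
    (fun x hx => H.posDef (by rwa [hm]) (by omega) hz x.2 (by simpa using hx)) hW
  let b := Module.finBasisOfFinrankEq ℝ τ.z hz
  have hzs : ∀ x (hx : x ∈ τ.z), x = ∑ i, b.repr ⟨x, hx⟩ i • (b i : τ.g) := fun x hx => by
    have := congrArg Subtype.val (b.sum_repr ⟨x, hx⟩)
    simpa only [Submodule.coe_sum, Submodule.coe_smul] using this.symm
  -- Pairing with a basis of `𝔷` identifies `𝔷*` with `ℝ²`; the preimages of the unit vectors form
  -- the dual basis.
  let f : Zd →ₗ[ℝ] (Fin 2 → ℝ) := LinearMap.pi fun i => (τ.B (b i)).domRestrict Zd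
  have hfin : Function.Injective f := by
    rw [injective_iff_map_eq_zero]
    rintro ⟨a, ha⟩ h0
    refine Subtype.ext (H.eq_zero_of_Zd ha fun x hx => ?_)
    rw [hzs x hx, map_sum, LinearMap.sum_apply]
    refine Finset.sum_eq_zero fun i _ => ?_
    have : τ.B (b i) a = 0 := congrFun h0 i
    simp [this]
  have hbij : Function.Bijective f :=
    ⟨hfin, (LinearMap.injective_iff_surjective_of_finrank_eq_finrank
      (by rw [H.finrank_Zd, hz]; simp)).mp hfin⟩
  let F : Zd ≃ₗ[ℝ] (Fin 2 → ℝ) := LinearEquiv.ofBijective f hbij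
  have hF : ∀ (i : Fin 2) (a : Zd), τ.B (b i) a = F a i := fun i a => rfl
  have hsum : ∀ a (ha : a ∈ Zd), a = ∑ i, F ⟨a, ha⟩ i • (F.symm (Pi.single i 1) : τ.g) := by
    intro a ha
    have : (⟨a, ha⟩ : Zd) = ∑ i, F ⟨a, ha⟩ i • F.symm (Pi.single i 1) := by
      apply F.injective
      rw [map_sum]
      ext j
      fin_cases j <;> simp
    simpa using congrArg Subtype.val this
  have hWφ : ∀ w (hw : w ∈ W), w = φ (φ.symm ⟨w, hw⟩) := fun w hw => by simp
  refine ⟨{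
    ι := W.subtype ∘ₗ φ.toLinearMap
    Z := fun i => b i
    Zd := fun i => F.symm (Pi.single i 1)
    ι_mem := fun x => H.W_le (φ x).2
    Z_mem := fun i => H.z_le (b i).2
    Zd_mem := fun i => H.Zd_le (F.symm _).2
    lie_Z := fun i x => mem_z.mp (b i).2 x
    B_Z_Z := fun i j => H.z_isotropic _ (b i).2 _ (b j).2
    B_Zd_Zd := fun i j => H.Zd_isotropic _ (F.symm _).2 _ (F.symm _).2
    B_Z_Zd := fun i j => by
      rw [hF, F.apply_symm_apply, Pi.single_apply]
    B_Z_ι := fun i x => H.orthogonal _ (Submodule.mem_sup_left (b i).2) _ (φ x).2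
    B_Zd_ι := fun i x => H.orthogonal _ (Submodule.mem_sup_right (F.symm _).2) _ (φ x).2
    B_ι_ι := hφ
    exists_coord := fun x hx => ?_
    center_le := fun x hx => ⟨_, hzs x hx⟩ }, fun i => (F.symm _).2, fun x => (φ x).2,
    fun a ha => ⟨_, hsum a ha⟩, fun w hw => ⟨_, hWφ w hw⟩⟩
  obtain ⟨a, ha, w, hw, c, hc, rfl⟩ := H.exists_add hx
  refine ⟨fun i => b.repr ⟨a, ha⟩ i, fun i => F ⟨c, hc⟩ i, φ.symm ⟨w, hw⟩, ?_⟩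
  rw [← hzs a ha, ← hsum c hc]
  simp

end IsAdaptedDecomposition

/-- Modulo `𝔷 ⊕ 𝔷*` the operator `ad Z*_j ∘ ad Z*_i` is `S i j`. By bilinearity `W_nil` is thus the
common kernel of the four `S i j`, and `w` is a unit vector spanning it. -/
theorem IsTypeIIa.exists_splitting {τ : SymmetricTriple.{u}} {n : ℕ} (hn : 4 ≤ n)
    (H : τ.IsTypeIIa n) :
    ∃ (D : Splitting τ (n - 4)) (w : EuclideanSpace ℝ (Fin (n - 4))), ‖w‖ = 1 ∧
      ∀ x, (∀ i j, D.S i j x = 0) ↔ ∃ c : ℝ, x = c • w := by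
  obtain ⟨W, Zd, hA, hnil⟩ := H.finrank_Wnil
  obtain ⟨D, hZd, hW, hZd', hW'⟩ := hA.exists_splitting hn H.signature H.finrank_center
  have hpr : ∀ a ∈ τ.z ⊔ Zd, D.pr a = 0 := fun a ha =>
    ext_inner_right ℝ fun x => by
      rw [D.inner_pr, hA.orthogonal a ha _ (hW x), inner_zero_left]
  have hmem : ∀ i j x, ⁅D.Zd j, ⁅D.Zd i, D.ι x⁆⁆ ∈ τ.z ⊔ Zd ↔ D.S i j x = 0 := by
    intro i j x
    have e : ⁅D.Zd j, ⁅D.Zd i, D.ι x⁆⁆ = ⁅⁅D.ι x, D.Zd i⁆, D.Zd j⁆ := by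
      rw [← lie_skew, ← lie_skew (D.Zd i), neg_lie, neg_neg]
    rw [e, D.S_apply]
    refine ⟨hpr _, fun h => ?_⟩
    rw [D.lie_eq (D.ι_Zd_mem x i) (D.Zd_mem j), h, map_zero, zero_add]
    exact Submodule.sum_mem _ fun k _ => Submodule.smul_mem _ _
      (Submodule.mem_sup_left (mem_z.mpr fun y => D.lie_Z k y))
  have hιinj : ∀ x, D.ι x = 0 → x = 0 := fun x hx => by rw [← D.pr_ι x, hx, map_zero]
  have hker : ∀ x, D.ι x ∈ τ.Wnil W Zd ↔ ∀ i j, D.S i j x = 0 := by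
    intro x
    constructor
    · rintro ⟨-, h⟩ i j
      exact (hmem i j x).mp (h _ (hZd j) _ (hZd i))
    · intro h
      refine ⟨hW x, fun a ha b hb => ?_⟩
      obtain ⟨p, rfl⟩ := hZd' a ha
      obtain ⟨q, rfl⟩ := hZd' b hb
      simp only [sum_lie, lie_sum, smul_lie, lie_smul]
      exact Submodule.sum_mem _ fun i _ => Submodule.smul_mem _ _ <|
        Submodule.sum_mem _ fun j _ => Submodule.smul_mem _ _ ((hmem _ _ x).mpr (h _ _))
  obtain ⟨⟨v, hv⟩, hv0, hspan⟩ := finrank_eq_one_iff'.mp hnil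
  obtain ⟨x, rfl⟩ := hW' v hv.1
  have hx0 : x ≠ 0 := fun h => hv0 (Subtype.ext (by simp [h]))
  have hx1 : ‖x‖ ≠ 0 := by simpa using hx0
  refine ⟨D, ‖x‖⁻¹ • x, ?_, fun y => ?_⟩
  · rw [norm_smul, norm_inv, norm_norm, inv_mul_cancel₀ hx1]
  · rw [← hker]
    constructor
    · intro h
      obtain ⟨c, hc⟩ := hspan ⟨_, h⟩
      have h2 : c • D.ι x = D.ι y := congrArg Subtype.val hc
      refine ⟨c * ‖x‖, ?_⟩
      rw [smul_smul, mul_assoc, mul_inv_cancel₀ hx1, mul_one, ← sub_eq_zero]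
      exact hιinj _ (by rw [map_sub, map_smul, h2, sub_self])
    · rintro ⟨c, rfl⟩
      rw [map_smul, map_smul]
      exact Submodule.smul_mem _ _ (Submodule.smul_mem _ _ hv)

end SymmetricTriple

/-! ### Simultaneous diagonalisation of the operators `S i j` -/

theorem exists_joint_eigenbasis {N : ℕ} {n : Type*} {T : n → Module.End ℝ (EuclideanSpace ℝ (Fin N))}
    (hT : ∀ i x y, inner ℝ (T i x) y = inner ℝ x (T i y)) (hC : ∀ i j, T i * T j = T j * T i) :
    ∃ (f : OrthonormalBasis (Fin N) ℝ (EuclideanSpace ℝ (Fin N))) (χ : Fin N → n → ℝ),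
      ∀ a j, T j (f a) = χ a j • f a := by
  classical
  have hT' : ∀ i, (T i).IsSymmetric := fun i x y => hT i x y
  have hI := LinearMap.IsSymmetric.directSum_isInternal_of_pairwise_commute hT'
    (fun i j _ => hC i j)
  have hO := LinearMap.IsSymmetric.orthogonalFamily_iInf_eigenspaces hT'
  have hfin := WellFoundedGT.finite_ne_bot_of_iSupIndep hI.submodule_iSupIndep
  have hI' := DirectSum.isInternal_ne_bot_iff.mpr hI
  let _ := hfin.fintype
  let _ : Fintype {χ : n → ℝ // (⨅ j, Module.End.eigenspace (T j) (χ j)) ≠ ⊥} := hfin.fintype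
  have hO' := hO.comp (f := fun χ : {χ : n → ℝ // (⨅ j, Module.End.eigenspace (T j) (χ j)) ≠ ⊥} => χ.1)
    Subtype.val_injective
  have hn : Module.finrank ℝ (EuclideanSpace ℝ (Fin N)) = N := by simp
  refine ⟨hI'.subordinateOrthonormalBasis hn hO',
    fun a => (hI'.subordinateOrthonormalBasisIndex hn a hO').1, fun a j => ?_⟩
  have h := hI'.subordinateOrthonormalBasis_subordinate hn a hO'
  exact Module.End.mem_eigenspace_iff.mp ((Submodule.mem_iInf _).mp h j)

/-- A singular symmetric `2 × 2` matrix is plus or minus the square of a vector; the sign convention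
is that of the eigenvalues `-ε λ_i λ_j`. -/
theorem exists_rank_one_form (a b c : ℝ) (h : a * c = b * b) :
    ∃ e s t : ℝ, (e = -1 ∨ e = 1) ∧ a = -(e * s * s) ∧ b = -(e * s * t) ∧ c = -(e * t * t) := by
  have key : ∀ a b c : ℝ, a * c = b * b → 0 ≤ a → 0 ≤ c →
      ∃ s t : ℝ, a = s * s ∧ b = s * t ∧ c = t * t := by
    intro a b c h ha hc
    have hb : b * b = (√a * √c) * (√a * √c) := by
      rw [mul_mul_mul_comm, Real.mul_self_sqrt ha, Real.mul_self_sqrt hc, h]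
    rcases mul_self_eq_mul_self_iff.mp hb with h1 | h1
    · exact ⟨√a, √c, (Real.mul_self_sqrt ha).symm, h1, (Real.mul_self_sqrt hc).symm⟩
    · exact ⟨√a, -√c, (Real.mul_self_sqrt ha).symm, by rw [h1]; ring,
        by rw [neg_mul_neg, Real.mul_self_sqrt hc]⟩
  by_cases hs : 0 ≤ a ∧ 0 ≤ c
  · obtain ⟨s, t, h1, h2, h3⟩ := key a b c h hs.1 hs.2
    exact ⟨-1, s, t, Or.inl rfl, by linarith, by linarith, by linarith⟩
  · have hs' : 0 ≤ -a ∧ 0 ≤ -c := by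
      have h0 : 0 ≤ a * c := h ▸ mul_self_nonneg b
      rcases mul_nonneg_iff.mp h0 with h1 | h1
      · exact absurd h1 hs
      · exact ⟨by linarith [h1.1], by linarith [h1.2]⟩
    obtain ⟨s, t, h1, h2, h3⟩ := key (-a) (-b) (-c) (by linarith) hs'.1 hs'.2
    exact ⟨1, s, t, Or.inr rfl, by linarith, by linarith, by linarith⟩

/-- Serves to list the eigenvectors with sign `-1` first; `r` is their number. -/
theorem exists_equiv_sorted {J : Type*} [Fintype J] {s : ℕ} (hJ : Fintype.card J = s) (p : J → Prop) :
    ∃ (r : Fin (s + 1)) (e : Fin s ≃ J), ∀ α : Fin s, (α : ℕ) < (r : ℕ) ↔ p (e α) := by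
  classical
  have hr : Fintype.card {j // p j} ≤ s := hJ ▸ Fintype.card_subtype_le p
  let e₀ : Fin s ≃ J := (Fintype.equivFinOfCardEq hJ).symm
  let r : Fin (s + 1) := ⟨Fintype.card {j // p j}, Nat.lt_succ_of_le hr⟩
  have hcard : Fintype.card {α : Fin s // (α : ℕ) < (r : ℕ)} = Fintype.card {α // p (e₀ α)} := by
    rw [Fintype.card_congr (e₀.subtypeEquiv fun α => Iff.rfl : {α // p (e₀ α)} ≃ {j // p j}),
      Fintype.card_subtype, Fin.card_filter_val_lt, min_eq_right hr]
  let e₁ := Fintype.equivOfCardEq hcard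
  refine ⟨r, e₁.extendSubtype.trans e₀, fun α => ⟨fun h => e₁.extendSubtype_mem α h, fun h => ?_⟩⟩
  by_contra h'
  exact e₁.extendSubtype_not_mem α h' h

theorem TauSpace.eps_ne_zero {s r : ℕ} (α : Fin s) : TauSpace.eps r α ≠ 0 := by
  unfold TauSpace.eps; split_ifs <;> norm_num

namespace SymmetricTriple

namespace Splitting

variable {τ : SymmetricTriple.{u}} {N s : ℕ}

/-- The orthonormal basis `f` diagonalises all operators `S i j`, with eigenvalues `-ε λ_i λ_j`. -/
structure IsDiag (D : Splitting τ N) (r : ℕ) (lam : Fin 2 → Fin s → ℝ)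
    (f : OrthonormalBasis (Option (Fin s)) ℝ (EuclideanSpace ℝ (Fin N))) : Prop where
  admissible : TauSpace.Admissible lam
  S_some : ∀ i j α, D.S i j (f (some α)) = (-(TauSpace.eps r α * lam i α * lam j α)) • f (some α)
  S_none : ∀ i j, D.S i j (f none) = 0

theorem exists_isDiag (hind : τ.Indecomposable) (D : Splitting τ (s + 1))
    {w : EuclideanSpace ℝ (Fin (s + 1))} (hw : ‖w‖ = 1)
    (hD : ∀ x, (∀ i j, D.S i j x = 0) ↔ ∃ c : ℝ, x = c • w) :
    ∃ (r : Fin (s + 1)) (lam : Fin 2 → Fin s → ℝ)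
      (f : OrthonormalBasis (Option (Fin s)) ℝ (EuclideanSpace ℝ (Fin (s + 1)))),
      D.IsDiag (r : ℕ) lam f := by
  classical
  have h10 := D.S_comm hind
  have hab := D.S_mul hind 0 0
  have hac := D.S_mul hind 1 0
  have hac' := D.S_mul hind 0 1
  have hbc := D.S_mul hind 1 1
  rw [h10] at hab hac' hbc
  -- As `S 1 0 = S 0 1`, three symmetric operators carry all the information.
  obtain ⟨f, χ, hf⟩ := exists_joint_eigenbasis (T := ![D.S 0 0, D.S 0 1, D.S 1 1])
    (fun i x y => by
      fin_cases i
      · exact D.inner_S_comm 0 0 x y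
      · exact (D.inner_S_comm 0 1 x y).trans (by rw [h10]; rfl)
      · exact D.inner_S_comm 1 1 x y)
    (fun i j => by
      fin_cases i <;> fin_cases j
      · rfl
      · exact hab.symm
      · exact hac'.symm.trans hac.symm
      · exact hab
      · rfl
      · exact hbc.symm
      · exact hac.trans hac'
      · exact hbc
      · rfl)
  have f0 : ∀ a, D.S 0 0 (f a) = χ a 0 • f a := fun a => hf a 0
  have f1 : ∀ a, D.S 0 1 (f a) = χ a 1 • f a := fun a => hf a 1
  have f2 : ∀ a, D.S 1 1 (f a) = χ a 2 • f a := fun a => hf a 2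
  have hne : ∀ a, f a ≠ 0 := fun a => f.orthonormal.ne_zero a
  have hχ : ∀ a, χ a 0 * χ a 2 = χ a 1 * χ a 1 := fun a => by
    have h1 := LinearMap.congr_fun hac (f a)
    rw [Module.End.mul_apply, Module.End.mul_apply, f0, f1, map_smul, map_smul, f1, f2, smul_smul,
      smul_smul] at h1
    exact smul_left_injective ℝ (hne a) h1
  choose e p q he h0 h1 h2 using fun a => exists_rank_one_form _ _ _ (hχ a)
  let lam' : Fin 2 → Fin (s + 1) → ℝ := ![p, q]
  have hS : ∀ i j a, D.S i j (f a) = (-(e a * lam' i a * lam' j a)) • f a := by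
    intro i j a
    fin_cases i <;> fin_cases j
    · exact (f0 a).trans (by rw [h0 a]; rfl)
    · exact (f1 a).trans (by rw [h1 a]; rfl)
    · refine (congrFun (congrArg DFunLike.coe h10) (f a)).trans ((f1 a).trans ?_)
      rw [h1 a, mul_right_comm]; rfl
    · exact (f2 a).trans (by rw [h2 a]; rfl)
  have hnil : ∀ a, (∃ c : ℝ, f a = c • w) ↔ lam' 0 a = 0 ∧ lam' 1 a = 0 := by
    intro a
    rw [← hD]
    constructor
    · intro h
      have key : ∀ i, lam' i a = 0 := fun i => by
        have := h i i
        rw [hS, smul_eq_zero] at this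
        rcases this with h' | h'
        · rcases he a with h'' | h'' <;> rw [h''] at h' <;> nlinarith [mul_self_nonneg (lam' i a)]
        · exact absurd h' (hne a)
      exact ⟨key 0, key 1⟩
    · intro h i j
      have : ∀ i, lam' i a = 0 := fun i => by fin_cases i; exacts [h.1, h.2]
      rw [hS, this, mul_zero, zero_mul, neg_zero, zero_smul]
  -- Some basis vector is a multiple of `w`. Otherwise each `f a` has `λ ≠ 0`, and `S i i w = 0`
  -- makes `w` orthogonal to all of them.
  obtain ⟨k₀, hk₀⟩ : ∃ k, ∃ c : ℝ, f k = c • w := by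
    by_contra! hcon
    have hw0 : w = 0 := by
      rw [← f.sum_repr' w]
      refine Finset.sum_eq_zero fun a _ => smul_eq_zero_of_left ?_ _
      have hSw := (hD w).mpr ⟨1, (one_smul ℝ w).symm⟩
      have h3 : ∀ i, lam' i a * lam' i a * inner ℝ (f a) w = 0 := fun i => by
        have h4 := D.inner_S_comm i i (f a) w
        rw [hSw, inner_zero_right, hS, real_inner_smul_left] at h4
        rcases he a with h'' | h'' <;> rw [h''] at h4 <;> linarith
      have h5 : ¬ (lam' 0 a = 0 ∧ lam' 1 a = 0) := fun h => by
        obtain ⟨c, hc⟩ := (hnil a).mpr h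
        exact hcon a c hc
      by_contra h6
      exact h5 ⟨by simpa [h6] using h3 0, by simpa [h6] using h3 1⟩
    simp [hw0] at hw
  have huniq : ∀ k, (∃ c : ℝ, f k = c • w) → k = k₀ := by
    rintro k ⟨c, hc⟩
    obtain ⟨d, hd⟩ := hk₀
    by_contra hk
    have h3 := f.orthonormal.inner_eq_zero hk
    rw [hc, hd, real_inner_smul_left, real_inner_smul_right, real_inner_self_eq_norm_sq, hw] at h3
    rcases mul_eq_zero.mp h3 with h | h
    · exact hne k (by rw [hc, h, zero_smul])
    · rw [one_pow, mul_one] at h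
      exact hne k₀ (by rw [hd, h, zero_smul])
  obtain ⟨r, g, hg⟩ := exists_equiv_sorted (J := {k // k ≠ k₀}) (s := s)
    (by simp [Fintype.card_subtype_compl]) (fun k => e k = -1)
  -- The nilpotent direction gets the index `none`; the others are numbered by sign.
  let E : Fin (s + 1) ≃ Option (Fin s) :=
    (Equiv.optionSubtypeNe k₀).symm.trans (Equiv.optionCongr g.symm)
  have hE : ∀ α, E.symm (some α) = g α := fun α => by simp [E]
  have hE0 : E.symm none = k₀ := by simp [E]
  have heps : ∀ α, e (g α) = TauSpace.eps r α := fun α => by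
    unfold TauSpace.eps
    split_ifs with h
    · exact (hg α).mp h
    · exact (he _).resolve_left fun h' => h ((hg α).mpr h')
  refine ⟨r, fun i α => lam' i (g α), f.reindex E, fun α => ?_, fun i j α => ?_, fun i j => ?_⟩
  · by_contra! hcon
    exact (g α).2 (huniq _ ((hnil _).mpr hcon))
  · rw [OrthonormalBasis.reindex_apply, hE, hS, heps]
  · rw [OrthonormalBasis.reindex_apply, hE0]
    exact (hD _).mpr hk₀ i j

end Splitting

end SymmetricTriple

/-! ### Changes of the splitting -/

namespace SymmetricTriple

namespace Splitting

variable {τ : SymmetricTriple.{u}} {N s : ℕ}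

/-- The splitting obtained by a change of basis of `𝔷*` with matrix `(a b; c d)`. -/
noncomputable def changeBasis (D : Splitting τ N) (a b c d : ℝ) (hdet : a * d - b * c ≠ 0) :
    Splitting τ N where
  ι := D.ι
  -- The basis of `𝔷` changes by the inverse transpose, to remain dual to `Zd`.
  Z := ![(a * d - b * c)⁻¹ • (d • D.Z 0 - c • D.Z 1), (a * d - b * c)⁻¹ • (a • D.Z 1 - b • D.Z 0)]
  Zd := ![a • D.Zd 0 + b • D.Zd 1, c • D.Zd 0 + d • D.Zd 1]
  ι_mem := D.ι_mem
  Z_mem i := by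
    fin_cases i <;> exact Submodule.smul_mem _ _ (Submodule.sub_mem _
      (Submodule.smul_mem _ _ (D.Z_mem _)) (Submodule.smul_mem _ _ (D.Z_mem _)))
  Zd_mem i := by
    fin_cases i <;> exact Submodule.add_mem _
      (Submodule.smul_mem _ _ (D.Zd_mem _)) (Submodule.smul_mem _ _ (D.Zd_mem _))
  lie_Z i x := by fin_cases i <;> simp [D.lie_Z]
  B_Z_Z i j := by fin_cases i <;> fin_cases j <;> simp [D.B_Z_Z]
  B_Zd_Zd i j := by fin_cases i <;> fin_cases j <;> simp [D.B_Zd_Zd]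
  B_Z_Zd i j := by
    fin_cases i <;> fin_cases j <;> simp [D.B_Z_Zd]
    · rw [← mul_inv_cancel₀ hdet]; ring
    · right; ring
    · right; ring
    · rw [← mul_inv_cancel₀ hdet]; ring
  B_Z_ι i x := by fin_cases i <;> simp [D.B_Z_ι]
  B_Zd_ι i x := by fin_cases i <;> simp [D.B_Zd_ι]
  B_ι_ι := D.B_ι_ι
  exists_coord x hx := by
    obtain ⟨p, q, e, rfl⟩ := D.exists_coord x hx
    refine ⟨![p 0 * a + p 1 * b, p 0 * c + p 1 * d],
      ![(a * d - b * c)⁻¹ * (q 0 * d - q 1 * c), (a * d - b * c)⁻¹ * (q 1 * a - q 0 * b)], e, ?_⟩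
    have e1 : ∀ x y : ℝ, (a * d - b * c)⁻¹ * x = y ↔ x = (a * d - b * c) * y := fun x y => by
      rw [inv_mul_eq_iff_eq_mul₀ hdet]
    simp only [Fin.sum_univ_two, Matrix.cons_val_zero, Matrix.cons_val_one]
    congr 1
    · congr 1
      match_scalars
      · field_simp; ring
      · field_simp; ring
    · match_scalars
      · field_simp; ring
      · field_simp; ring
  center_le x hx := by
    obtain ⟨p, rfl⟩ := D.center_le x hx
    refine ⟨![p 0 * a + p 1 * b, p 0 * c + p 1 * d], ?_⟩
    simp only [Fin.sum_univ_two, Matrix.cons_val_zero, Matrix.cons_val_one]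
    match_scalars
    · field_simp; ring
    · field_simp; ring

theorem lie_changeBasis (D : Splitting τ N) (a b c d : ℝ) (hdet : a * d - b * c ≠ 0) :
    ⁅(D.changeBasis a b c d hdet).Zd 0, (D.changeBasis a b c d hdet).Zd 1⁆ =
      (a * d - b * c) • ⁅D.Zd 0, D.Zd 1⁆ := by
  have : ⁅D.Zd 1, D.Zd 0⁆ = - ⁅D.Zd 0, D.Zd 1⁆ := (lie_skew _ _).symm
  show ⁅a • D.Zd 0 + b • D.Zd 1, c • D.Zd 0 + d • D.Zd 1⁆ = _
  simp only [lie_add, add_lie, lie_smul, smul_lie, lie_self, this]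
  module

theorem IsDiag.changeBasis {D : Splitting τ N} {r : ℕ} {lam : Fin 2 → Fin s → ℝ}
    {f : OrthonormalBasis (Option (Fin s)) ℝ (EuclideanSpace ℝ (Fin N))} (H : D.IsDiag r lam f)
    (a b c d : ℝ) (hdet : a * d - b * c ≠ 0) :
    (D.changeBasis a b c d hdet).IsDiag r
      ![fun α => a * lam 0 α + b * lam 1 α, fun α => c * lam 0 α + d * lam 1 α] f := by
  let P : Fin 2 → Fin 2 → ℝ := ![![a, b], ![c, d]]
  have hZd : ∀ i, (D.changeBasis a b c d hdet).Zd i = P i 0 • D.Zd 0 + P i 1 • D.Zd 1 := fun i => by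
    fin_cases i <;> rfl
  have hS : ∀ i j x, (D.changeBasis a b c d hdet).S i j x = (P i 0 * P j 0) • D.S 0 0 x +
      (P i 0 * P j 1) • D.S 0 1 x + (P i 1 * P j 0) • D.S 1 0 x + (P i 1 * P j 1) • D.S 1 1 x := by
    intro i j x
    have : (D.changeBasis a b c d hdet).S i j x =
        D.pr ⁅⁅D.ι x, (D.changeBasis a b c d hdet).Zd i⁆, (D.changeBasis a b c d hdet).Zd j⁆ := rfl
    rw [this, hZd, hZd]
    simp only [lie_add, add_lie, lie_smul, smul_lie, map_add, map_smul, ← S_apply]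
    module
  refine ⟨fun α => ?_, fun i j α => ?_, fun i j => ?_⟩
  · by_contra! hcon
    obtain ⟨h0, h1⟩ := hcon
    simp only [Matrix.cons_val_zero, Matrix.cons_val_one] at h0 h1
    rcases H.admissible α with h | h
    · refine h (mul_left_cancel₀ hdet ?_)
      linear_combination d * h0 - b * h1
    · refine h (mul_left_cancel₀ hdet ?_)
      linear_combination a * h1 - c * h0
  · rw [hS, H.S_some, H.S_some, H.S_some, H.S_some]
    fin_cases i <;> fin_cases j <;>
      simp only [P, Matrix.cons_val_zero, Matrix.cons_val_one, Fin.zero_eta, Fin.mk_one] <;> module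
  · simp [hS, H.S_none]

/-- The splitting obtained by adding elements of `W` to the basis of `𝔷*`. -/
noncomputable def shift (D : Splitting τ N) (w : Fin 2 → EuclideanSpace ℝ (Fin N)) :
    Splitting τ N where
  -- The central corrections here and in `Zd` restore the orthogonality of `W` to `𝔷*` and the
  -- isotropy of `𝔷*`.
  ι := D.ι - ∑ i, (innerₗ _ (w i)).smulRight (D.Z i)
  Z := D.Z
  Zd i := D.Zd i + D.ι (w i) - (2 : ℝ)⁻¹ • ∑ j, inner ℝ (w i) (w j) • D.Z j
  ι_mem x := by
    simp only [LinearMap.sub_apply, LinearMap.sum_apply, LinearMap.smulRight_apply]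
    exact Submodule.sub_mem _ (D.ι_mem x) (Submodule.sum_mem _ fun i _ =>
      Submodule.smul_mem _ _ (D.Z_mem i))
  Z_mem := D.Z_mem
  Zd_mem i := Submodule.sub_mem _ (Submodule.add_mem _ (D.Zd_mem i) (D.ι_mem _))
    (Submodule.smul_mem _ _ (Submodule.sum_mem _ fun j _ => Submodule.smul_mem _ _ (D.Z_mem j)))
  lie_Z := D.lie_Z
  B_Z_Z := D.B_Z_Z
  B_Zd_Zd i j := by
    have := real_inner_comm (w i) (w j)
    fin_cases i <;> fin_cases j <;> simp [D.B_Z_Z, D.B_Zd_Zd, D.B_Zd_Z, D.B_Z_Zd, D.B_ι_Z, D.B_Z_ι,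
      D.B_ι_Zd, D.B_Zd_ι, D.B_ι_ι] at this ⊢ <;> linarith
  B_Z_Zd i j := by simp [D.B_Z_Z, D.B_Z_Zd, D.B_Z_ι]
  B_Z_ι i x := by simp [D.B_Z_Z, D.B_Z_ι]
  B_Zd_ι i x := by
    fin_cases i <;> simp [D.B_Z_Z, D.B_Zd_Z, D.B_ι_Z, D.B_Z_ι, D.B_Zd_ι, D.B_ι_ι]
  B_ι_ι x y := by simp [D.B_Z_Z, D.B_ι_Z, D.B_Z_ι, D.B_ι_ι]
  exists_coord x hx := by
    obtain ⟨p, q, e, rfl⟩ := D.exists_coord x hx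
    refine ⟨fun i => p i + inner ℝ (w i) e - ∑ j, (2 : ℝ)⁻¹ * (q j * inner ℝ (w j) (w i)), q,
      e - ∑ i, q i • w i, ?_⟩
    have := real_inner_comm (w 0) (w 1)
    simp only [Fin.sum_univ_two, LinearMap.sub_apply, LinearMap.add_apply, innerₗ_apply_apply,
      LinearMap.smulRight_apply, map_sub, map_add, map_smul, this]
    module
  center_le := D.center_le

section
variable (D : Splitting τ N) (w : Fin 2 → EuclideanSpace ℝ (Fin N))

theorem lie_shift_ι (v : τ.g) (x : EuclideanSpace ℝ (Fin N)) : ⁅v, (D.shift w).ι x⁆ = ⁅v, D.ι x⁆ := by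
  simp [shift, D.lie_Z]

theorem lie_shift_Zd (v : τ.g) (i : Fin 2) :
    ⁅v, (D.shift w).Zd i⁆ = ⁅v, D.Zd i⁆ + ⁅v, D.ι (w i)⁆ := by
  simp [shift, D.lie_Z]

theorem pr_shift_lie (k v : τ.g) : (D.shift w).pr ⁅k, v⁆ = D.pr ⁅k, v⁆ := by
  refine ext_inner_right ℝ fun x => ?_
  rw [inner_pr, inner_pr, B_lie, lie_shift_ι, B_lie]

theorem shift_S (hind : τ.Indecomposable) (i j : Fin 2) : (D.shift w).S i j = D.S i j := by
  ext1 x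
  have h : ⁅(D.shift w).ι x, (D.shift w).Zd i⁆ = ⁅D.ι x, D.Zd i⁆ := by
    rw [← lie_skew, lie_shift_ι, lie_skew, lie_shift_Zd, D.lie_ι_ι hind, add_zero]
  rw [S_apply, h, pr_shift_lie, lie_shift_Zd, map_add, ← rho_apply, D.rho_eq_zero hind]
  simp [S_apply]

theorem lie_Zd_shift (hind : τ.Indecomposable) :
    ⁅(D.shift w).Zd 0, (D.shift w).Zd 1⁆ =
      ⁅D.Zd 0, D.Zd 1⁆ + ⁅D.ι (w 0), D.Zd 1⁆ - ⁅D.ι (w 1), D.Zd 0⁆ := by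
  rw [lie_shift_Zd, ← lie_skew, lie_shift_Zd, ← lie_skew ((D.shift w).Zd 0), lie_shift_Zd,
    D.lie_ι_ι hind, neg_add, lie_skew, lie_skew]
  abel

theorem pr_shift_lie_Zd (hind : τ.Indecomposable) (i : Fin 2) :
    (D.shift w).pr ⁅⁅(D.shift w).Zd 0, (D.shift w).Zd 1⁆, (D.shift w).Zd i⁆ =
      D.pr ⁅⁅D.Zd 0, D.Zd 1⁆, D.Zd i⁆ + D.S 1 i (w 0) - D.S 0 i (w 1) := by
  rw [pr_shift_lie, lie_shift_Zd, map_add, ← rho_apply, D.rho_eq_zero hind, D.lie_Zd_shift w hind]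
  simp only [sub_lie, add_lie, map_sub, map_add, ← S_apply, LinearMap.zero_apply, add_zero]

end

theorem IsDiag.shift {D : Splitting τ N} (hind : τ.Indecomposable)
    {r : ℕ} {lam : Fin 2 → Fin s → ℝ}
    {f : OrthonormalBasis (Option (Fin s)) ℝ (EuclideanSpace ℝ (Fin N))} (H : D.IsDiag r lam f)
    (w : Fin 2 → EuclideanSpace ℝ (Fin N)) : (D.shift w).IsDiag r lam f :=
  ⟨H.admissible, fun i j α => by rw [D.shift_S w hind, H.S_some],
    fun i j => by rw [D.shift_S w hind, H.S_none]⟩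

end Splitting

end SymmetricTriple

/-! ### Normalising `mu` and the length of `[Z*_0, Z*_1]` -/

namespace SymmetricTriple

namespace Splitting

variable {τ : SymmetricTriple.{u}} {N s : ℕ} (D : Splitting τ N)

/-- The components in `W` of the brackets of `[Z*_1, Z*_2]` with `Z*_i`. -/
noncomputable def mu (i : Fin 2) : EuclideanSpace ℝ (Fin N) :=
  D.pr ⁅⁅D.Zd 0, D.Zd 1⁆, D.Zd i⁆

theorem B_ι_Zd_y (x : EuclideanSpace ℝ (Fin N)) (i : Fin 2) :
    τ.B ⁅D.ι x, D.Zd i⁆ ⁅D.Zd 0, D.Zd 1⁆ = - inner ℝ x (D.mu i) := by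
  rw [mu, real_inner_comm, inner_pr, B_lie, ← lie_skew, map_neg, τ.B_symm, B_lie, ← lie_skew (D.Zd i),
    map_neg, τ.B_symm ⁅D.Zd 0, D.Zd 1⁆, B_lie]

theorem B_ι_Zd_ι_Zd (x y : EuclideanSpace ℝ (Fin N)) (i j : Fin 2) :
    τ.B ⁅D.ι x, D.Zd i⁆ ⁅D.ι y, D.Zd j⁆ = - inner ℝ (D.S i j x) y := by
  rw [inner_S, neg_neg]

theorem inner_S_mu (hind : τ.Indecomposable) (d : Fin 2) (x : EuclideanSpace ℝ (Fin N)) :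
    inner ℝ (D.S d 0 x) (D.mu 1) = inner ℝ (D.S d 1 x) (D.mu 0) := by
  have := congrArg (fun k => τ.B k ⁅D.Zd 0, D.Zd 1⁆) (D.lie_ι_S hind d x)
  simp only [B_ι_Zd_y] at this
  exact neg_injective this

/-- If both products vanished, `[ι w, Z*_i]` would be orthogonal to all generators of `𝔥`, hence
zero. With `[W, W] = 0` this makes `ι w` central, although `W` meets the centre only in zero. -/
theorem exists_inner_mu_ne_zero (hind : τ.Indecomposable) {w : EuclideanSpace ℝ (Fin N)}
    (hw : w ≠ 0) (hS : ∀ i j, D.S i j w = 0) :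
    inner ℝ w (D.mu 0) ≠ 0 ∨ inner ℝ w (D.mu 1) ≠ 0 := by
  by_contra! hcon
  have hmu : ∀ i, inner ℝ w (D.mu i) = 0 := fun i => by fin_cases i; exacts [hcon.1, hcon.2]
  have h0 : ∀ i, ⁅D.ι w, D.Zd i⁆ = 0 := fun i =>
    D.eq_zero_of_B hind (D.ι_Zd_mem w i) (by rw [B_ι_Zd_y, hmu, neg_zero])
      (fun x j => by rw [B_ι_Zd_ι_Zd, hS, inner_zero_left, neg_zero])
  have hz : D.ι w ∈ τ.z := mem_z_of_m (D.ι_mem w) fun u hu => by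
    obtain ⟨p, q, e, rfl⟩ := D.exists_coord u hu
    simp [D.lie_Z, D.lie_ι_ι hind, h0]
  obtain ⟨p, hp⟩ := D.center_le _ hz
  apply hw
  rw [← D.pr_ι w, hp]
  simp [D.pr_Z]

theorem changeBasis_mu (a b c d : ℝ) (hdet : a * d - b * c ≠ 0) :
    (D.changeBasis a b c d hdet).mu 0 = (a * d - b * c) • (a • D.mu 0 + b • D.mu 1) ∧
    (D.changeBasis a b c d hdet).mu 1 = (a * d - b * c) • (c • D.mu 0 + d • D.mu 1) := by
  have h : ∀ p q : ℝ, D.pr ⁅(a * d - b * c) • ⁅D.Zd 0, D.Zd 1⁆, p • D.Zd 0 + q • D.Zd 1⁆ =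
      (a * d - b * c) • (p • D.mu 0 + q • D.mu 1) := fun p q => by
    simp only [lie_add, lie_smul, smul_lie, map_add, map_smul, mu]
    module
  constructor
  · rw [mu, lie_changeBasis]; exact h a b
  · rw [mu, lie_changeBasis]; exact h c d

theorem shift_mu (hind : τ.Indecomposable) (w : Fin 2 → EuclideanSpace ℝ (Fin N)) (i : Fin 2) :
    (D.shift w).mu i = D.mu i + D.S 1 i (w 0) - D.S 0 i (w 1) := D.pr_shift_lie_Zd w hind i

theorem exists_inner_mu_eq {r : ℕ} {lam : Fin 2 → Fin s → ℝ}
    (hind : τ.Indecomposable)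
    {f : OrthonormalBasis (Option (Fin s)) ℝ (EuclideanSpace ℝ (Fin N))} (H : D.IsDiag r lam f) :
    ∃ (D' : Splitting τ N) (lam' : Fin 2 → Fin s → ℝ), D'.IsDiag r lam' f ∧
      inner ℝ (f none) (D'.mu 0) = 1 ∧ inner ℝ (f none) (D'.mu 1) = 0 := by
  set p := inner ℝ (f none) (D.mu 0) with hp
  set q := inner ℝ (f none) (D.mu 1) with hq
  have hN : p ^ 2 + q ^ 2 ≠ 0 := by
    rcases D.exists_inner_mu_ne_zero hind (f.orthonormal.ne_zero none) H.S_none with h | h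
    · rw [← hp] at h; positivity
    · rw [← hq] at h; positivity
  -- With `N = p² + q²`, the matrix with rows `(p, q)` and `(-q, p)/N²` has determinant `1/N`. By
  -- `changeBasis_mu` the `w`-components of `mu` are transformed by the determinant times the
  -- matrix, so `(p, q)` becomes `(1, 0)`.
  have hdet : p * (((p ^ 2 + q ^ 2) ^ 2)⁻¹ * p) - q * (((p ^ 2 + q ^ 2) ^ 2)⁻¹ * -q) =
      (p ^ 2 + q ^ 2)⁻¹ := by
    field_simp; ring
  have hdet' : p * (((p ^ 2 + q ^ 2) ^ 2)⁻¹ * p) - q * (((p ^ 2 + q ^ 2) ^ 2)⁻¹ * -q) ≠ 0 := by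
    rw [hdet]; exact inv_ne_zero hN
  refine ⟨_, _, H.changeBasis p q _ _ hdet', ?_, ?_⟩
  · rw [(D.changeBasis_mu p q _ _ hdet').1, hdet]
    simp only [inner_smul_right, inner_add_right, ← hp, ← hq]
    field_simp
  · rw [(D.changeBasis_mu p q _ _ hdet').2, hdet]
    simp only [inner_smul_right, inner_add_right, ← hp, ← hq]
    ring

/-- Evaluated at `f (some α)`, `inner_S_mu` says that the `α`-components of `(mu 0, mu 1)` form a
vector parallel to `(λ_0^α, λ_1^α)`, which is non-zero. -/
theorem IsDiag.exists_mu_some {D : Splitting τ N} {r : ℕ} {lam : Fin 2 → Fin s → ℝ}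
    (hind : τ.Indecomposable)
    {f : OrthonormalBasis (Option (Fin s)) ℝ (EuclideanSpace ℝ (Fin N))} (H : D.IsDiag r lam f)
    (α : Fin s) : ∃ t : ℝ, ∀ i, inner ℝ (f (some α)) (D.mu i) = t * lam i α := by
  have h := fun d => D.inner_S_mu hind d (f (some α))
  simp only [H.S_some, real_inner_smul_left] at h
  have hN := TauSpace.normSq_ne_zero H.admissible α
  have he := TauSpace.eps_ne_zero (r := r) α
  have h' : lam 0 α * inner ℝ (f (some α)) (D.mu 1) = lam 1 α * inner ℝ (f (some α)) (D.mu 0) := by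
    rcases H.admissible α with h0 | h0
    · have := h 0
      refine mul_left_cancel₀ (mul_ne_zero he h0) ?_
      linear_combination -this
    · have := h 1
      refine mul_left_cancel₀ (mul_ne_zero he h0) ?_
      linear_combination -this
  refine ⟨(lam 0 α * inner ℝ (f (some α)) (D.mu 0) + lam 1 α * inner ℝ (f (some α)) (D.mu 1)) /
    (lam 0 α ^ 2 + lam 1 α ^ 2), fun i => ?_⟩
  rw [div_mul_eq_mul_div, eq_div_iff hN]
  fin_cases i <;> simp only [Fin.zero_eta, Fin.mk_one]
  · linear_combination (-lam 1 α) * h'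
  · linear_combination lam 0 α * h'

theorem exists_mu_eq {r : ℕ} {lam : Fin 2 → Fin s → ℝ}
    (hind : τ.Indecomposable)
    {f : OrthonormalBasis (Option (Fin s)) ℝ (EuclideanSpace ℝ (Fin N))} (H : D.IsDiag r lam f)
    (h0 : inner ℝ (f none) (D.mu 0) = 1) (h1 : inner ℝ (f none) (D.mu 1) = 0) :
    ∃ D' : Splitting τ N, D'.IsDiag r lam f ∧ D'.mu 0 = f none ∧ D'.mu 1 = 0 := by
  choose t ht using H.exists_mu_some hind
  let n : Fin s → ℝ := fun α => lam 0 α ^ 2 + lam 1 α ^ 2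
  -- A shift changes the `α`-component of `mu i` by `-ε λ_i (λ_1 w_0 - λ_0 w_1)`. This choice makes
  -- the change equal to `-t λ_i`, which cancels the component.
  let w : Fin 2 → EuclideanSpace ℝ (Fin N) :=
    ![∑ α, (TauSpace.eps r α * t α * lam 1 α / n α) • f (some α),
      ∑ α, (-(TauSpace.eps r α * t α * lam 0 α / n α)) • f (some α)]
  have hmu : ∀ i, D.mu i = inner ℝ (f none) (D.mu i) • f none + ∑ α, (t α * lam i α) • f (some α) :=
    fun i => by
      conv_lhs => rw [← f.sum_repr' (D.mu i), Fintype.sum_option]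
      simp only [ht]
  have key : ∀ i, (D.shift w).mu i = inner ℝ (f none) (D.mu i) • f none := by
    intro i
    rw [D.shift_mu hind, hmu i]
    simp only [w, Matrix.cons_val_zero, Matrix.cons_val_one, map_sum, map_smul, H.S_some]
    rw [inner_add_right, real_inner_smul_right, real_inner_self_eq_norm_sq, f.orthonormal.1,
      inner_sum]
    have : ∀ α, inner ℝ (f none) ((t α * lam i α) • f (some α)) = 0 := fun α => by
      rw [real_inner_smul_right, f.orthonormal.inner_eq_zero (by simp), mul_zero]
    simp only [this, Finset.sum_const_zero, add_zero, one_pow, mul_one]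
    rw [add_assoc, add_sub_assoc, ← Finset.sum_add_distrib, ← Finset.sum_sub_distrib, add_eq_left]
    refine Finset.sum_eq_zero fun α _ => ?_
    have he := TauSpace.eps_mul_self (r := r) α
    have hn : n α ≠ 0 := TauSpace.normSq_ne_zero H.admissible α
    rw [smul_smul, smul_smul, ← add_smul, ← sub_smul]
    refine smul_eq_zero_of_left ?_ _
    have hn' : (lam 0 α ^ 2 + lam 1 α ^ 2) / n α = 1 := div_self hn
    linear_combination (-(t α * lam i α * (TauSpace.eps r α * TauSpace.eps r α))) * hn'
      - t α * lam i α * he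
  exact ⟨D.shift w, H.shift hind w, by rw [key, h0, one_smul], by rw [key, h1, zero_smul]⟩

/-- Adding `t w` to `Z*_1` does not affect `mu`, since every `S i j` kills `w`. It replaces `y` by
`y - t [w, Z*_0]`, whose square is `B(y, y) + 2t`. -/
theorem exists_B_y_y {r : ℕ} {lam : Fin 2 → Fin s → ℝ}
    (hind : τ.Indecomposable)
    {f : OrthonormalBasis (Option (Fin s)) ℝ (EuclideanSpace ℝ (Fin N))} (H : D.IsDiag r lam f)
    (h0 : D.mu 0 = f none) (h1 : D.mu 1 = 0) :
    ∃ D' : Splitting τ N, D'.IsDiag r lam f ∧ D'.mu 0 = f none ∧ D'.mu 1 = 0 ∧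
      τ.B ⁅D'.Zd 0, D'.Zd 1⁆ ⁅D'.Zd 0, D'.Zd 1⁆ = 0 := by
  let t := -τ.B ⁅D.Zd 0, D.Zd 1⁆ ⁅D.Zd 0, D.Zd 1⁆ / 2
  let w : Fin 2 → EuclideanSpace ℝ (Fin N) := ![0, t • f none]
  have hw0 : w 0 = 0 := rfl
  have hw1 : w 1 = t • f none := rfl
  have key : ∀ i, (D.shift w).mu i = D.mu i := fun i => by
    rw [D.shift_mu hind, hw0, hw1]; simp [H.S_none]
  refine ⟨D.shift w, H.shift hind w, by rw [key, h0], by rw [key, h1], ?_⟩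
  rw [D.lie_Zd_shift w hind, hw0, hw1]
  have e : τ.B ⁅D.Zd 0, D.Zd 1⁆ ⁅D.ι (f none), D.Zd 0⁆ = -1 := by
    rw [τ.B_symm, B_ι_Zd_y, h0, real_inner_self_eq_norm_sq, f.orthonormal.1, one_pow]
  simp only [map_zero, map_smul, zero_lie, smul_lie, add_zero, map_sub, LinearMap.sub_apply,
    LinearMap.smul_apply, smul_eq_mul, B_ι_Zd_ι_Zd, H.S_none, inner_zero_left, e,
    τ.B_symm ⁅D.ι (f none), D.Zd 0⁆]
  simp only [t]
  ring

end Splitting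
end SymmetricTriple

/-! ### The frame of a normalised splitting -/

namespace SymmetricTriple

namespace Splitting

variable {τ : SymmetricTriple.{u}} {N s : ℕ} {D : Splitting τ N} {r : ℕ}
  {lam : Fin 2 → Fin s → ℝ}
  {f : OrthonormalBasis (Option (Fin s)) ℝ (EuclideanSpace ℝ (Fin N))}

theorem B_Zd_ι_y (D : Splitting τ N) (x : EuclideanSpace ℝ (Fin N)) (i : Fin 2) :
    τ.B ⁅D.Zd i, D.ι x⁆ ⁅D.Zd 0, D.Zd 1⁆ = inner ℝ x (D.mu i) := by
  rw [← lie_skew, map_neg, LinearMap.neg_apply, D.B_ι_Zd_y, neg_neg]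

theorem B_Zd_ι_Zd_ι (D : Splitting τ N) (x y : EuclideanSpace ℝ (Fin N)) (i j : Fin 2) :
    τ.B ⁅D.Zd i, D.ι x⁆ ⁅D.Zd j, D.ι y⁆ = - inner ℝ (D.S i j x) y := by
  rw [← lie_skew, ← lie_skew (D.Zd j), map_neg, map_neg, LinearMap.neg_apply, neg_neg,
    D.B_ι_Zd_ι_Zd]

theorem Zd_ι_mem (D : Splitting τ N) (x : EuclideanSpace ℝ (Fin N)) (i : Fin 2) :
    ⁅D.Zd i, D.ι x⁆ ∈ τ.h := lie_mem_h (D.Zd_mem i) (D.ι_mem x)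

theorem IsDiag.lie_Zd_ι_comm (H : D.IsDiag r lam f) (hind : τ.Indecomposable) (α : Fin s) :
    lam 0 α • ⁅D.Zd 1, D.ι (f (some α))⁆ = lam 1 α • ⁅D.Zd 0, D.ι (f (some α))⁆ := by
  have he := TauSpace.eps_ne_zero (r := r) α
  have h : ∀ d, (TauSpace.eps r α * lam d α) • (lam 0 α • ⁅D.Zd 1, D.ι (f (some α))⁆) =
      (TauSpace.eps r α * lam d α) • (lam 1 α • ⁅D.Zd 0, D.ι (f (some α))⁆) := fun d => by
    have := D.lie_ι_S hind d (f (some α))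
    rw [H.S_some, H.S_some, map_smul, map_smul, smul_lie, smul_lie, ← lie_skew, ← lie_skew (D.ι _),
      smul_neg, smul_neg, neg_smul, neg_smul, neg_neg, neg_neg] at this
    rw [smul_smul, smul_smul, this]
  rcases H.admissible α with h0 | h0
  · exact smul_right_injective _ (mul_ne_zero he h0) (h 0)
  · exact smul_right_injective _ (mul_ne_zero he h0) (h 1)

/-- By `lie_Zd_ι_comm` the two brackets `[Z*_i, W_α]` are proportional to the `λ_i^α`. Averaging
with weights `λ_j^α` gives the common factor, which is the vector `W*_α` of the frame. -/
theorem IsDiag.smul_lie_Zd_ι (H : D.IsDiag r lam f) (hind : τ.Indecomposable) (i : Fin 2)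
    (α : Fin s) :
    ⁅D.Zd i, D.ι (f (some α))⁆ = lam i α • (lam 0 α ^ 2 + lam 1 α ^ 2)⁻¹ •
      ∑ j, lam j α • ⁅D.Zd j, D.ι (f (some α))⁆ := by
  have h := H.lie_Zd_ι_comm hind α
  rw [smul_smul, mul_comm, ← smul_smul, eq_inv_smul_iff₀ (TauSpace.normSq_ne_zero H.admissible α),
    Fin.sum_univ_two]
  fin_cases i <;> simp only [Fin.zero_eta, Fin.mk_one]
  · rw [smul_add, smul_comm (lam 0 α) (lam 1 α), h]; module
  · rw [smul_add, smul_comm (lam 1 α) (lam 0 α), ← h]; module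

/-- The frame given by a normalised splitting. -/
noncomputable def frame (hind : τ.Indecomposable) (H : D.IsDiag r lam f) (h0 : D.mu 0 = f none)
    (h1 : D.mu 1 = 0) (hy : τ.B ⁅D.Zd 0, D.Zd 1⁆ ⁅D.Zd 0, D.Zd 1⁆ = 0) : Frame τ r lam where
  y := ⁅D.Zd 0, D.Zd 1⁆
  Wd α := (lam 0 α ^ 2 + lam 1 α ^ 2)⁻¹ • ∑ j, lam j α • ⁅D.Zd j, D.ι (f (some α))⁆
  wd := ⁅D.Zd 0, D.ι (f none)⁆
  Z1 := D.Z 0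
  Z2 := D.Z 1
  W α := D.ι (f (some α))
  w := D.ι (f none)
  Zd1 := D.Zd 0
  Zd2 := D.Zd 1
  Z1_mem := D.Z_mem 0
  Z2_mem := D.Z_mem 1
  W_mem α := D.ι_mem _
  w_mem := D.ι_mem _
  Zd1_mem := D.Zd_mem 0
  Zd2_mem := D.Zd_mem 1
  y_mem := D.Zd_Zd_mem
  Wd_mem α := Submodule.smul_mem _ _ (Submodule.sum_mem _ fun j _ =>
    Submodule.smul_mem _ _ (D.Zd_ι_mem _ j))
  wd_mem := D.Zd_ι_mem _ 0
  lie_Z1 := D.lie_Z 0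
  lie_Z2 := D.lie_Z 1
  lie_Zd := rfl
  lie_Zd1_w := rfl
  -- The bracket is orthogonal to `y` because `mu 1 = 0`, and to the `[ι x, Z*_i]` because `S` kills
  -- `f none`.
  lie_Zd2_w := by
    refine D.eq_zero_of_B hind (D.Zd_ι_mem _ 1) (by rw [B_Zd_ι_y, h1, inner_zero_right])
      fun x i => ?_
    rw [← lie_skew (D.ι x), map_neg, B_Zd_ι_Zd_ι, H.S_none, inner_zero_left, neg_zero, neg_zero]
  lie_Zd1_W := H.smul_lie_Zd_ι hind 0
  lie_Zd2_W := H.smul_lie_Zd_ι hind 1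
  lie_W_W α β := D.lie_ι_ι hind _ _
  lie_w_W α := D.lie_ι_ι hind _ _
  B_y_y := hy
  B_y_wd := by
    rw [τ.B_symm, B_Zd_ι_y, h0, real_inner_self_eq_norm_sq, f.orthonormal.1, one_pow]
  B_wd_wd := by rw [B_Zd_ι_Zd_ι, H.S_none, inner_zero_left, neg_zero]
  B_y_Wd α := by
    rw [τ.B_symm]
    have : inner ℝ (f (some α)) (f none) = 0 := f.orthonormal.inner_eq_zero (by simp)
    simp [B_Zd_ι_y, h0, h1, this]
  B_wd_Wd α := by simp [B_Zd_ι_Zd_ι, H.S_none]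
  B_Wd_Wd α β := by
    simp only [map_smul, LinearMap.smul_apply, map_sum, LinearMap.sum_apply, smul_eq_mul,
      B_Zd_ι_Zd_ι, H.S_some, real_inner_smul_left]
    have hi : inner ℝ (f (some α)) (f (some β)) = if α = β then (1 : ℝ) else 0 := by
      rw [orthonormal_iff_ite.mp f.orthonormal]; simp
    rw [hi]
    split_ifs with h
    · subst h
      have := TauSpace.normSq_ne_zero H.admissible α
      simp only [Fin.sum_univ_two]
      field_simp
    · simp
  B_Z1_Z1 := D.B_Z_Z 0 0
  B_Z1_Z2 := D.B_Z_Z 0 1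
  B_Z2_Z2 := D.B_Z_Z 1 1
  B_Zd1_Zd1 := D.B_Zd_Zd 0 0
  B_Zd1_Zd2 := D.B_Zd_Zd 0 1
  B_Zd2_Zd2 := D.B_Zd_Zd 1 1
  B_Z1_Zd1 := by simp [D.B_Z_Zd]
  B_Z1_Zd2 := by simp [D.B_Z_Zd]
  B_Z2_Zd1 := by simp [D.B_Z_Zd]
  B_Z2_Zd2 := by simp [D.B_Z_Zd]
  B_Z1_W α := D.B_Z_ι 0 _
  B_Z2_W α := D.B_Z_ι 1 _
  B_Zd1_W α := D.B_Zd_ι 0 _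
  B_Zd2_W α := D.B_Zd_ι 1 _
  B_Z1_w := D.B_Z_ι 0 _
  B_Z2_w := D.B_Z_ι 1 _
  B_Zd1_w := D.B_Zd_ι 0 _
  B_Zd2_w := D.B_Zd_ι 1 _
  B_w_W α := by rw [D.B_ι_ι, f.orthonormal.inner_eq_zero (by simp)]
  B_w_w := by rw [D.B_ι_ι, real_inner_self_eq_norm_sq, f.orthonormal.1, one_pow]
  B_W_W α β := by rw [D.B_ι_ι, orthonormal_iff_ite.mp f.orthonormal]; simp
  exists_coord x hx := by
    obtain ⟨p, q, e, rfl⟩ := D.exists_coord x hx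
    refine ⟨p 0, p 1, inner ℝ (f none) e, q 0, q 1, fun α => inner ℝ (f (some α)) e, ?_⟩
    conv_lhs => rw [← f.sum_repr' e, Fintype.sum_option]
    simp only [Fin.sum_univ_two, map_add, map_smul, map_sum]
    abel

end Splitting

theorem IsTypeIIa.exists_isomorphic_tau {τ : SymmetricTriple.{u}} {n : ℕ} (hn : 5 ≤ n)
    (H : τ.IsTypeIIa n) :
    ∃ (r : Fin (n - 5 + 1)) (lam : Fin 2 → Fin (n - 5) → ℝ) (hl : TauSpace.Admissible lam),
      τ.Isomorphic (tau n r lam hl) := by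
  have hind := H.indecomposable
  obtain ⟨s, rfl⟩ := Nat.exists_eq_add_of_le' hn
  obtain ⟨D, w, hw, hD⟩ := H.exists_splitting (by omega)
  obtain ⟨r, lam, f, hf⟩ := Splitting.exists_isDiag (s := s) hind D hw hD
  obtain ⟨D, lam, hf, h0, h1⟩ := D.exists_inner_mu_eq hind hf
  obtain ⟨D, hf, h0, h1⟩ := D.exists_mu_eq hind hf h0 h1
  obtain ⟨D, hf, h0, h1, hy⟩ := D.exists_B_y_y hind hf h0 h1
  exact ⟨r, lam, hf.admissible, (Splitting.frame hind hf h0 h1 hy).isomorphic hf.admissible⟩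

end SymmetricTriple

/-! ### Invariants of isomorphisms between normal forms -/

namespace TauSpace

section
variable {s : ℕ} {r r' : ℕ} {lam lam' : Fin 2 → Fin s → ℝ}

/-- The coordinates with respect to `W_1, …, W_s, w`. -/
def coord (a : TauSpace r lam) : Option (Fin s) → ℝ := fun i => i.elim a.w a.W

/-- The basis `W_1, …, W_s, w`. -/
def wBasis (r : ℕ) (lam : Fin 2 → Fin s → ℝ) : Option (Fin s) → TauSpace r lam
  | none => ⟨0, 0, 0, 0, 0, 0, 1, 0, 0⟩
  | some α => ⟨0, 0, 0, 0, 0, Pi.single α 1, 0, 0, 0⟩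

/-- The eigenvalues of `-ad b ∘ ad a` on `W_1, …, W_s, w` modulo the centre. -/
def eigval (a b : TauSpace r lam) : Option (Fin s) → ℝ :=
  fun i => i.elim 0 fun α => eps r α * a.pair α * b.pair α

theorem coord_add (a b : TauSpace r lam) : (a + b).coord = a.coord + b.coord := by
  ext i; cases i <;> rfl

theorem coord_smul (c : ℝ) (a : TauSpace r lam) : (c • a).coord = c • a.coord := by
  ext i; cases i <;> rfl

theorem coord_wBasis (i j : Option (Fin s)) : (wBasis r lam i).coord j = if i = j then 1 else 0 := by
  rcases i with - | α <;> rcases j with - | β <;>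
    simp [coord, wBasis, Pi.single_apply, eq_comm]

theorem coord_lie_lie {x : TauSpace r lam} (h1 : x.Zd1 = 0) (h2 : x.Zd2 = 0) (a b : TauSpace r lam)
    (i : Option (Fin s)) : ⁅⁅x, a⁆, b⁆.coord i = -(eigval a b i * x.coord i) := by
  rcases i with - | α
  · simp [coord, eigval, lie_def, h1, h2]
  · simp [coord, eigval, lie_def, pair, h1, h2]; ring

/-- This identity ties the determinant of the map induced on `𝔷*` to its first coordinate; in
`exists_of_equiv` it forces that map to be triangular. -/
theorem coord_lie_lie_none (a b c : TauSpace r lam) :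
    ⁅⁅a, b⁆, c⁆.coord none = (a.Zd1 * b.Zd2 - a.Zd2 * b.Zd1) * c.Zd1 := by
  simp [coord, lie_def]

theorem lie_wBasis_lie (i : Option (Fin s)) (a b : TauSpace r lam) (c : TauSpace r lam) :
    ⁅c, ⁅⁅wBasis r lam i, a⁆, b⁆ + eigval a b i • wBasis r lam i⁆ = 0 := by
  have key : ∀ x : TauSpace r lam, x.y = 0 → x.Wd = 0 → x.wd = 0 → x.W = 0 → x.w = 0 → x.Zd1 = 0 →
      x.Zd2 = 0 → ⁅c, x⁆ = 0 := by
    intro x e1 e2 e3 e4 e5 e6 e7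
    ext <;> simp [lie_def, pair, e1, e2, e3, e4, e5, e6, e7]
  rcases i with - | α
  · apply key <;> simp [wBasis, eigval, lie_def, pair]
    · rfl
    · ext β; simp
  · apply key <;> simp [wBasis, eigval, lie_def, pair]
    · ext β; simp
    · ext β
      rcases eq_or_ne β α with rfl | h <;> simp [*]; ring

theorem form_eq_sum_coord {a b : TauSpace r lam} (h1 : a.y = 0 ∧ a.Wd = 0 ∧ a.wd = 0)
    (h2 : a.Zd1 = 0) (h3 : a.Zd2 = 0) (h4 : b.Zd1 = 0) (h5 : b.Zd2 = 0) :
    form a b = ∑ i, a.coord i * b.coord i := by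
  simp [form_apply, coord, Fintype.sum_option, h1.1, h1.2.1, h1.2.2, h2, h3, h4, h5, add_comm]

theorem exists_eigval_ne_zero (hl : Admissible lam) (α : Fin s) :
    ∃ a : TauSpace r lam, a.pair α ≠ 0 := by
  rcases hl α with h | h
  · exact ⟨⟨0, 0, 0, 0, 0, 0, 0, 1, 0⟩, by simpa [pair] using h⟩
  · exact ⟨⟨0, 0, 0, 0, 0, 0, 0, 0, 1⟩, by simpa [pair] using h⟩

section
variable (Φ : TauSpace r lam ≃ₗ⁅ℝ⁆ TauSpace r' lam')

theorem map_center {x : TauSpace r lam} (hx : ∀ b : TauSpace r lam, ⁅b, x⁆ = 0)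
    (b : TauSpace r' lam') : ⁅b, Φ x⁆ = 0 := by
  rw [← Φ.apply_symm_apply b, ← LieEquiv.map_lie, hx, map_zero]

variable (hl : Admissible lam) (hl' : Admissible lam')
  (hσ : ∀ x, Φ (sigma x) = sigma (Φ x)) (hB : ∀ x y, form (Φ x) (Φ y) = form x y)

include hl hB in
-- The `𝔷*`-coordinates are pairings with the centre, and `Φ` preserves both the centre and the
-- form.
theorem map_Zd_eq_zero {x : TauSpace r lam} (h1 : x.Zd1 = 0) (h2 : x.Zd2 = 0) :
    (Φ x).Zd1 = 0 ∧ (Φ x).Zd2 = 0 := by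
  have key : ∀ u : TauSpace r' lam', (∀ b : TauSpace r' lam', ⁅b, u⁆ = 0) → form (Φ x) u = 0 := by
    intro u hu
    have hu' := (mem_center_iff hl _).mp (map_center Φ.symm hu)
    rw [← Φ.apply_symm_apply u, hB, form_apply]
    obtain ⟨e1, e2, e3, e4, e5, e6, e7⟩ := hu'
    simp [e1, e2, e3, e4, e5, e6, e7, h1, h2]
  have k1 := key ⟨0, 0, 0, 1, 0, 0, 0, 0, 0⟩ (fun b => by ext <;> simp [lie_def, pair])
  have k2 := key ⟨0, 0, 0, 0, 1, 0, 0, 0, 0⟩ (fun b => by ext <;> simp [lie_def, pair])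
  exact ⟨by simpa [form_apply] using k1, by simpa [form_apply] using k2⟩

include hσ in
theorem map_mem_m {x : TauSpace r lam} (hx : x.y = 0 ∧ x.Wd = 0 ∧ x.wd = 0) :
    (Φ x).y = 0 ∧ (Φ x).Wd = 0 ∧ (Φ x).wd = 0 := by
  rw [← mem_m_iff, Module.End.mem_eigenspace_iff] at hx ⊢
  have h : sigma x = (-1 : ℝ) • x := hx
  show sigma (Φ x) = _
  rw [← hσ, h, map_smul]

theorem wBasis_Zd (i : Option (Fin s)) : (wBasis r lam i).Zd1 = 0 ∧ (wBasis r lam i).Zd2 = 0 := by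
  cases i <;> exact ⟨rfl, rfl⟩

theorem wBasis_mem_m (i : Option (Fin s)) :
    (wBasis r lam i).y = 0 ∧ (wBasis r lam i).Wd = 0 ∧ (wBasis r lam i).wd = 0 := by
  cases i <;> exact ⟨rfl, rfl, rfl⟩

include hl hl' hB in
-- The image under `Φ` of the eigenvector relation of `lie_wBasis_lie`: the matrix entry of `Φ` from
-- `i` to `j` can be non-zero only if the eigenvalues agree for all `a, b`.
theorem eigval_mul_coord (i j : Option (Fin s)) (a b : TauSpace r lam) :
    eigval (Φ a) (Φ b) j * (Φ (wBasis r lam i)).coord j =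
      eigval a b i * (Φ (wBasis r lam i)).coord j := by
  have h := (mem_center_iff hl' _).mp (map_center Φ (lie_wBasis_lie i a b))
  have h0 : (Φ (⁅⁅wBasis r lam i, a⁆, b⁆ + eigval a b i • wBasis r lam i)).coord j = 0 := by
    cases j
    · exact h.2.2.2.2.1
    · exact congrFun h.2.2.2.1 _
  have hz := map_Zd_eq_zero Φ hl hB (wBasis_Zd i).1 (wBasis_Zd i).2
  rw [map_add, map_smul, LieEquiv.map_lie, LieEquiv.map_lie, coord_add, coord_smul, Pi.add_apply,
    coord_lie_lie hz.1 hz.2, Pi.smul_apply, smul_eq_mul] at h0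
  linarith

include hl hσ hB in
theorem sum_coord_mul_coord (i k : Option (Fin s)) :
    ∑ j, (Φ (wBasis r lam i)).coord j * (Φ (wBasis r lam k)).coord j = if i = k then 1 else 0 := by
  have hz := fun i => map_Zd_eq_zero Φ hl hB (wBasis_Zd i).1 (wBasis_Zd i).2
  rw [← form_eq_sum_coord (map_mem_m Φ hσ (wBasis_mem_m i)) (hz i).1 (hz i).2 (hz k).1 (hz k).2, hB,
    form_eq_sum_coord (wBasis_mem_m i) (wBasis_Zd i).1 (wBasis_Zd i).2 (wBasis_Zd k).1
      (wBasis_Zd k).2]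
  simp [coord_wBasis]

include hl hl' hσ hB in
-- The matrix of `Φ` on `W` modulo `𝔷` is orthogonal, so some term of the Leibniz expansion of its
-- determinant is non-zero. The permutation of that term meets only non-zero entries, hence matches
-- eigenvalues, for all `a, b` at once.
theorem exists_perm_eigval : ∃ σ : Equiv.Perm (Option (Fin s)), ∀ i,
    (∀ a b, eigval (Φ a) (Φ b) (σ i) = eigval a b i) := by
  let M : Matrix (Option (Fin s)) (Option (Fin s)) ℝ :=
    Matrix.of fun j i => (Φ (wBasis r lam i)).coord j
  have hM : M.transpose * M = 1 := by
    ext i k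
    rw [Matrix.mul_apply, Matrix.one_apply, ← sum_coord_mul_coord Φ hl hσ hB]
    rfl
  have hdet : M.det ≠ 0 := fun h => by
    have := congrArg Matrix.det hM
    rw [Matrix.det_mul, h, mul_zero, Matrix.det_one] at this
    exact zero_ne_one this
  rw [Matrix.det_apply] at hdet
  obtain ⟨σ, -, h⟩ := Finset.exists_ne_zero_of_sum_ne_zero hdet
  refine ⟨σ, fun i a b => ?_⟩
  have hi : M (σ i) i ≠ 0 := fun h0 => h (smul_eq_zero_of_right _
    (Finset.prod_eq_zero (Finset.mem_univ i) h0))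
  exact mul_right_cancel₀ hi (eigval_mul_coord Φ hl hl' hB i (σ i) a b)

include hl hl' hσ hB in
-- The index `none` has eigenvalue zero throughout, whereas admissibility makes that of `some α`
-- non-zero for suitable `a`; so no `some α` is sent to `none`.
theorem exists_perm_pair : ∃ π : Equiv.Perm (Fin s), ∀ α a b,
    eps r' (π α) * (Φ a).pair (π α) * (Φ b).pair (π α) = eps r α * a.pair α * b.pair α := by
  obtain ⟨σ, h⟩ := exists_perm_eigval Φ hl hl' hσ hB
  have hsome : ∀ α, ∃ β, σ (some α) = some β := by
    intro α
    rw [← Option.ne_none_iff_exists']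
    intro hn
    obtain ⟨a, ha⟩ := exists_eigval_ne_zero (r := r) hl α
    have := h (some α) a a
    rw [hn] at this
    exact mul_ne_zero (mul_ne_zero (eps_ne_zero α) ha) ha this.symm
  refine ⟨Equiv.removeNone σ, fun α a b => ?_⟩
  have := h (some α) a b
  rwa [← Equiv.removeNone_some σ (hsome α)] at this

include hl hl' hσ hB in
-- For the same reason `Φ w` has no `W_β`-component. It is `κ w` modulo `𝔷`, with `κ² = 1` by
-- isometry, and pairing with it reads off the `w`-coordinate.
theorem exists_coord_none : ∃ κ : ℝ, κ * κ = 1 ∧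
    ∀ x : TauSpace r lam, x.Zd1 = 0 → x.Zd2 = 0 → x.y = 0 ∧ x.Wd = 0 ∧ x.wd = 0 →
      (Φ x).coord none = κ * x.coord none := by
  have h0 : ∀ β, (Φ (wBasis r lam none)).coord (some β) = 0 := by
    intro β
    obtain ⟨a, ha⟩ := exists_eigval_ne_zero (r := r') hl' β
    have h := eigval_mul_coord Φ hl hl' hB none (some β) (Φ.symm a) (Φ.symm a)
    rw [Φ.apply_symm_apply, show eigval (Φ.symm a) (Φ.symm a) none = 0 from rfl, zero_mul] at h
    exact (mul_eq_zero.mp h).resolve_left (mul_ne_zero (mul_ne_zero (eps_ne_zero β) ha) ha)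
  refine ⟨(Φ (wBasis r lam none)).coord none, ?_, fun x h1 h2 hx => ?_⟩
  · have := sum_coord_mul_coord Φ hl hσ hB none none
    rw [Fintype.sum_option] at this
    simpa [h0] using this
  · have hx0 : form x (wBasis r lam none) = x.coord none := by
      simp [form_apply, wBasis, coord, hx.1]
    have hz := map_Zd_eq_zero Φ hl hB h1 h2
    have hz' := map_Zd_eq_zero Φ hl hB (wBasis_Zd none).1 (wBasis_Zd none).2
    have hk : (Φ (wBasis r lam none)).coord none * (Φ (wBasis r lam none)).coord none = 1 := by
      have := sum_coord_mul_coord Φ hl hσ hB none none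
      rw [Fintype.sum_option] at this
      simpa [h0] using this
    rw [← hB, form_eq_sum_coord (map_mem_m Φ hσ hx) hz.1 hz.2 hz'.1 hz'.2, Fintype.sum_option] at hx0
    simp only [h0, mul_zero, Finset.sum_const_zero, add_zero] at hx0
    linear_combination (Φ (wBasis r lam none)).coord none * hx0 - (Φ x).coord none * hk

end

end

theorem exists_units_of_mul_eq {p q p' q' : ℝ} (h1 : p' * p' = p * p) (h2 : p' * q' = p * q)
    (h3 : q' * q' = q * q) : ∃ η : ℤˣ, p' = ((η : ℤ) : ℝ) * p ∧ q' = ((η : ℤ) : ℝ) * q := by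
  by_cases hp : p = 0
  · have hp' : p' = 0 := by simpa [hp] using h1
    rcases mul_self_eq_mul_self_iff.mp h3 with h | h
    · exact ⟨1, by simp [hp, hp'], by simp [h]⟩
    · exact ⟨-1, by simp [hp, hp'], by simp [h]⟩
  · rcases mul_self_eq_mul_self_iff.mp h1 with h | h
    · exact ⟨1, by simp [h], by
        refine mul_left_cancel₀ hp ?_; rw [h] at h2; simpa using h2⟩
    · exact ⟨-1, by simp [h], by
        refine mul_left_cancel₀ hp ?_; rw [h] at h2; push_cast; linarith⟩

theorem eq_of_eps_perm {s : ℕ} {r r' : ℕ} (hr : r ≤ s) (hr' : r' ≤ s) (π : Equiv.Perm (Fin s))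
    (h : ∀ α, eps r' (π α) = eps r α) : r = r' ∧ PreservesPartition r π := by
  have h' : ∀ α : Fin s, ((π α : Fin s) : ℕ) < r' ↔ (α : ℕ) < r := fun α => by
    have := h α
    unfold eps at this
    constructor <;> intro h0 <;> by_contra h1 <;> simp only [h0, h1, if_true, if_false] at this <;>
      norm_num at this
  have hc : r = r' := by
    have e1 : Fintype.card {α : Fin s // (α : ℕ) < r} = r := by
      rw [Fintype.card_subtype, Fin.card_filter_val_lt, min_eq_right hr]
    have e2 : Fintype.card {α : Fin s // (α : ℕ) < r'} = r' := by
      rw [Fintype.card_subtype, Fin.card_filter_val_lt, min_eq_right hr']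
    rw [← e1, ← e2]
    exact Fintype.card_congr (π.subtypeEquiv fun α => (h' α).symm)
  subst hc
  exact ⟨rfl, h'⟩

theorem exists_of_equiv {s : ℕ} {r r' : ℕ} {lam lam' : Fin 2 → Fin s → ℝ} (hr : r ≤ s) (hr' : r' ≤ s)
    (Φ : TauSpace r lam ≃ₗ⁅ℝ⁆ TauSpace r' lam') (hl : Admissible lam) (hl' : Admissible lam')
    (hσ : ∀ x, Φ (sigma x) = sigma (Φ x)) (hB : ∀ x y, form (Φ x) (Φ y) = form x y) :
    r = r' ∧ ∃ (a b : ℝ) (π : Equiv.Perm (Fin s)) (η : Fin s → ℤˣ), a ≠ 0 ∧ PreservesPartition r π ∧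
      ∀ α, lam' 0 (π α) = ((η α : ℤ) : ℝ) * (a * lam 0 α + b * lam 1 α) ∧
        lam' 1 (π α) = ((η α : ℤ) : ℝ) * ((a ^ 2)⁻¹ * lam 1 α) := by
  obtain ⟨π, hπ⟩ := exists_perm_pair Φ hl hl' hσ hB
  obtain ⟨κ, hκ, hw⟩ := exists_coord_none Φ hl hl' hσ hB
  set e₁ : TauSpace r lam := ⟨0, 0, 0, 0, 0, 0, 0, 1, 0⟩ with he₁
  set e₂ : TauSpace r lam := ⟨0, 0, 0, 0, 0, 0, 0, 0, 1⟩ with he₂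
  -- Compare the `w`-coordinate of `[[Z*_1, Z*_2], c]` before and after applying `Φ`.
  have hdet : ∀ c : TauSpace r lam, c.y = 0 ∧ c.Wd = 0 ∧ c.wd = 0 →
      ((Φ e₁).Zd1 * (Φ e₂).Zd2 - (Φ e₁).Zd2 * (Φ e₂).Zd1) * (Φ c).Zd1 = κ * c.Zd1 := fun c hc => by
    have h := hw ⁅⁅e₁, e₂⁆, c⁆ rfl rfl ⟨by simp [lie_def], by ext; simp [lie_def, pair, he₁, he₂],
      by simp [lie_def, he₁, he₂]⟩
    rw [LieEquiv.map_lie, LieEquiv.map_lie, coord_lie_lie_none, coord_lie_lie_none] at h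
    rw [h]; simp [he₁, he₂]
  have d1 := hdet e₁ ⟨rfl, rfl, rfl⟩
  have d2 := hdet e₂ ⟨rfl, rfl, rfl⟩
  have hκ0 : κ ≠ 0 := fun h => by simp [h] at hκ
  set A := (Φ e₁).Zd1
  set C := (Φ e₁).Zd2
  set D := (Φ e₂).Zd2
  -- From `c = e₁` the determinant is non-zero; then `c = e₂` makes the induced map triangular.
  have hE : (Φ e₂).Zd1 = 0 := by
    have h1 : e₂.Zd1 = 0 := rfl
    rw [h1, mul_zero] at d2
    refine (mul_eq_zero.mp d2).resolve_left fun h0 => ?_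
    rw [h0, zero_mul] at d1
    exact hκ0 (by simpa [he₁] using d1.symm)
  have d3 : A * D * A = κ := by
    have h1 : e₁.Zd1 = 1 := rfl
    rw [hE, h1] at d1; linarith
  have hA : A ≠ 0 := fun h => hκ0 (by rw [← d3, h]; ring)
  have p1 : ∀ α, e₁.pair α = lam 0 α := fun α => by simp [pair, he₁]
  have p2 : ∀ α, e₂.pair α = lam 1 α := fun α => by simp [pair, he₂]
  have q1 : ∀ α, (Φ e₁).pair α = A * lam' 0 α + C * lam' 1 α := fun α => rfl
  have q2 : ∀ α, (Φ e₂).pair α = D * lam' 1 α := fun α => by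
    show (Φ e₂).Zd1 * _ + _ = _
    rw [hE, zero_mul, zero_add]
  have heps : ∀ α, eps r' (π α) = eps r α := by
    intro α
    obtain ⟨a, ha⟩ := exists_eigval_ne_zero (r := r) hl α
    have h := hπ α a a
    have h1 := mul_self_pos.mpr ha
    have h2 : 0 ≤ (Φ a).pair (π α) * (Φ a).pair (π α) := mul_self_nonneg _
    rw [mul_assoc, mul_assoc] at h
    unfold eps at h ⊢
    split_ifs at h ⊢ <;> first | rfl | nlinarith
  obtain ⟨hrr, hpp⟩ := eq_of_eps_perm hr hr' π heps
  have hη : ∀ α, ∃ η : ℤˣ, A * lam' 0 (π α) + C * lam' 1 (π α) = ((η : ℤ) : ℝ) * lam 0 α ∧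
      D * lam' 1 (π α) = ((η : ℤ) : ℝ) * lam 1 α := by
    intro α
    have h : ∀ a b, (Φ a).pair (π α) * (Φ b).pair (π α) = a.pair α * b.pair α := fun a b => by
      have := hπ α a b
      rw [heps, mul_assoc, mul_assoc] at this
      exact mul_left_cancel₀ (eps_ne_zero α) this
    rw [← q1, ← q2, ← p1, ← p2]
    exact exists_units_of_mul_eq (h _ _) (h _ _) (h _ _)
  choose η hη1 hη2 using hη
  obtain ⟨κ', hκ'⟩ : ∃ κ' : ℤˣ, κ = ((κ' : ℤ) : ℝ) := by
    rcases mul_self_eq_one_iff.mp hκ with h | h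
    · exact ⟨1, by simp [h]⟩
    · exact ⟨-1, by simp [h]⟩
  have hD : D = κ * (A ^ 2)⁻¹ := by
    rw [eq_mul_inv_iff_mul_eq₀ (pow_ne_zero 2 hA)]; linarith
  -- Obtained by inverting `A λ'_1 + C λ'_2 = η λ_1` and `D λ'_2 = η λ_2` with `D = κ A⁻²`; the
  -- common sign `κ` is moved into the signs `η`.
  refine ⟨hrr, κ * A⁻¹, -(A * C), π, fun α => κ' * η α, mul_ne_zero hκ0 (inv_ne_zero hA), hpp,
    fun α => ?_⟩
  have k2 : lam' 1 (π α) = κ * ((η α : ℤ) : ℝ) * (A ^ 2 * lam 1 α) := by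
    have h := hη2 α
    rw [hD] at h
    have hA2 : (A ^ 2)⁻¹ * A ^ 2 = 1 := inv_mul_cancel₀ (pow_ne_zero 2 hA)
    linear_combination κ * A ^ 2 * h - κ * κ * lam' 1 (π α) * hA2 - lam' 1 (π α) * hκ
  push_cast
  rw [← hκ']
  constructor
  · have h := hη1 α
    rw [k2] at h
    have hA2 : A⁻¹ * A = 1 := inv_mul_cancel₀ hA
    linear_combination A⁻¹ * h - lam' 0 (π α) * hA2 - ((η α : ℤ) : ℝ) * A⁻¹ * lam 0 α * hκ
      - A * ((η α : ℤ) : ℝ) * κ * C * lam 1 α * hA2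
  · rw [k2, mul_pow, mul_inv, inv_pow, inv_inv, pow_two κ, hκ]; ring

end TauSpace

/-! ### Realising the admissible transformations by isomorphisms -/

theorem TauSpace.eq_sum_of_mem_m {s r : ℕ} {lam : Fin 2 → Fin s → ℝ} {a : ℝ} (ha : a ≠ 0) (b : ℝ)
    (π : Equiv.Perm (Fin s)) {x : TauSpace r lam} (hx : x.y = 0 ∧ x.Wd = 0 ∧ x.wd = 0) :
    x = (a * (x.Z1 + a * b * (x.Z2 / a ^ 2))) • ⟨0, 0, 0, a⁻¹, 0, 0, 0, 0, 0⟩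
      + (x.Z2 / a ^ 2) • ⟨0, 0, 0, -(a * b), a ^ 2, 0, 0, 0, 0⟩
      + ∑ β, x.W (π.symm β) • (⟨0, 0, 0, 0, 0, Pi.single (π.symm β) 1, 0, 0, 0⟩ : TauSpace r lam)
      + x.w • ⟨0, 0, 0, 0, 0, 0, 1, 0, 0⟩
      + (x.Zd1 / a) • ⟨0, 0, 0, 0, 0, 0, 0, a, b⟩
      + ((x.Zd2 - b * (x.Zd1 / a)) * a ^ 2) • ⟨0, 0, 0, 0, 0, 0, 0, 0, (a ^ 2)⁻¹⟩ := by
  let φ : (Fin s → ℝ) →ₗ[ℝ] TauSpace r lam :=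
    { toFun := fun u => ⟨0, 0, 0, 0, 0, u, 0, 0, 0⟩
      map_add' := fun u v => by ext <;> simp
      map_smul' := fun c v => by ext <;> simp }
  have hsum : ∑ β, x.W (π.symm β) • (⟨0, 0, 0, 0, 0, Pi.single (π.symm β) 1, 0, 0, 0⟩ :
      TauSpace r lam) = ⟨0, 0, 0, 0, 0, x.W, 0, 0, 0⟩ := by
    rw [π.symm.sum_comp fun β => x.W β •
      (⟨0, 0, 0, 0, 0, Pi.single β 1, 0, 0, 0⟩ : TauSpace r lam)]
    have : φ x.W = ∑ β, x.W β • φ (Pi.single β 1) := by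
      rw [← Finset.univ_sum_single x.W, map_sum]
      refine Finset.sum_congr rfl fun β _ => ?_
      rw [← map_smul, ← Pi.single_smul, Finset.univ_sum_single, smul_eq_mul, mul_one]
    exact this.symm
  rw [hsum]
  ext <;> simp [hx.1, hx.2.1, hx.2.2]
  all_goals field_simp
  all_goals ring

section
variable {n : ℕ} {r : Fin (n - 5 + 1)} {lam lam' : Fin 2 → Fin (n - 5) → ℝ}

theorem tau_B_toTau (hl : TauSpace.Admissible lam) (x y : TauSpace (r : ℕ) lam) :
    (tau n r lam hl).B (toTau hl x) (toTau hl y) = TauSpace.form x y := rfl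

theorem tau_lie_toTau (hl : TauSpace.Admissible lam) (x y : TauSpace (r : ℕ) lam) :
    ⁅toTau hl x, toTau hl y⁆ = toTau hl ⁅x, y⁆ := rfl

/-- The frame of a normal form that is obtained by a change of basis of `𝔷*` and a signed
permutation of the `W_α`. -/
noncomputable def transformedFrame (hl : TauSpace.Admissible lam) {a b : ℝ} (ha : a ≠ 0)
    {π : Equiv.Perm (Fin (n - 5))} {η : Fin (n - 5) → ℤˣ} (hπ : PreservesPartition r π)
    (h0 : ∀ α, lam' 0 (π α) = ((η α : ℤ) : ℝ) * (a * lam 0 α + b * lam 1 α))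
    (h1 : ∀ α, lam' 1 (π α) = ((η α : ℤ) : ℝ) * ((a ^ 2)⁻¹ * lam 1 α)) :
    SymmetricTriple.Frame (tau n r lam hl) (r : ℕ) lam' where
  -- The bracket of the new `Z*_1`, `Z*_2` is `a · a⁻² y`, while the new `w*` is `a w*`; the factor
  -- `a⁻²` on `Z*_2` is what keeps `B(y, w*) = 1` with `w` unchanged.
  y := toTau hl ⟨a⁻¹, 0, 0, 0, 0, 0, 0, 0, 0⟩
  Wd β := toTau hl ⟨0, Pi.single (π.symm β) ((η (π.symm β) : ℤ) : ℝ), 0, 0, 0, 0, 0, 0, 0⟩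
  wd := toTau hl ⟨0, 0, a, 0, 0, 0, 0, 0, 0⟩
  Z1 := toTau hl ⟨0, 0, 0, a⁻¹, 0, 0, 0, 0, 0⟩
  Z2 := toTau hl ⟨0, 0, 0, -(a * b), a ^ 2, 0, 0, 0, 0⟩
  W β := toTau hl ⟨0, 0, 0, 0, 0, Pi.single (π.symm β) 1, 0, 0, 0⟩
  w := toTau hl ⟨0, 0, 0, 0, 0, 0, 1, 0, 0⟩
  Zd1 := toTau hl ⟨0, 0, 0, 0, 0, 0, 0, a, b⟩
  Zd2 := toTau hl ⟨0, 0, 0, 0, 0, 0, 0, 0, (a ^ 2)⁻¹⟩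
  Z1_mem := (tau_mem_m hl _).mpr ⟨rfl, rfl, rfl⟩
  Z2_mem := (tau_mem_m hl _).mpr ⟨rfl, rfl, rfl⟩
  W_mem α := (tau_mem_m hl _).mpr ⟨rfl, rfl, rfl⟩
  w_mem := (tau_mem_m hl _).mpr ⟨rfl, rfl, rfl⟩
  Zd1_mem := (tau_mem_m hl _).mpr ⟨rfl, rfl, rfl⟩
  Zd2_mem := (tau_mem_m hl _).mpr ⟨rfl, rfl, rfl⟩
  y_mem := (tau_mem_h hl _).mpr ⟨rfl, rfl, rfl, rfl, rfl, rfl⟩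
  Wd_mem α := (tau_mem_h hl _).mpr ⟨rfl, rfl, rfl, rfl, rfl, rfl⟩
  wd_mem := (tau_mem_h hl _).mpr ⟨rfl, rfl, rfl, rfl, rfl, rfl⟩
  lie_Z1 := (TauSpace.mem_center_iff hl _).mpr ⟨rfl, rfl, rfl, rfl, rfl, rfl, rfl⟩
  lie_Z2 := (TauSpace.mem_center_iff hl _).mpr ⟨rfl, rfl, rfl, rfl, rfl, rfl, rfl⟩
  lie_Zd := by
    rw [tau_lie_toTau]
    refine congrArg (toTau hl) ?_
    ext <;> simp [TauSpace.lie_def, TauSpace.pair]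
    field_simp
  lie_Zd1_w := by
    rw [tau_lie_toTau]
    refine congrArg (toTau hl) ?_
    ext <;> simp [TauSpace.lie_def, TauSpace.pair]
  lie_Zd2_w := by
    rw [tau_lie_toTau]
    refine congrArg (toTau hl) (?_ : _ = (0 : TauSpace (r : ℕ) lam))
    ext <;> simp [TauSpace.lie_def, TauSpace.pair]
  lie_Zd1_W β := by
    rw [tau_lie_toTau]
    refine congrArg (toTau hl) (?_ : _ = lam' 0 β • (⟨0, Pi.single (π.symm β) ((η (π.symm β) : ℤ) : ℝ), 0, 0, 0, 0, 0, 0, 0⟩ : TauSpace (r : ℕ) lam))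
    obtain ⟨α, rfl⟩ := π.surjective β
    ext γ <;> simp [TauSpace.lie_def, TauSpace.pair]
    rcases eq_or_ne γ α with rfl | h
    · have := units_cast_mul_self (η γ)
      simp [h0]
      linear_combination (-(a * lam 0 γ + b * lam 1 γ)) * this
    · simp [h]
  lie_Zd2_W β := by
    rw [tau_lie_toTau]
    refine congrArg (toTau hl) (?_ : _ = lam' 1 β • (⟨0, Pi.single (π.symm β) ((η (π.symm β) : ℤ) : ℝ), 0, 0, 0, 0, 0, 0, 0⟩ : TauSpace (r : ℕ) lam))
    obtain ⟨α, rfl⟩ := π.surjective β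
    ext γ <;> simp [TauSpace.lie_def, TauSpace.pair]
    rcases eq_or_ne γ α with rfl | h
    · have := units_cast_mul_self (η γ)
      simp [h1]
      linear_combination (-((a ^ 2)⁻¹ * lam 1 γ)) * this
    · simp [h]
  lie_W_W α β := by
    rw [tau_lie_toTau]
    refine congrArg (toTau hl) (?_ : _ = (0 : TauSpace (r : ℕ) lam))
    ext <;> simp [TauSpace.lie_def, TauSpace.pair]
  lie_w_W α := by
    rw [tau_lie_toTau]
    refine congrArg (toTau hl) (?_ : _ = (0 : TauSpace (r : ℕ) lam))
    ext <;> simp [TauSpace.lie_def, TauSpace.pair]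
  B_y_y := by simp [tau_B_toTau, TauSpace.form_apply]
  B_y_wd := by simp [tau_B_toTau, TauSpace.form_apply, ha]
  B_wd_wd := by simp [tau_B_toTau, TauSpace.form_apply]
  B_y_Wd α := by simp [tau_B_toTau, TauSpace.form_apply]
  B_wd_Wd α := by simp [tau_B_toTau, TauSpace.form_apply]
  B_Wd_Wd α β := by
    obtain ⟨α, rfl⟩ := π.surjective α
    obtain ⟨β, rfl⟩ := π.surjective β
    have h2 : TauSpace.eps (r : ℕ) (π α) = TauSpace.eps (r : ℕ) α := by
      unfold TauSpace.eps; simp only [hπ α]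
    have := units_cast_mul_self (η α)
    rcases eq_or_ne α β with rfl | h
    · simp [tau_B_toTau, TauSpace.form_apply, Pi.single_apply, h2, this]
    · simp [tau_B_toTau, TauSpace.form_apply, Pi.single_apply, h, h.symm]
  B_Z1_Z1 := by simp [tau_B_toTau, TauSpace.form_apply]
  B_Z1_Z2 := by simp [tau_B_toTau, TauSpace.form_apply]
  B_Z2_Z2 := by simp [tau_B_toTau, TauSpace.form_apply]
  B_Zd1_Zd1 := by simp [tau_B_toTau, TauSpace.form_apply]
  B_Zd1_Zd2 := by simp [tau_B_toTau, TauSpace.form_apply]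
  B_Zd2_Zd2 := by simp [tau_B_toTau, TauSpace.form_apply]
  B_Z1_Zd1 := by simp [tau_B_toTau, TauSpace.form_apply, ha]
  B_Z1_Zd2 := by simp [tau_B_toTau, TauSpace.form_apply]
  B_Z2_Zd1 := by simp [tau_B_toTau, TauSpace.form_apply]; ring
  B_Z2_Zd2 := by simp [tau_B_toTau, TauSpace.form_apply, ha]
  B_Z1_W α := by simp [tau_B_toTau, TauSpace.form_apply]
  B_Z2_W α := by simp [tau_B_toTau, TauSpace.form_apply]
  B_Zd1_W α := by simp [tau_B_toTau, TauSpace.form_apply]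
  B_Zd2_W α := by simp [tau_B_toTau, TauSpace.form_apply]
  B_Z1_w := by simp [tau_B_toTau, TauSpace.form_apply]
  B_Z2_w := by simp [tau_B_toTau, TauSpace.form_apply]
  B_Zd1_w := by simp [tau_B_toTau, TauSpace.form_apply]
  B_Zd2_w := by simp [tau_B_toTau, TauSpace.form_apply]
  B_w_W α := by simp [tau_B_toTau, TauSpace.form_apply]
  B_w_w := by simp [tau_B_toTau, TauSpace.form_apply]
  B_W_W α β := by simp [tau_B_toTau, TauSpace.form_apply, Pi.single_apply, eq_comm]
  exists_coord x hx := by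
    have hx' := (tau_mem_m hl x).mp hx
    exact ⟨_, _, _, _, _, _, TauSpace.eq_sum_of_mem_m ha b π hx'⟩

theorem tau_isomorphic_tau (hl : TauSpace.Admissible lam) (hl' : TauSpace.Admissible lam') {a b : ℝ}
    (ha : a ≠ 0) {π : Equiv.Perm (Fin (n - 5))} {η : Fin (n - 5) → ℤˣ} (hπ : PreservesPartition r π)
    (h : ∀ α, lam' 0 (π α) = ((η α : ℤ) : ℝ) * (a * lam 0 α + b * lam 1 α) ∧
      lam' 1 (π α) = ((η α : ℤ) : ℝ) * ((a ^ 2)⁻¹ * lam 1 α)) :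
    (tau n r lam hl).Isomorphic (tau n r lam' hl') :=
  (transformedFrame hl ha hπ (fun α => (h α).1) fun α => (h α).2).isomorphic hl'

theorem tau_isomorphic_iff {r' : Fin (n - 5 + 1)} (hl : TauSpace.Admissible lam)
    (hl' : TauSpace.Admissible lam') :
    (tau n r lam hl).Isomorphic (tau n r' lam' hl') ↔ r = r' ∧
      ∃ (a b : ℝ) (π : Equiv.Perm (Fin (n - 5))) (η : Fin (n - 5) → ℤˣ), a ≠ 0 ∧
        PreservesPartition r π ∧
        ∀ α, lam' 0 (π α) = ((η α : ℤ) : ℝ) * (a * lam 0 α + b * lam 1 α) ∧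
          lam' 1 (π α) = ((η α : ℤ) : ℝ) * ((a ^ 2)⁻¹ * lam 1 α) := by
  constructor
  · rintro ⟨Φ, hσ, hB⟩
    obtain ⟨h1, h2⟩ := TauSpace.exists_of_equiv (Nat.lt_succ_iff.mp r.2) (Nat.lt_succ_iff.mp r'.2)
      Φ hl hl' hσ hB
    exact ⟨Fin.ext h1, h2⟩
  · rintro ⟨rfl, a, b, π, η, ha, hπ, h⟩
    exact tau_isomorphic_tau hl hl' ha hπ h

end

/-! ### Signed permutations and the rank of `λ` -/

section
variable {s : ℕ} {π : Equiv.Perm (Fin s)} {η : Fin s → ℤˣ}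

theorem SignedPermRel.inner_eq {x y x' y' : EuclideanSpace ℝ (Fin s)} (hx : SignedPermRel π η x x')
    (hy : SignedPermRel π η y y') : inner ℝ x' y' = inner ℝ x y := by
  simp only [PiLp.inner_apply]
  rw [← Equiv.sum_comp π]
  refine Finset.sum_congr rfl fun α _ => ?_
  have := units_cast_mul_self (η α)
  simp only [hx α, hy α, RCLike.inner_apply, conj_trivial]
  linear_combination (x α * y α) * this

theorem SignedPermRel.norm_eq {x x' : EuclideanSpace ℝ (Fin s)} (hx : SignedPermRel π η x x') :
    ‖x'‖ = ‖x‖ := by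
  have := hx.inner_eq hx
  rw [real_inner_self_eq_norm_sq, real_inner_self_eq_norm_sq] at this
  exact (sq_eq_sq₀ (norm_nonneg _) (norm_nonneg _)).mp this

theorem SignedPermRel.units_smul {x x' : EuclideanSpace ℝ (Fin s)} {κ : ℤˣ}
    (hx : SignedPermRel π η (((κ : ℤ) : ℝ) • x) x') : SignedPermRel π (fun α => κ * η α) x x' :=
  fun α => by
    rw [hx α]; simp only [PiLp.smul_apply, smul_eq_mul]; push_cast; ring

theorem exists_units_of_sq_eq_one {a : ℝ} (h : a ^ 2 = 1) : ∃ κ : ℤˣ, a = ((κ : ℤ) : ℝ) := by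
  rcases mul_self_eq_one_iff.mp ((pow_two a).symm.trans h) with h | h
  · exact ⟨1, by simp [h]⟩
  · exact ⟨-1, by simp [h]⟩

/-- The linear independence of the two rows of `λ`. -/
def RowsIndependent (lam : Fin 2 → Fin s → ℝ) : Prop :=
  ∀ x y : ℝ, (∀ α, x * lam 0 α + y * lam 1 α = 0) → x = 0 ∧ y = 0

theorem matrix_rank_eq_two_iff (lam : Fin 2 → Fin s → ℝ) :
    (Matrix.of lam).rank = 2 ↔ RowsIndependent lam := by
  have h1 : RowsIndependent lam ↔ LinearIndependent ℝ (Matrix.of lam).row := by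
    rw [Fintype.linearIndependent_iff]
    constructor
    · intro h g hg i
      have := h (g 0) (g 1) fun α => by simpa [Fin.sum_univ_two] using congrFun hg α
      fin_cases i
      exacts [this.1, this.2]
    · intro h x y hxy
      have := h ![x, y] (by ext α; simpa [Fin.sum_univ_two] using hxy α)
      exact ⟨this 0, this 1⟩
  rw [h1, linearIndependent_iff_card_eq_finrank_span, Fintype.card_fin,
    Matrix.rank_eq_finrank_span_row, eq_comm]
  rfl

theorem matrix_rank_eq_one_iff (hs : 0 < s) {lam : Fin 2 → Fin s → ℝ} (hl : TauSpace.Admissible lam) :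
    (Matrix.of lam).rank = 1 ↔ ¬ RowsIndependent lam := by
  rw [← matrix_rank_eq_two_iff]
  have h2 : (Matrix.of lam).rank ≤ 2 := by
    simpa using (Matrix.of lam).rank_le_card_height
  have h0 : (Matrix.of lam).rank ≠ 0 := by
    rw [Matrix.rank_eq_finrank_span_row, Ne, Submodule.finrank_eq_zero, Submodule.span_eq_bot]
    intro h
    rcases hl ⟨0, hs⟩ with h1 | h1
    · exact h1 (congrFun (h _ ⟨0, rfl⟩) _)
    · exact h1 (congrFun (h _ ⟨1, rfl⟩) _)
  omega

end

/-! ### The two families of parameters -/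

section
variable {n : ℕ} {r r' : Fin (n - 5 + 1)} {lam lam' : Fin 2 → Fin (n - 5) → ℝ}

theorem SymmetricTriple.Isomorphic.rowsIndependent {hl : TauSpace.Admissible lam}
    {hl' : TauSpace.Admissible lam'} (H : (tau n r lam hl).Isomorphic (tau n r' lam' hl'))
    (h : RowsIndependent lam') : RowsIndependent lam := by
  obtain ⟨-, a, b, π, η, ha, -, hη⟩ := (tau_isomorphic_iff hl hl').mp H
  intro x y hxy
  -- A relation between the rows of `λ` is carried to one for `λ'` by the inverse of the triangular
  -- matrix.
  have h1 := h (x / a) (a ^ 2 * (y - x * b / a)) fun β => by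
    obtain ⟨α, rfl⟩ := π.surjective β
    rw [(hη α).1, (hη α).2]
    have : x / a * (((η α : ℤ) : ℝ) * (a * lam 0 α + b * lam 1 α)) +
        a ^ 2 * (y - x * b / a) * (((η α : ℤ) : ℝ) * ((a ^ 2)⁻¹ * lam 1 α)) =
        ((η α : ℤ) : ℝ) * (x * lam 0 α + y * lam 1 α) := by
      field_simp; ring
    rw [this, hxy, mul_zero]
  have hx : x = 0 := by simpa [ha] using h1.1
  subst hx
  exact ⟨rfl, by simpa [ha] using h1.2⟩

theorem RankOneParam.not_rowsIndependent (p : RankOneParam n) : ¬ RowsIndependent p.lam := by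
  intro h
  have : p.k = 0 ∨ p.k = 1 := by omega
  rcases this with hk | hk
  · exact one_ne_zero (h 0 1 fun α => by simp [RankOneParam.lam, hk]).2
  · exact one_ne_zero (h 1 0 fun α => by simp [RankOneParam.lam, hk]).1

theorem RankTwoParam.rowsIndependent (p : RankTwoParam n) : RowsIndependent p.lam := by
  intro x y h
  have h' : x • p.l₁ + y • p.l₂ = 0 := by
    ext α
    have := h α
    simp only [RankTwoParam.lam, Matrix.cons_val_zero, Matrix.cons_val_one] at this
    have h2 : p.δ * (x * p.l₁ α + y * p.l₂ α) = 0 := by linarith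
    simpa using (mul_eq_zero.mp h2).resolve_left p.δ_pos.ne'
  constructor
  · have := congrArg (fun v => inner ℝ v p.l₁) h'
    simpa [inner_add_left, real_inner_smul_left, p.norm_l₁, real_inner_comm p.l₁ p.l₂, p.inner_eq]
      using this
  · have := congrArg (fun v => inner ℝ v p.l₂) h'
    simpa [inner_add_left, real_inner_smul_left, p.norm_l₂, p.inner_eq] using this

theorem RankOneParam.isomorphic_of_rel {p p' : RankOneParam n} (h : p.Rel p') :
    (tau n p.r p.lam p.admissible).Isomorphic (tau n p'.r p'.lam p'.admissible) := by
  obtain ⟨hr, hk, π, η, hπ, hη⟩ := h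
  refine (tau_isomorphic_iff _ _).mpr ⟨hr, 1, 0, π, η, one_ne_zero, hπ, fun α => ?_⟩
  simp only [RankOneParam.lam, hk, hη α]
  constructor <;> split_ifs <;> simp

theorem RankTwoParam.isomorphic_of_rel {p p' : RankTwoParam n} (h : p.Rel p') :
    (tau n p.r p.lam p.admissible).Isomorphic (tau n p'.r p'.lam p'.admissible) := by
  obtain ⟨hr, hδ, κ, π, η, hπ, h1, h2⟩ := h
  have hκ := units_cast_mul_self κ
  refine (tau_isomorphic_iff _ _).mpr ⟨hr, ((κ : ℤ) : ℝ), 0, π, η, left_ne_zero_of_mul_eq_one hκ, hπ,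
    fun α => ?_⟩
  rw [pow_two, hκ]
  simp only [RankTwoParam.lam, Matrix.cons_val_zero, Matrix.cons_val_one, h1 α, h2 α, hδ,
    PiLp.smul_apply, smul_eq_mul]
  constructor <;> ring

/-- The second row of `λ'` is a non-zero multiple of that of `λ`, up to signed permutation, so `k`
is an invariant. Unit length leaves only a sign, which is absorbed into `η`. -/
theorem RankOneParam.rel_of_isomorphic {p p' : RankOneParam n}
    (H : (tau n p.r p.lam p.admissible).Isomorphic (tau n p'.r p'.lam p'.admissible)) :
    p.Rel p' := by
  obtain ⟨hr, a, b, π, η, ha, hπ, hη⟩ := (tau_isomorphic_iff _ _).mp H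
  have hne : ∀ q : RankOneParam n, q.l ≠ 0 := fun q h => by simpa [h] using q.norm_l
  have hk : p.k = p'.k ∧ ∃ c : ℝ, SignedPermRel π η (c • p.l) p'.l := by
    have e1 : p.k = 0 ∨ p.k = 1 := by omega
    have e2 : p'.k = 0 ∨ p'.k = 1 := by omega
    rcases e1 with e1 | e1 <;> rcases e2 with e2 | e2
    · refine ⟨by rw [e1, e2], a, fun α => ?_⟩
      simpa [RankOneParam.lam, e1, e2] using (hη α).1
    · refine absurd ?_ (hne p')
      ext β
      obtain ⟨α, rfl⟩ := π.surjective β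
      simpa [RankOneParam.lam, e1, e2] using (hη α).2
    · refine absurd ?_ (hne p)
      ext α
      simpa [RankOneParam.lam, e1, e2, ha] using (hη α).2
    · refine ⟨by rw [e1, e2], (a ^ 2)⁻¹, fun α => ?_⟩
      simpa [RankOneParam.lam, e1, e2] using (hη α).2
  obtain ⟨hk, c, hc⟩ := hk
  have hn := hc.norm_eq
  rw [norm_smul, p.norm_l, p'.norm_l, mul_one, Real.norm_eq_abs] at hn
  obtain ⟨κ, rfl⟩ := exists_units_of_sq_eq_one (a := c) (by rw [← sq_abs, ← hn, one_pow])
  exact ⟨hr, hk, π, _, hπ, hc.units_smul⟩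

/-- Orthogonality of both pairs forces `b = 0`. Comparing norms gives `|a| = |a|⁻²`, so `a = ±1`;
hence `δ` is an invariant and only `l₁` is ambiguous in sign. -/
theorem RankTwoParam.rel_of_isomorphic {p p' : RankTwoParam n}
    (H : (tau n p.r p.lam p.admissible).Isomorphic (tau n p'.r p'.lam p'.admissible)) :
    p.Rel p' := by
  obtain ⟨hr, a, b, π, η, ha, hπ, hη⟩ := (tau_isomorphic_iff _ _).mp H
  have hδ := p.δ_pos
  have hδ' := p'.δ_pos
  have h1 : SignedPermRel π η (p.δ • (a • p.l₁ + b • p.l₂)) (p'.δ • p'.l₁) := fun α => by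
    have := (hη α).1
    simp only [RankTwoParam.lam, Matrix.cons_val_zero, Matrix.cons_val_one] at this
    simp only [PiLp.smul_apply, PiLp.add_apply, smul_eq_mul, this]
    ring
  have h2 : SignedPermRel π η (p.δ • (a ^ 2)⁻¹ • p.l₂) (p'.δ • p'.l₂) := fun α => by
    have := (hη α).2
    simp only [RankTwoParam.lam, Matrix.cons_val_one, Matrix.cons_val_zero] at this
    simp only [PiLp.smul_apply, smul_eq_mul, this]
    ring
  have hb : b = 0 := by
    have := h1.inner_eq h2
    simp only [real_inner_smul_left, real_inner_smul_right, inner_add_left, p.inner_eq, p'.inner_eq,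
      real_inner_self_eq_norm_sq, p.norm_l₂] at this
    simpa [hδ.ne', ha] using this
  subst hb
  have n1 := h1.norm_eq
  have n2 := h2.norm_eq
  simp only [zero_smul, add_zero, norm_smul, p.norm_l₁, p.norm_l₂, p'.norm_l₁, p'.norm_l₂, mul_one,
    Real.norm_eq_abs, abs_of_pos hδ, abs_of_pos hδ', abs_inv, abs_pow] at n1 n2
  have ha' : |a| = 1 := by
    have h3 : |a| = (|a| ^ 2)⁻¹ := mul_left_cancel₀ hδ.ne' (n1.symm.trans n2)
    have h4 : |a| ^ 3 = 1 := by
      have h5 := inv_mul_cancel₀ (pow_ne_zero 2 (abs_ne_zero.mpr ha))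
      rw [← h3] at h5
      rw [← h5]; ring
    exact (pow_eq_one_iff_of_nonneg (abs_nonneg a) three_ne_zero).mp h4
  rw [ha', mul_one] at n1
  have ha2 : a ^ 2 = 1 := by rw [← sq_abs, ha', one_pow]
  obtain ⟨κ, rfl⟩ := exists_units_of_sq_eq_one ha2
  refine ⟨hr, n1.symm, κ, π, η, hπ, ?_, ?_⟩
  · have := h1.smul p.δ⁻¹
    rwa [zero_smul, add_zero, n1, inv_smul_smul₀ hδ.ne', inv_smul_smul₀ hδ.ne'] at this
  · have := h2.smul p.δ⁻¹
    rwa [ha2, inv_one, one_smul, n1, inv_smul_smul₀ hδ.ne', inv_smul_smul₀ hδ.ne'] at this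

/-- Each `α` with `v α ≠ 0` excludes a single value of `t`. -/
theorem exists_forall_add_mul_ne_zero {s : ℕ} (u v : Fin s → ℝ) (h : ∀ α, u α ≠ 0 ∨ v α ≠ 0) :
    ∃ t : ℝ, ∀ α, u α + t * v α ≠ 0 := by
  obtain ⟨t, ht⟩ := Infinite.exists_notMem_finset (Finset.univ.image fun α => -u α / v α)
  refine ⟨t, fun α h0 => ?_⟩
  by_cases hv : v α = 0
  · exact (h α).resolve_right (not_not.mpr hv) (by simpa [hv] using h0)
  · refine ht (Finset.mem_image.mpr ⟨α, Finset.mem_univ α, ?_⟩)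
    rw [div_eq_iff hv]; linarith

theorem exists_param_isomorphic (hn : 6 ≤ n) (hl : TauSpace.Admissible lam) :
    (∃ p : RankOneParam n, (tau n r lam hl).Isomorphic (tau n p.r p.lam p.admissible)) ∨
    ∃ p : RankTwoParam n, (tau n r lam hl).Isomorphic (tau n p.r p.lam p.admissible) := by
  let x : EuclideanSpace ℝ (Fin (n - 5)) := WithLp.toLp 2 (lam 0)
  let y : EuclideanSpace ℝ (Fin (n - 5)) := WithLp.toLp 2 (lam 1)
  have hx : ∀ α, lam 0 α = x α := fun α => rfl
  have hy : ∀ α, lam 1 α = y α := fun α => rfl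
  let α₀ : Fin (n - 5) := ⟨0, by omega⟩
  by_cases hy0 : y = 0
  · have hx0 : ∀ α, x α ≠ 0 := fun α => (hl α).resolve_right fun h => h (by rw [hy, hy0]; rfl)
    have hxn : ‖x‖ ≠ 0 := norm_ne_zero_iff.mpr fun h => hx0 α₀ (by rw [h]; rfl)
    refine Or.inl ⟨⟨r, 0, ‖x‖⁻¹ • x, ?_, ?_⟩, (tau_isomorphic_iff _ _).mpr ⟨rfl, ‖x‖⁻¹, 0, 1, 1,
      inv_ne_zero hxn, fun α => Iff.rfl, fun α => ?_⟩⟩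
    · rw [norm_smul, norm_inv, norm_norm, inv_mul_cancel₀ hxn]
    · simpa [hxn] using hx0
    · simp [RankOneParam.lam, hx, hy, hy0]
  have hyn : ‖y‖ ≠ 0 := norm_ne_zero_iff.mpr hy0
  -- Gram-Schmidt on the rows: `z` is the part of `λ_1` orthogonal to `λ_2`, and its vanishing
  -- distinguishes rank one from rank two.
  obtain ⟨c, hc⟩ : ∃ c : ℝ, inner ℝ (x + c • y) y = 0 := by
    refine ⟨-inner ℝ x y / ‖y‖ ^ 2, ?_⟩
    rw [inner_add_left, real_inner_smul_left, real_inner_self_eq_norm_sq]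
    field_simp; ring
  set z := x + c • y with hz
  have hzα : ∀ α, z α = x α + c * y α := fun α => rfl
  by_cases hz0 : z = 0
  · have hy1 : ∀ α, y α ≠ 0 := fun α h => by
      have h1 := hzα α
      rw [hz0, h] at h1
      rcases hl α with h2 | h2
      · exact h2 (by rw [hx]; simpa using h1.symm)
      · exact h2 h
    -- Here `a = √‖y‖` gives `a⁻² = ‖y‖⁻¹`, and `b = a c` annihilates the first row.
    refine Or.inl ⟨⟨r, 1, ‖y‖⁻¹ • y, ?_, ?_⟩, (tau_isomorphic_iff _ _).mpr ⟨rfl, √‖y‖, √‖y‖ * c, 1, 1,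
      (Real.sqrt_pos.mpr (norm_pos_iff.mpr hy0)).ne', fun α => Iff.rfl, fun α => ?_⟩⟩
    · rw [norm_smul, norm_inv, norm_norm, inv_mul_cancel₀ hyn]
    · simpa [hyn] using hy1
    · have h1 := hzα α
      rw [hz0] at h1
      have h2 : x α + c * y α = 0 := by simpa using h1.symm
      constructor
      · simp only [RankOneParam.lam, hx, hy]
        simp
        linear_combination (-√‖y‖) * h2
      · simp [RankOneParam.lam, hy]
  · have hzn : ‖z‖ ≠ 0 := norm_ne_zero_iff.mpr hz0
    have hzp := norm_pos_iff.mpr hz0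
    have hyp := norm_pos_iff.mpr hy0
    -- The cube root is the solution of `a ‖z‖ = a⁻² ‖y‖`, which gives both new rows the same length
    -- `δ`.
    obtain ⟨a, ha, ha3⟩ : ∃ a : ℝ, 0 < a ∧ a ^ 3 = ‖y‖ / ‖z‖ :=
      ⟨(‖y‖ / ‖z‖) ^ (((3 : ℕ) : ℝ)⁻¹), by positivity,
        Real.rpow_inv_natCast_pow (by positivity) three_ne_zero⟩
    have hay : (a ^ 2)⁻¹ = a * ‖z‖ * ‖y‖⁻¹ := by
      have : a ^ 3 * ‖z‖ = ‖y‖ := by rw [ha3]; field_simp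
      rw [← this]
      field_simp
    obtain ⟨t, ht⟩ := exists_forall_add_mul_ne_zero (fun α => z α) (fun α => y α) fun α => by
      by_contra! hcon
      have h1 := hzα α
      rw [hcon.1, hcon.2] at h1
      rcases hl α with h2 | h2
      · exact h2 (by rw [hx]; simpa using h1.symm)
      · exact h2 hcon.2
    refine Or.inr ⟨⟨r, a * ‖z‖, ‖z‖⁻¹ • z, ‖y‖⁻¹ • y, by positivity, ?_, ?_, ?_, fun hsub => ?_⟩,
      (tau_isomorphic_iff _ _).mpr ⟨rfl, a, a * c, 1, 1, ha.ne', fun α => Iff.rfl, fun α => ?_⟩⟩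
    · rw [norm_smul, norm_inv, norm_norm, inv_mul_cancel₀ hzn]
    · rw [norm_smul, norm_inv, norm_norm, inv_mul_cancel₀ hyn]
    · rw [real_inner_smul_left, real_inner_smul_right, hc, mul_zero, mul_zero]
    · have hm : z + t • y ∈ Submodule.span ℝ {‖z‖⁻¹ • z, ‖y‖⁻¹ • y} :=
        Submodule.mem_span_pair.mpr ⟨‖z‖, t * ‖y‖, by
          rw [smul_inv_smul₀ hzn, mul_smul, smul_inv_smul₀ hyn]⟩
      obtain ⟨α, hα⟩ := Set.mem_iUnion.mp (hsub hm)
      exact ht α hα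
    · constructor
      · simp [RankTwoParam.lam, hx, hy, hzα]
        field_simp
      · simp [RankTwoParam.lam, hy, hay]
        ring

end

/-! ### The bijection with isomorphism classes -/

theorem exists_moduli_equiv {n : ℕ} (hn : 6 ≤ n) :
    ∃ e : RankOneModuli n ⊕ RankTwoModuli n ≃
        {c : SymmetricTriple.IsoClass // ∃ τ : SymmetricTriple.{0}, τ.IsTypeIIa n ∧ ⟦τ⟧ = c},
      (∀ p : RankOneParam n, (e (Sum.inl ⟦p⟧)).1 = ⟦tau n p.r p.lam p.admissible⟧) ∧
      (∀ p : RankTwoParam n, (e (Sum.inr ⟦p⟧)).1 = ⟦tau n p.r p.lam p.admissible⟧) := by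
  have hn5 : 5 ≤ n := by omega
  let T := {c : SymmetricTriple.IsoClass // ∃ τ : SymmetricTriple.{0}, τ.IsTypeIIa n ∧ ⟦τ⟧ = c}
  let f₁ : RankOneModuli n → T := Quotient.lift
    (fun p => ⟨⟦tau n p.r p.lam p.admissible⟧, _, tau_isTypeIIa p.admissible hn5, rfl⟩)
    fun p p' h => Subtype.ext (Quotient.sound (RankOneParam.isomorphic_of_rel h))
  let f₂ : RankTwoModuli n → T := Quotient.lift
    (fun p => ⟨⟦tau n p.r p.lam p.admissible⟧, _, tau_isTypeIIa p.admissible hn5, rfl⟩)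
    fun p p' h => Subtype.ext (Quotient.sound (RankTwoParam.isomorphic_of_rel h))
  -- The families are disjoint because independence of the rows of `λ` is an isomorphism invariant.
  have hcross : ∀ (p : RankOneParam n) (p' : RankTwoParam n),
      ¬ (tau n p.r p.lam p.admissible).Isomorphic (tau n p'.r p'.lam p'.admissible) :=
    fun p p' H => p.not_rowsIndependent (H.rowsIndependent p'.rowsIndependent)
  have hbij : Function.Bijective (Sum.elim f₁ f₂) := by
    constructor
    · rintro (x | x) (y | y) h <;> induction x using Quotient.inductionOn with | _ p => ?_ <;>
        induction y using Quotient.inductionOn with | _ p' => ?_ <;>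
        have H := Quotient.exact (congrArg Subtype.val h)
      · exact congrArg Sum.inl (Quotient.sound (RankOneParam.rel_of_isomorphic H))
      · exact absurd H (hcross p p')
      · exact absurd (SymmetricTriple.Isomorphic.symm H) (hcross p' p)
      · exact congrArg Sum.inr (Quotient.sound (RankTwoParam.rel_of_isomorphic H))
    · rintro ⟨c, τ, hτ, rfl⟩
      obtain ⟨r, lam, hl, H⟩ := hτ.exists_isomorphic_tau hn5
      rcases exists_param_isomorphic (r := r) hn hl with ⟨p, hp⟩ | ⟨p, hp⟩
      · exact ⟨Sum.inl ⟦p⟧, Subtype.ext (Quotient.sound (H.trans hp).symm)⟩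
      · exact ⟨Sum.inr ⟦p⟧, Subtype.ext (Quotient.sound (H.trans hp).symm)⟩
  exact ⟨Equiv.ofBijective _ hbij, fun p => rfl, fun p => rfl⟩

theorem mainTheorem6 (n : ℕ) (hn : 5 ≤ n) :
    (∀ τ : SymmetricTriple.{u}, τ.IsTypeIIa n →
      ∃ (r : Fin (n - 5 + 1)) (lam : Fin 2 → Fin (n - 5) → ℝ) (hl : TauSpace.Admissible lam),
        τ.Isomorphic (tau n r lam hl)) ∧
    (∀ (r : Fin (n - 5 + 1)) (lam : Fin 2 → Fin (n - 5) → ℝ) (hl : TauSpace.Admissible lam),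
      (tau n r lam hl).IsTypeIIa n ∧ LieAlgebra.IsSolvable (tau n r lam hl).g) ∧
    (6 ≤ n →
      ∃ e : RankOneModuli n ⊕ RankTwoModuli n ≃
          {c : SymmetricTriple.IsoClass // ∃ τ : SymmetricTriple.{0}, τ.IsTypeIIa n ∧ ⟦τ⟧ = c},
        (∀ p : RankOneParam n, (e (Sum.inl ⟦p⟧)).1 = ⟦tau n p.r p.lam p.admissible⟧) ∧
        (∀ p : RankTwoParam n, (e (Sum.inr ⟦p⟧)).1 = ⟦tau n p.r p.lam p.admissible⟧) ∧
        (∀ (r : Fin (n - 5 + 1)) (lam : Fin 2 → Fin (n - 5) → ℝ) (hl : TauSpace.Admissible lam),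
          ((Matrix.of lam).rank = 1 ↔ ∃ x, (e (Sum.inl x)).1 = ⟦tau n r lam hl⟧) ∧
          ((Matrix.of lam).rank = 2 ↔ ∃ x, (e (Sum.inr x)).1 = ⟦tau n r lam hl⟧))) := by
  refine ⟨fun τ hτ => hτ.exists_isomorphic_tau hn,
    fun r lam hl => ⟨tau_isTypeIIa hl hn, TauSpace.isSolvable⟩, fun hn6 => ?_⟩
  obtain ⟨e, he₁, he₂⟩ := exists_moduli_equiv hn6
  refine ⟨e, he₁, he₂, fun r lam hl => ?_⟩
  rw [matrix_rank_eq_one_iff (by omega) hl, matrix_rank_eq_two_iff]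
  have h₁ : (∃ x, (e (Sum.inl x)).1 = ⟦tau n r lam hl⟧) → ¬ RowsIndependent lam := by
    rintro ⟨x, hx⟩ h
    induction x using Quotient.inductionOn with | _ p => ?_
    rw [he₁] at hx
    have H := Quotient.exact hx
    exact p.not_rowsIndependent (SymmetricTriple.Isomorphic.rowsIndependent H h)
  have h₂ : (∃ x, (e (Sum.inr x)).1 = ⟦tau n r lam hl⟧) → RowsIndependent lam := by
    rintro ⟨x, hx⟩
    induction x using Quotient.inductionOn with | _ p => ?_
    rw [he₂] at hx
    have H := SymmetricTriple.Isomorphic.symm (Quotient.exact hx)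
    exact SymmetricTriple.Isomorphic.rowsIndependent H p.rowsIndependent
  -- Every normal form lies in one of the families, so the one-sided implications `h₁` and `h₂`
  -- become equivalences.
  have h₃ : (∃ x, (e (Sum.inl x)).1 = ⟦tau n r lam hl⟧) ∨
      ∃ x, (e (Sum.inr x)).1 = ⟦tau n r lam hl⟧ := by
    rcases exists_param_isomorphic (r := r) hn6 hl with ⟨p, hp⟩ | ⟨p, hp⟩
    · exact Or.inl ⟨⟦p⟧, (he₁ p).trans (Quotient.sound hp.symm)⟩
    · exact Or.inr ⟨⟦p⟧, (he₂ p).trans (Quotient.sound hp.symm)⟩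
  exact ⟨⟨fun h => h₃.resolve_right fun h' => h (h₂ h'), h₁⟩,
    ⟨fun h => h₃.resolve_left fun h' => h₁ h' h, h₂⟩⟩
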